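/- Let $p$ be a prime, $k$ a field of characteristic $p$, and $G$ a finite group; all modules are finitely generated. A $kG$-module is a *$p$-permutation module* if its restriction to every $p$-subgroup of $G$ is a permutation module. An *endotrivial complex* is a bounded chain complex $C$ of $p$-permutation $kG$-modules such that $C^*\otimes_k C$ is homotopy equivalent to $k[0]$, the trivial module in degree $0$. For a $kG$-module $M$ and a $p$-subgroup $P$ of $G$, the *Brauer construction* is the $k[N_G(P)/P]$-module $M(P) = M^P/\sum_{Q<P}\operatorname{tr}_Q^P(M^Q)$, where $\operatorname{tr}_Q^P(m)=\sum_{x\in[P/Q]}xm$; it is a functor and is applied to chain complexes degreewise. For $\omega\in\operatorname{Hom}(G,k^\times)$ let $k_\omega$ be the one-dimensional $kG$-module on which $g$ acts as $\omega(g)$, and let $k_\omega[0]$ be this module regarded as a complex in degree $0$. The set $\mathcal{E}_k(G)$ of homotopy classes of endotrivial complexes is an abelian group under $[C]+[D]=[C\otimes_k D]$. If $C$ is endotrivial and $P$ is a $p$-subgroup of $G$, then $C(P)$ has nonzero homology in exactly one degree, denoted $h_C(P)$ (the *h-mark* of $C$ at $P$), and $H_{h_C(P)}(C(P))$ is one-dimensional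 over $k$, hence given by a character $\mathcal{H}_C(P)\in\operatorname{Hom}(N_G(P)/P,k^\times)$. Both depend only on $[C]$, the function $h_C$ is constant on conjugacy classes of $p$-subgroups, and the maps $$h\colon \mathcal{E}_k(G)\to \Bigl(\prod_{P}\mathbb{Z}\Bigr)^G,\ [C]\mapsto h_C,\qquad \Xi\colon \mathcal{E}_k(G)\to\prod_{P}\bigl(\mathbb{Z}\times\operatorname{Hom}(N_G(P)/P,k^\times)\bigr),\ [C]\mapsto (h_C(P),\mathcal{H}_C(P))_P$$ (products over all $p$-subgroups $P$ of $G$) are group homomorphisms. Moreover: 1. $\ker h=\{[k_\omega[0]] \mid \omega\in\operatorname{Hom}(G,k^\times)\}$. 2. $\Xi$ is injective. In particular, given integers $(x_P)_P$ and $\rho\in\operatorname{Hom}(G,k^\times)$, there is at most one element $(a_P,\rho_P)_P$ in the image of $\Xi$ with $\rho_1=\rho$ and $a_P=x_P$ for all $P$. 3. $\mathcal{E}_k(G)$ is finitely generated, its $\mathbb{Z}$-rank is at most the number of conjugacy classes of $p$-subgroups of $G$, and $\omega\mapsto[k_\omega[0]]$ is an isomorphism from $\operatorname{Hom}(G,k^\times)$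 onto the torsion subgroup of $\mathcal{E}_k(G)$. -/

import Mathlib

open CategoryTheory CategoryTheory.Limits

universe u v

namespace EndotrivialComplexes

noncomputable section

/-! ### Subgroups of prime power order -/

/-- The set `s_p(G)` of `p`-subgroups of `G`. -/
abbrev PSubgroup (p : ℕ) (G : Type v) [Group G] : Type v := {P : Subgroup G // IsPGroup p P}

/-- Two `p`-subgroups of `G` are equivalent if they are conjugate in `G`. -/
def conjSetoid (p : ℕ) (G : Type v) [Group G] : Setoid (PSubgroup p G) where
  r P Q := ∃ g : G, P.1.map (MulAut.conj g).toMonoidHom = Q.1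
  iseqv :=
    { refl := fun P => ⟨1, by ext; simp [Subgroup.mem_map]⟩
      symm := by
        rintro P Q ⟨g, hg⟩
        refine ⟨g⁻¹, ?_⟩
        rw [← hg]
        ext x
        simp [Subgroup.mem_map, mul_assoc]
      trans := by
        rintro P Q R ⟨g, hg⟩ ⟨g', hg'⟩
        refine ⟨g' * g, ?_⟩
        rw [← hg', ← hg]
        ext x
        simp [Subgroup.mem_map, mul_assoc] }

/-- The additive group `C(G,p)` of integer valued functions on the `p`-subgroups of `G`
which are constant on conjugacy classes. -/
def classFunctions (p : ℕ) (G : Type v) [Group G] : AddSubgroup (PSubgroup p G → ℤ) where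
  carrier := {f | ∀ P Q, (conjSetoid p G).r P Q → f P = f Q}
  zero_mem' := fun _ _ _ => rfl
  add_mem' := fun hf hg P Q h => congrArg₂ (· + ·) (hf P Q h) (hg P Q h)
  neg_mem' := fun hf P Q h => congrArg (- ·) (hf P Q h)

/-- The normalizer `N_G(P)`. -/
abbrev Nor {G : Type v} [Group G] (P : Subgroup G) : Subgroup G :=
  Subgroup.normalizer (P : Set G)

/-- `P` as a subgroup of its normalizer. -/
abbrev inNor {G : Type v} [Group G] (P : Subgroup G) : Subgroup (Nor P) := P.subgroupOf (Nor P)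

/-- The group `N_G(P)/P`. -/
abbrev LocalGroup {G : Type v} [Group G] (P : Subgroup G) : Type v := Nor P ⧸ inNor P

/-! ### `p`-permutation modules -/

section Modules

variable {k : Type u} [Field k] {G : Type v} [Group G]

/-- A (finitely generated) permutation module: some finite `k`-basis is permuted by the group. -/
def IsPermutation {H : Type v} [Group H] {V : Type u} [AddCommGroup V] [Module k V]
    (ρ : Representation k H V) : Prop :=
  ∃ (n : ℕ) (b : Module.Basis (Fin n) k V), ∀ (h : H) (i : Fin n), ∃ j : Fin n, ρ h (b i) = b j

/-- A (finitely generated) `p`-permutation module: the restriction to every `p`-subgroup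
is a permutation module. -/
def IsPPermutation (p : ℕ) (M : Rep.{u} k G) : Prop :=
  ∀ P : Subgroup G, IsPGroup p P → IsPermutation (M.ρ.comp P.subtype)

/-! ### The Brauer construction -/

/-- The fixed points `M^P`. -/
def fixedPts (P : Subgroup G) (M : Rep.{u} k G) : Submodule k M :=
  Representation.invariants (M.ρ.comp P.subtype)

lemma mem_fixedPts (P : Subgroup G) (M : Rep.{u} k G) (m : M) :
    m ∈ fixedPts P M ↔ ∀ g ∈ P, M.ρ g m = m := by
  simp [fixedPts, Representation.mem_invariants]

/-- The trace `tr_Q^P(m) = ∑_{x ∈ [P/Q]} x m`; for `m ∈ M^Q` it does not depend on the choice of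
the representatives. (Used for finite groups only, where the sum is a finite one.) -/
def traceElt (Q P : Subgroup G) (M : Rep.{u} k G) (m : M) : M :=
  ∑ᶠ x : P ⧸ Q.subgroupOf P, M.ρ (x.out : P) m

/-- The sum `∑_{Q < P} tr_Q^P(M^Q)`. -/
def traceSub (P : Subgroup G) (M : Rep.{u} k G) : Submodule k M :=
  Submodule.span k {y | ∃ Q : Subgroup G, Q < P ∧ ∃ m ∈ fixedPts Q M, y = traceElt Q P M m}

lemma fixedPts_le_comap (P : Subgroup G) (M : Rep.{u} k G) (g : Nor P) :
    fixedPts P M ≤ (fixedPts P M).comap ((M.ρ.comp (Nor P).subtype) g) := by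
  intro m hm
  rw [Submodule.mem_comap, mem_fixedPts]
  intro x hx
  rw [mem_fixedPts] at hm
  have h1 : (g : G)⁻¹ * x * g ∈ P := by
    have := (Subgroup.mem_normalizer_iff.1 (inv_mem g.2) x).1 hx
    simpa using this
  have h2 := hm _ h1
  have : M.ρ x (M.ρ g m) = M.ρ g (M.ρ ((g : G)⁻¹ * x * g) m) := by
    rw [← Module.End.mul_apply, ← Module.End.mul_apply, ← map_mul, ← map_mul]
    congr 2
    group
  change M.ρ x (M.ρ g m) = M.ρ g m
  rw [this, h2]

/-- The action of `N_G(P)` on `M^P`. -/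
def fixedRep (P : Subgroup G) (M : Rep.{u} k G) : Representation k (Nor P) (fixedPts P M) :=
  Representation.subrepresentation (M.ρ.comp (Nor P).subtype) (fixedPts P M)
    (fixedPts_le_comap P M)

@[simp]
lemma coe_fixedRep (P : Subgroup G) (M : Rep.{u} k G) (g : Nor P) (m : fixedPts P M) :
    (fixedRep P M g m : M) = M.ρ g (m : M) := rfl

lemma traceElt_map {M N : Rep.{u} k G} [Finite G] (f : M ⟶ N) (Q P : Subgroup G) (m : M) :
    f.hom (traceElt Q P M m) = traceElt Q P N (f.hom m) := by
  unfold traceElt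
  rw [← AddMonoidHom.coe_coe f.hom, AddMonoidHom.map_finsum _ (Set.toFinite _)]
  refine finsum_congr fun x => ?_
  exact Rep.hom_comm_apply f _ _

/-- The trace may be computed with any map choosing representatives. -/
lemma traceElt_eq (M : Rep.{u} k G) {Q P : Subgroup G} {m : M} (hm : m ∈ fixedPts Q M)
    (s : P ⧸ Q.subgroupOf P → P) (hs : ∀ x, (s x : P ⧸ Q.subgroupOf P) = x) :
    traceElt Q P M m = ∑ᶠ x : P ⧸ Q.subgroupOf P, M.ρ (s x : P) m := by
  unfold traceElt
  refine finsum_congr fun x => ?_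
  have h : ((x.out : P) : P ⧸ Q.subgroupOf P) = (s x : P ⧸ Q.subgroupOf P) := by
    rw [hs]; exact Quotient.out_eq' x
  rw [QuotientGroup.eq, Subgroup.mem_subgroupOf] at h
  rw [mem_fixedPts] at hm
  have h2 := congrArg (M.ρ ((x.out : P) : G)) (hm _ h)
  rw [← Module.End.mul_apply, ← map_mul] at h2
  rw [← h2]
  congr 2
  simp

lemma traceSub_le_comap [Finite G] (P : Subgroup G) (M : Rep.{u} k G) (g : Nor P) :
    traceSub P M ≤ (traceSub P M).comap (M.ρ (g : G)) := by
  refine Submodule.span_le.2 ?_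
  rintro _ ⟨Q, hQ, m, hm, rfl⟩
  have hP : P.map (MulAut.conj (g : G)).toMonoidHom = P :=
    Subgroup.mem_normalizer_iff_map_conj_eq.1 g.2
  set Q' : Subgroup G := Q.map (MulAut.conj (g : G)).toMonoidHom with hQ'
  have hlt : Q' < P := by
    rw [← hP]
    exact (Subgroup.map_lt_map_iff_of_injective (MulAut.conj (g : G)).injective).2 hQ
  have hm' : M.ρ (g : G) m ∈ fixedPts Q' M := by
    rw [mem_fixedPts] at hm ⊢
    rintro _ ⟨q, hq, rfl⟩
    have : (MulAut.conj (g : G)).toMonoidHom q * g = g * q := by simp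
    rw [← Module.End.mul_apply, ← map_mul, this, map_mul, Module.End.mul_apply, hm q hq]
  refine Submodule.subset_span ⟨Q', hlt, M.ρ (g : G) m, hm', ?_⟩
  let c : P ≃* P := P.normalizerMonoidHom g
  have hc : ∀ x : P, ((c x : P) : G) = g * x * (g : G)⁻¹ := fun x => rfl
  let e : P ⧸ Q.subgroupOf P ≃ P ⧸ Q'.subgroupOf P := by
    refine Quotient.congr c.toEquiv fun a b => ?_
    refine Quotient.eq.symm.trans (Iff.trans ?_ Quotient.eq)
    change ((a : P ⧸ Q.subgroupOf P) = b) ↔ ((c a : P ⧸ Q'.subgroupOf P) = c b)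
    rw [QuotientGroup.eq, QuotientGroup.eq, Subgroup.mem_subgroupOf, Subgroup.mem_subgroupOf,
      ← map_inv, ← map_mul, hc]
    exact (Subgroup.mem_map_iff_mem (MulAut.conj (g : G)).injective).symm
  have he : ∀ x : P, e (x : P ⧸ Q.subgroupOf P) = (c x : P ⧸ Q'.subgroupOf P) := fun x => rfl
  rw [traceElt_eq M hm' (fun y => c (e.symm y).out)]
  · rw [traceElt, ← AddMonoidHom.coe_coe (M.ρ (g : G)),
      AddMonoidHom.map_finsum _ (Set.toFinite _), ← finsum_comp_equiv e]
    refine finsum_congr fun x => ?_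
    change M.ρ (g : G) (M.ρ (x.out : P) m) = M.ρ (c (e.symm (e x)).out : P) (M.ρ (g : G) m)
    rw [e.symm_apply_apply, hc, ← Module.End.mul_apply, ← map_mul, ← Module.End.mul_apply,
      ← map_mul, inv_mul_cancel_right]
  · intro y
    rw [← he]
    have := Quotient.out_eq' (e.symm y)
    exact (congrArg e this).trans (e.apply_symm_apply y)

/-- `∑_{Q < P} tr_Q^P(M^Q)` as a subspace of `M^P`. -/
def traceFixed (P : Subgroup G) (M : Rep.{u} k G) : Submodule k (fixedPts P M) :=
  (traceSub P M).comap (fixedPts P M).subtype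

variable [Finite G]

/-- The action of `N_G(P)` on `M(P) = M^P / ∑_{Q < P} tr_Q^P(M^Q)`. -/
def brauerRep (P : Subgroup G) (M : Rep.{u} k G) :
    Representation k (Nor P) (fixedPts P M ⧸ traceFixed P M) :=
  (fixedRep P M).quotient (traceFixed P M) fun g _ hm => traceSub_le_comap P M g hm

instance (P : Subgroup G) (M : Rep.{u} k G) :
    Representation.IsTrivial ((brauerRep P M).comp (inNor P).subtype) where
  out := by
    rintro ⟨g, hg⟩
    refine LinearMap.ext fun m => ?_
    obtain ⟨m, rfl⟩ := Submodule.Quotient.mk_surjective _ m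
    have h : fixedRep P M g m = m := Subtype.ext ((mem_fixedPts P M m).1 m.2 _ hg)
    exact congrArg (Submodule.Quotient.mk (p := traceFixed P M)) h

/-- The Brauer construction `M(P)`, a `k[N_G(P)/P]`-module. -/
def brauerObj (P : Subgroup G) (M : Rep.{u} k G) : Rep.{u} k (LocalGroup P) :=
  Rep.of ((brauerRep P M).ofQuotient (inNor P))

/-- The map `M^P → N^P` induced by a homomorphism `M → N`. -/
def fixedMap (P : Subgroup G) {M N : Rep.{u} k G} (f : M ⟶ N) :
    fixedPts P M →ₗ[k] fixedPts P N :=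
  f.hom.toLinearMap.restrict fun m hm => by
    rw [mem_fixedPts] at hm ⊢
    intro g hg
    change N.ρ g (f.hom m) = f.hom m
    rw [← Rep.hom_comm_apply, hm g hg]

lemma traceFixed_le_comap (P : Subgroup G) {M N : Rep.{u} k G} (f : M ⟶ N) :
    traceFixed P M ≤ (traceFixed P N).comap (fixedMap P f) := by
  have h : traceSub P M ≤ (traceSub P N).comap f.hom.toLinearMap := by
    refine Submodule.span_le.2 ?_
    rintro _ ⟨Q, hQ, m, hm, rfl⟩
    exact Submodule.subset_span ⟨Q, hQ, f.hom m, (fixedMap Q f ⟨m, hm⟩).2, traceElt_map f Q P m⟩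
  intro m hm
  exact h hm

/-- The map `M(P) → N(P)` induced by a homomorphism `M → N`. -/
def brauerMap (P : Subgroup G) {M N : Rep.{u} k G} (f : M ⟶ N) : brauerObj P M ⟶ brauerObj P N :=
  Rep.ofHom
    { toLinearMap := (traceFixed P M).mapQ (traceFixed P N) (fixedMap P f)
        (traceFixed_le_comap P f)
      isIntertwining' := by
        intro g
        obtain ⟨g, rfl⟩ := QuotientGroup.mk_surjective g
        refine LinearMap.ext fun m => ?_
        obtain ⟨m, rfl⟩ := Submodule.Quotient.mk_surjective _ m
        refine congrArg (Submodule.Quotient.mk (p := traceFixed P N)) (Subtype.ext ?_)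
        exact Rep.hom_comm_apply f (g : G) m }

/-- The Brauer construction as a functor from `kG`-modules to `k[N_G(P)/P]`-modules. -/
def brauer (P : Subgroup G) : Rep.{u} k G ⥤ Rep.{u} k (LocalGroup P) where
  obj := brauerObj P
  map := brauerMap P
  map_id M := by
    refine Rep.hom_ext (DFunLike.ext _ _ fun m => ?_)
    obtain ⟨m, rfl⟩ := Submodule.Quotient.mk_surjective _ m
    rfl
  map_comp f g := by
    refine Rep.hom_ext (DFunLike.ext _ _ fun m => ?_)
    obtain ⟨m, rfl⟩ := Submodule.Quotient.mk_surjective _ m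
    rfl

instance (P : Subgroup G) : (brauer (k := k) P).Additive where
  map_add {M N f g} := by
    refine Rep.hom_ext (DFunLike.ext _ _ fun m => ?_)
    obtain ⟨m, rfl⟩ := Submodule.Quotient.mk_surjective _ m
    rfl

end Modules

/-! ### Chain complexes -/

section Complexes

/-- The sign convention for tensor products of `ℤ`-graded chain complexes: the differential on
`C_i ⊗ D_j` is `c_i ⊗ id + (-1)^i id ⊗ d_j`. -/
instance : (ComplexShape.down ℤ).TensorSigns where
  ε' := MonoidHom.mk' (fun i => Int.negOnePow (Multiplicative.toAdd i))
    fun i j => Int.negOnePow_add (Multiplicative.toAdd i) (Multiplicative.toAdd j)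
  rel_add p q r (hpq : q + 1 = p) := by
    change q + r + 1 = p + r
    omega
  add_rel p q r (hpq : q + 1 = p) := by
    change r + q + 1 = r + p
    omega
  ε'_succ := by
    rintro p q rfl
    change Int.negOnePow q = - Int.negOnePow (q + 1)
    rw [Int.negOnePow_succ, neg_neg]

variable {k : Type u} [Field k] {G : Type v} [Group G]

/-- The tensor product `C ⊗_k D` of chain complexes of `kG`-modules. -/
def tensor (C D : ChainComplex (Rep.{u} k G) ℤ) : ChainComplex (Rep.{u} k G) ℤ :=
  HomologicalComplex.tensorObj C D

/-- The dual `M^* = Hom_k(M, k)` of a `kG`-module, with `(g f)(m) = f(g⁻¹ m)`. -/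
def dualObj (M : Rep.{u} k G) : Rep.{u} k G := Rep.of M.ρ.dual

/-- The dual `N^* → M^*` of a homomorphism `M → N`. -/
def dualMap {M N : Rep.{u} k G} (f : M ⟶ N) : dualObj N ⟶ dualObj M :=
  Rep.ofHom
    { toLinearMap := f.hom.toLinearMap.dualMap
      isIntertwining' := by
        intro g
        refine LinearMap.ext fun φ => LinearMap.ext fun m => ?_
        exact congrArg φ (Rep.hom_comm_apply f g⁻¹ m).symm }

lemma dualMap_zero (M N : Rep.{u} k G) : dualMap (0 : M ⟶ N) = 0 := by
  refine Rep.hom_ext (DFunLike.ext _ _ fun φ => ?_)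
  exact LinearMap.ext fun m => map_zero (show N →ₗ[k] k from φ)

lemma dualMap_comp {L M N : Rep.{u} k G} (f : L ⟶ M) (g : M ⟶ N) :
    dualMap (f ≫ g) = dualMap g ≫ dualMap f := rfl

/-- The dual complex `C^* = Hom_k(C, k[0])`: it has `(C_{-n})^*` in degree `n`, and the
differential leaving degree `n` is `(-1)^{n+1}` times the dual of `C_{-n+1} → C_{-n}`. -/
def dual (C : ChainComplex (Rep.{u} k G) ℤ) : ChainComplex (Rep.{u} k G) ℤ where
  X n := dualObj (C.X (-n))
  d i j := Int.negOnePow (i + 1) • dualMap (C.d (-j) (-i))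
  shape i j h := by
    have h' : ¬ (ComplexShape.down ℤ).Rel (-j) (-i) := by
      intro h'
      apply h
      change -i + 1 = -j at h'
      change j + 1 = i
      omega
    rw [C.shape _ _ h', dualMap_zero, smul_zero]
  d_comp_d' i j l _ _ := by
    rw [Linear.units_smul_comp, Linear.comp_units_smul, ← dualMap_comp, C.d_comp_d, dualMap_zero,
      smul_zero, smul_zero]

/-- The complex `M[0]` with `M` in degree `0` and zero elsewhere. -/
abbrev inDegreeZero (M : Rep.{u} k G) : ChainComplex (Rep.{u} k G) ℤ :=
  (HomologicalComplex.single (Rep.{u} k G) (ComplexShape.down ℤ) 0).obj M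

/-- The one-dimensional `kG`-module `k_ω` given by a linear character `ω`. -/
def oneDim (ω : G →* kˣ) : Rep.{u} k G :=
  Rep.of (X := k) (((Algebra.lmul k k : k →ₐ[k] Module.End k k) : k →* Module.End k k).comp
    ((Units.coeHom k).comp ω))

/-- Endotrivial complexes of `p`-permutation `kG`-modules: bounded complexes `C` of
(finitely generated) `p`-permutation modules such that `C^* ⊗_k C` is homotopy equivalent to the
trivial module in degree `0`. -/
structure IsEndotrivial (p : ℕ) (C : ChainComplex (Rep.{u} k G) ℤ) : Prop where
  bounded : ∃ a b : ℤ, ∀ i : ℤ, i < a ∨ b < i → IsZero (C.X i)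
  pPermutation : ∀ i : ℤ, IsPPermutation p (C.X i)
  endotrivial : Nonempty (HomotopyEquiv (tensor (dual C) C) (inDegreeZero (Rep.trivial k G k)))

variable (k G) (p : ℕ) in
/-- Homotopy equivalence of endotrivial complexes. -/
def htpySetoid : Setoid {C : ChainComplex (Rep.{u} k G) ℤ // IsEndotrivial p C} where
  r C D := Nonempty (HomotopyEquiv C.1 D.1)
  iseqv :=
    { refl := fun C => ⟨HomotopyEquiv.refl C.1⟩
      symm := fun ⟨e⟩ => ⟨e.symm⟩
      trans := fun ⟨e⟩ ⟨f⟩ => ⟨e.trans f⟩ }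

variable (k G) (p : ℕ) in
/-- The set `E_k(G)` of homotopy classes of endotrivial complexes. -/
def EndotrivialClasses : Type (max (u + 1) v) := _root_.Quotient (htpySetoid k G p)

/-- `IsClass C x` says that the complex `C` is endotrivial and that `x = [C]`. -/
def IsClass {p : ℕ} (C : ChainComplex (Rep.{u} k G) ℤ) (x : EndotrivialClasses k G p) : Prop :=
  ∃ hC : IsEndotrivial p C, _root_.Quotient.mk (htpySetoid k G p) ⟨C, hC⟩ = x

/-- The homology `H_i(C(P))`, a `k[N_G(P)/P]`-module. -/
def localHomology [Finite G] (C : ChainComplex (Rep.{u} k G) ℤ) (P : Subgroup G) (i : ℤ) :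
    Rep.{u} k (LocalGroup P) :=
  (((brauer P).mapHomologicalComplex (ComplexShape.down ℤ)).obj C).homology i

variable (k G) (p : ℕ) in
/-- The group `∏_P ℤ × Hom(N_G(P)/P, kˣ)`, the product being over all `p`-subgroups `P`. -/
abbrev LocalData : Type (max u v) :=
  (P : PSubgroup p G) → ℤ × Additive (LocalGroup P.1 →* kˣ)

end Complexes

end

end EndotrivialComplexes

open EndotrivialComplexes

/-! The tensor product makes the homotopy classes of all complexes of `kG`-modules a commutative
monoid. The endotrivial classes form a submonoid in which `[C^*]` is inverse to `[C]` by definition;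
closure rests on the isomorphisms `C ≅ C^{**}` and `C^* ⊗ D^* ≅ (C ⊗ D)^*` for bounded complexes of
finite-dimensional modules.

The h-marks exist because the Brauer construction is monoidal on `p`-permutation modules: the
`P`-fixed vectors of a permuted basis give a basis of `M(P)` (`brauerBasis`), hence `M(P) ⊗ N(P) ≅
(M ⊗ N)(P)` (`brauerMul_bijective`). Over the field `k`, two fragments of the Künneth theorem then
suffice: products of non-boundaries are non-boundaries (`not_isBoundary_externalProduct`), and
tensoring with an acyclic complex gives an acyclic one (`isBoundary_tensor_of_acyclic`). Since `C^*
⊗ C` has the homology of `k[0]`, they force the homology of `C(P)` to be a line in a single degree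
(`exists_hasMark`). Products of spanning cycles show that degrees add and characters multiply.

The core is the kernel of `h`. Suppose all marks are `0`. In a negative degree, vanishing of the
homology of `C(Q)` for every `p`-subgroup `Q` makes every `Q`-fixed cycle the boundary of a
`Q`-fixed element, by induction on the order of `Q` (`exists_fixed_boundary`). Maps out of a
`p`-permutation module lift as soon as they lift on such fixed points: lift orbit by orbit for a
Sylow subgroup, then average (`exists_lift`). So `C` contracts equivariantly in negative degrees,
and the same argument for `C^*` contracts it in positive degrees. What remains is the
one-dimensional homology in degree `0`, a module `k_ω` (`exists_htpyClass_eq_oneDim`).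

The rest is formal. The character at the trivial subgroup recovers `ω`, so `Ξ` is injective. The
kernel of `h` is the image of the finite group `Hom(G, kˣ)`, and the target of `h` embeds in a free
abelian group of rank the number of classes of `p`-subgroups; this gives finite generation, the rank
bound and the torsion. -/

namespace EndotrivialComplexes
noncomputable section
open MonoidalCategory
-- Tensor products of complexes and the monoid of homotopy classes
section TensorProduct

variable {k : Type u} [Field k] {G : Type v} [Group G]

/-- The inclusion of the summand `C_i ⊗ D_j` of `(C ⊗ D)_n`, where `i + j = n`. -/
def tensorι (C D : ChainComplex (Rep.{u} k G) ℤ) (i j n : ℤ) (h : i + j = n) :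
    C.X i ⊗ D.X j ⟶ (tensor C D).X n :=
  HomologicalComplex.ιTensorObj C D i j n h

/-- The morphism out of `(C ⊗ D)_n` with given restrictions to the summands. -/
def tensorDesc {C D : ChainComplex (Rep.{u} k G) ℤ} {n : ℤ} {A : Rep.{u} k G}
    (f : ∀ i j : ℤ, i + j = n → (C.X i ⊗ D.X j ⟶ A)) : (tensor C D).X n ⟶ A :=
  HomologicalComplex.mapBifunctorDesc (K₁ := C) (K₂ := D) (F := curriedTensor (Rep.{u} k G))
    (c := ComplexShape.down ℤ) f

@[simp]
lemma tensorι_desc {C D : ChainComplex (Rep.{u} k G) ℤ} {n : ℤ} {A : Rep.{u} k G}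
    (f : ∀ i j : ℤ, i + j = n → (C.X i ⊗ D.X j ⟶ A)) (i j : ℤ) (h : i + j = n) :
    tensorι C D i j n h ≫ tensorDesc f = f i j h :=
  HomologicalComplex.ι_mapBifunctorDesc (K₁ := C) (K₂ := D)
    (F := curriedTensor (Rep.{u} k G)) (c := ComplexShape.down ℤ) f i j h

@[simp]
lemma tensorι_desc_assoc {C D : ChainComplex (Rep.{u} k G) ℤ} {n : ℤ} {A B : Rep.{u} k G}
    (f : ∀ i j : ℤ, i + j = n → (C.X i ⊗ D.X j ⟶ A)) (i j : ℤ) (h : i + j = n) (g : A ⟶ B) :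
    tensorι C D i j n h ≫ tensorDesc f ≫ g = f i j h ≫ g := by
  rw [← Category.assoc, tensorι_desc]

lemma tensor_hom_ext {C D : ChainComplex (Rep.{u} k G) ℤ} {n : ℤ} {A : Rep.{u} k G}
    {f g : (tensor C D).X n ⟶ A}
    (h : ∀ i j (h : i + j = n), tensorι C D i j n h ≫ f = tensorι C D i j n h ≫ g) : f = g :=
  HomologicalComplex.mapBifunctor.hom_ext (K₁ := C) (K₂ := D)
    (F := curriedTensor (Rep.{u} k G)) (c := ComplexShape.down ℤ) h

lemma tensorι_d (C D : ChainComplex (Rep.{u} k G) ℤ) (i i' j j' n m : ℤ)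
    (h : i + j = n) (hi : i' + 1 = i) (hj : j' + 1 = j) (hm : m + 1 = n) :
    tensorι C D i j n h ≫ (tensor C D).d n m =
      C.d i i' ▷ D.X j ≫ tensorι C D i' j m (by omega) +
        Int.negOnePow i • (C.X i ◁ D.d j j' ≫ tensorι C D i j' m (by omega)) := by
  refine (Preadditive.comp_add _ _ _ (HomologicalComplex.ιTensorObj C D i j n h)
    (HomologicalComplex.mapBifunctor.D₁ C D (curriedTensor _) (ComplexShape.down ℤ) n m)
    (HomologicalComplex.mapBifunctor.D₂ C D (curriedTensor _) (ComplexShape.down ℤ) n m)).trans ?_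
  refine congrArg₂ (· + ·) ?_ ?_
  · refine (HomologicalComplex.mapBifunctor.ι_D₁ C D (curriedTensor _)
      (ComplexShape.down ℤ) n m i j h).trans ?_
    refine (HomologicalComplex.mapBifunctor.d₁_eq C D (curriedTensor _)
      (ComplexShape.down ℤ) (i₁ := i) (i₁' := i') hi j m (by change i' + j = m; omega)).trans ?_
    exact one_smul _ _
  · refine (HomologicalComplex.mapBifunctor.ι_D₂ C D (curriedTensor _)
      (ComplexShape.down ℤ) n m i j h).trans ?_
    exact (HomologicalComplex.mapBifunctor.d₂_eq C D (curriedTensor _)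
      (ComplexShape.down ℤ) i (i₂ := j) (i₂' := j') hj m (by change i + j' = m; omega))

/-- The symmetry `C ⊗ D → D ⊗ C`. -/
def tensorBraid (C D : ChainComplex (Rep.{u} k G) ℤ) : tensor C D ⟶ tensor D C where
  f n := tensorDesc fun i j h => Int.negOnePow (i * j) • ((β_ (C.X i) (D.X j)).hom ≫
    tensorι D C j i n (by omega))
  comm' n m hnm := by
    change m + 1 = n at hnm
    refine tensor_hom_ext fun i j h => ?_
    rw [tensorι_desc_assoc, ← Category.assoc,
      tensorι_d C D i (i - 1) j (j - 1) n m h (by omega) (by omega) hnm,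
      Linear.units_smul_comp, Category.assoc,
      tensorι_d D C j (j - 1) i (i - 1) n m (by omega) (by omega) (by omega) hnm,
      Preadditive.add_comp, Linear.units_smul_comp, Category.assoc, Category.assoc,
      tensorι_desc, tensorι_desc, Preadditive.comp_add, Linear.comp_units_smul,
      Linear.comp_units_smul, Linear.comp_units_smul, smul_add, smul_smul, smul_smul, add_comm,
      BraidedCategory.braiding_naturality_left_assoc,
      BraidedCategory.braiding_naturality_right_assoc, ← Int.negOnePow_add, ← Int.negOnePow_add,
      -- The Koszul sign `(-1)^(ij)` is compatible with the differentials because `ij + j` and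
      -- `(i-1)j` agree modulo 2 and `ij = i + i(j-1)`.
      (Int.negOnePow_eq_iff (i * j + j) ((i - 1) * j)).2 ⟨j, by ring⟩,
      (Int.negOnePow_eq_iff (i * j) (i + i * (j - 1))).2 ⟨0, by ring⟩]

lemma tensorBraid_comp (C D : ChainComplex (Rep.{u} k G) ℤ) :
    tensorBraid C D ≫ tensorBraid D C = 𝟙 _ := by
  ext1 n
  refine tensor_hom_ext fun i j h => ?_
  rw [HomologicalComplex.comp_f]
  dsimp only [tensorBraid]
  rw [tensorι_desc_assoc, Linear.units_smul_comp, Category.assoc, tensorι_desc,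
    Linear.comp_units_smul, smul_smul, SymmetricCategory.symmetry_assoc, ← Int.negOnePow_add,
    HomologicalComplex.id_f, Category.comp_id,
    Int.negOnePow_even _ ⟨i * j, by ring⟩, one_smul]

/-- The isomorphism `C ⊗ D ≅ D ⊗ C`. -/
def tensorComm (C D : ChainComplex (Rep.{u} k G) ℤ) : tensor C D ≅ tensor D C where
  hom := tensorBraid C D
  inv := tensorBraid D C
  hom_inv_id := tensorBraid_comp C D
  inv_hom_id := tensorBraid_comp D C

/-- The isomorphism `(C ⊗ D) ⊗ E ≅ C ⊗ (D ⊗ E)`. -/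
def tensorAssoc (C D E : ChainComplex (Rep.{u} k G) ℤ) :
    tensor (tensor C D) E ≅ tensor C (tensor D E) :=
  HomologicalComplex.associator C D E

/-- The isomorphism `k[0] ⊗ C ≅ C`. -/
def tensorUnitIso (C : ChainComplex (Rep.{u} k G) ℤ) :
    tensor (inDegreeZero (Rep.trivial k G k)) C ≅ C :=
  HomologicalComplex.leftUnitor C

/-- The tensor product of two chain maps. -/
def tensorMap {C C' D D' : ChainComplex (Rep.{u} k G) ℤ} (f : C ⟶ C') (g : D ⟶ D') :
    tensor C D ⟶ tensor C' D' :=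
  HomologicalComplex.tensorHom f g

lemma tensorι_map {C C' D D' : ChainComplex (Rep.{u} k G) ℤ} (f : C ⟶ C') (g : D ⟶ D')
    (i j n : ℤ) (h : i + j = n) :
    tensorι C D i j n h ≫ (tensorMap f g).f n =
      f.f i ▷ D.X j ≫ C'.X i ◁ g.f j ≫ tensorι C' D' i j n h :=
  HomologicalComplex.ι_mapBifunctorMap f g (curriedTensor _) (ComplexShape.down ℤ) i j n h

lemma tensorι_map_assoc {C C' D D' : ChainComplex (Rep.{u} k G) ℤ} (f : C ⟶ C') (g : D ⟶ D')
    (i j n : ℤ) (h : i + j = n) {A : Rep.{u} k G} (φ : (tensor C' D').X n ⟶ A) :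
    tensorι C D i j n h ≫ (tensorMap f g).f n ≫ φ =
      f.f i ▷ D.X j ≫ C'.X i ◁ g.f j ≫ tensorι C' D' i j n h ≫ φ := by
  rw [← Category.assoc, tensorι_map, Category.assoc, Category.assoc]

lemma tensorMap_id (C D : ChainComplex (Rep.{u} k G) ℤ) : tensorMap (𝟙 C) (𝟙 D) = 𝟙 _ := by
  ext1 n
  refine tensor_hom_ext fun i j h => ?_
  rw [tensorι_map]
  simp

lemma tensorMap_comp {C C' C'' D : ChainComplex (Rep.{u} k G) ℤ} (f : C ⟶ C') (f' : C' ⟶ C'') :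
    tensorMap (f ≫ f') (𝟙 D) = tensorMap f (𝟙 D) ≫ tensorMap f' (𝟙 D) := by
  ext1 n
  refine tensor_hom_ext fun i j h => ?_
  rw [tensorι_map, HomologicalComplex.comp_f (tensorMap f _), tensorι_map_assoc, tensorι_map]
  simp

/-- Tensoring with `D` preserves homotopy equivalences. -/
def tensorHomotopyEquiv {C C' : ChainComplex (Rep.{u} k G) ℤ} (e : HomotopyEquiv C C')
    (D : ChainComplex (Rep.{u} k G) ℤ) : HomotopyEquiv (tensor C D) (tensor C' D) where
  hom := tensorMap e.hom (𝟙 D)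
  inv := tensorMap e.inv (𝟙 D)
  homotopyHomInvId := (Homotopy.ofEq (tensorMap_comp _ _).symm).trans
    ((HomologicalComplex.mapBifunctorMapHomotopy₁ e.homotopyHomInvId (𝟙 D) (curriedTensor _)
      (ComplexShape.down ℤ)).trans (Homotopy.ofEq (tensorMap_id _ _)))
  homotopyInvHomId := (Homotopy.ofEq (tensorMap_comp _ _).symm).trans
    ((HomologicalComplex.mapBifunctorMapHomotopy₁ e.homotopyInvHomId (𝟙 D) (curriedTensor _)
      (ComplexShape.down ℤ)).trans (Homotopy.ofEq (tensorMap_id _ _)))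

variable (k G) in
/-- Homotopy equivalence of complexes of `kG`-modules. -/
def complexSetoid : Setoid (ChainComplex (Rep.{u} k G) ℤ) where
  r C D := Nonempty (HomotopyEquiv C D)
  iseqv :=
    { refl := fun C => ⟨HomotopyEquiv.refl C⟩
      symm := fun ⟨e⟩ => ⟨e.symm⟩
      trans := fun ⟨e⟩ ⟨f⟩ => ⟨e.trans f⟩ }

variable (k G) in
/-- The commutative monoid of homotopy classes of complexes of `kG`-modules. -/
def ComplexClasses : Type (max (u + 1) v) := _root_.Quotient (complexSetoid k G)

/-- The homotopy class of a complex. -/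
def htpyClass (C : ChainComplex (Rep.{u} k G) ℤ) : ComplexClasses k G :=
  _root_.Quotient.mk (complexSetoid k G) C

lemma htpyClass_eq_iff {C D : ChainComplex (Rep.{u} k G) ℤ} :
    htpyClass C = htpyClass D ↔ Nonempty (HomotopyEquiv C D) :=
  Quotient.eq (r := complexSetoid k G)

lemma htpyClass_eq_of_iso {C D : ChainComplex (Rep.{u} k G) ℤ} (e : C ≅ D) :
    htpyClass C = htpyClass D :=
  htpyClass_eq_iff.2 ⟨HomotopyEquiv.ofIso e⟩

lemma htpyClass_tensor_comm (C D : ChainComplex (Rep.{u} k G) ℤ) :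
    htpyClass (tensor C D) = htpyClass (tensor D C) :=
  htpyClass_eq_of_iso (tensorComm C D)

/-- Homotopy invariance is needed in the left factor only; commutativity carries it to the right
one. -/
lemma htpyClass_tensor_congr {C C' D D' : ChainComplex (Rep.{u} k G) ℤ}
    (h : htpyClass C = htpyClass C') (h' : htpyClass D = htpyClass D') :
    htpyClass (tensor C D) = htpyClass (tensor C' D') := by
  have key : ∀ {A A' : ChainComplex (Rep.{u} k G) ℤ} (B), htpyClass A = htpyClass A' →
      htpyClass (tensor A B) = htpyClass (tensor A' B) := fun B hA => by
    obtain ⟨e⟩ := htpyClass_eq_iff.1 hA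
    exact htpyClass_eq_iff.2 ⟨tensorHomotopyEquiv e B⟩
  rw [key D h, htpyClass_tensor_comm, key C' h', htpyClass_tensor_comm]

instance : Add (ComplexClasses k G) where
  add := _root_.Quotient.map₂ tensor fun _ _ h _ _ h' =>
    Quotient.exact (htpyClass_tensor_congr (Quotient.sound h) (Quotient.sound h'))

instance : Zero (ComplexClasses k G) where
  zero := htpyClass (inDegreeZero (Rep.trivial k G k))

instance : AddCommMonoid (ComplexClasses k G) where
  add_assoc := by
    rintro ⟨C⟩ ⟨D⟩ ⟨E⟩
    exact htpyClass_eq_of_iso (tensorAssoc C D E)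
  zero_add := by
    rintro ⟨C⟩
    exact htpyClass_eq_of_iso (tensorUnitIso C)
  add_zero := by
    rintro ⟨C⟩
    exact (htpyClass_tensor_comm _ _).trans (htpyClass_eq_of_iso (tensorUnitIso C))
  add_comm := by
    rintro ⟨C⟩ ⟨D⟩
    exact htpyClass_tensor_comm C D
  nsmul := nsmulRec

lemma htpyClass_tensor (C D : ChainComplex (Rep.{u} k G) ℤ) :
    htpyClass (tensor C D) = htpyClass C + htpyClass D := rfl

lemma htpyClass_unit : htpyClass (inDegreeZero (Rep.trivial k G k)) = 0 := rfl

end TensorProduct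

/-! ### Direct sum decomposition of the terms of a tensor product -/

section TensorSummands

variable {k : Type u} [Field k] {G : Type v} [Group G]

/-- The projection of `(C ⊗ D)_n` onto the summand `C_i ⊗ D_j`, where `i + j = n`. -/
def tensorπ (C D : ChainComplex (Rep.{u} k G) ℤ) (i j n : ℤ) (h : i + j = n) :
    (tensor C D).X n ⟶ C.X i ⊗ D.X j :=
  tensorDesc fun i' j' h' => if e : i' = i then
    (C.XIsoOfEq e).hom ⊗ₘ (D.XIsoOfEq (by omega : j' = j)).hom else 0

lemma tensorι_π_self (C D : ChainComplex (Rep.{u} k G) ℤ) (i j n : ℤ) (h : i + j = n) :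
    tensorι C D i j n h ≫ tensorπ C D i j n h = 𝟙 _ := by
  simp [tensorπ, HomologicalComplex.XIsoOfEq]

lemma tensorι_π_of_ne (C D : ChainComplex (Rep.{u} k G) ℤ) (i j i' j' n : ℤ) (h : i + j = n)
    (h' : i' + j' = n) (hne : i ≠ i') :
    tensorι C D i j n h ≫ tensorπ C D i' j' n h' = 0 := by
  simp [tensorπ, hne]

lemma tensorι_π_self_assoc (C D : ChainComplex (Rep.{u} k G) ℤ) (i j n : ℤ) (h : i + j = n)
    {A : Rep.{u} k G} (φ : C.X i ⊗ D.X j ⟶ A) :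
    tensorι C D i j n h ≫ tensorπ C D i j n h ≫ φ = φ := by
  rw [← Category.assoc, tensorι_π_self, Category.id_comp]

lemma tensorι_π_of_ne_assoc (C D : ChainComplex (Rep.{u} k G) ℤ) (i j i' j' n : ℤ) (h : i + j = n)
    (h' : i' + j' = n) (hne : i ≠ i') {A : Rep.{u} k G} (φ : C.X i' ⊗ D.X j' ⟶ A) :
    tensorι C D i j n h ≫ tensorπ C D i' j' n h' ≫ φ = 0 := by
  rw [← Category.assoc, tensorι_π_of_ne _ _ _ _ _ _ _ _ _ hne, zero_comp]

/-- The coordinate form of `tensorι_d`: among the summands of degree `n`, only those with first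
index `i` or `i'` map nontrivially to the summand `(i', j')`. -/
lemma tensor_d_π (C D : ChainComplex (Rep.{u} k G) ℤ) (i i' j j' n m : ℤ)
    (h : i' + j' = m) (hi : i' + 1 = i) (hj : j' + 1 = j) (hm : m + 1 = n) :
    (tensor C D).d n m ≫ tensorπ C D i' j' m h =
      tensorπ C D i j' n (by omega) ≫ C.d i i' ▷ D.X j' +
        Int.negOnePow i' • (tensorπ C D i' j n (by omega) ≫ C.X i' ◁ D.d j j') := by
  refine tensor_hom_ext fun a b hab => ?_
  rw [← Category.assoc, tensorι_d C D a (a - 1) b (b - 1) n m hab (by omega) (by omega) hm,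
    Preadditive.add_comp, Linear.units_smul_comp, Category.assoc, Category.assoc,
    Preadditive.comp_add, Linear.comp_units_smul]
  by_cases h1 : a = i
  · obtain rfl : b = j' := by omega
    obtain rfl : i' = a - 1 := by omega
    subst h1
    rw [tensorι_π_self, tensorι_π_self_assoc, tensorι_π_of_ne _ _ _ _ _ _ _ _ _ (by omega),
      tensorι_π_of_ne_assoc _ _ _ _ _ _ _ _ _ (by omega)]
    simp
  by_cases h2 : a = i'
  · obtain rfl : j' = b - 1 := by omega
    obtain rfl : b = j := by omega
    subst h2
    rw [tensorι_π_self, tensorι_π_self_assoc, tensorι_π_of_ne _ _ _ _ _ _ _ _ _ (by omega),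
      tensorι_π_of_ne_assoc _ _ _ _ _ _ _ _ _ (by omega)]
    simp
  rw [tensorι_π_of_ne _ _ _ _ _ _ _ _ _ (by omega), tensorι_π_of_ne _ _ _ _ _ _ _ _ _ (by omega),
    tensorι_π_of_ne_assoc _ _ _ _ _ _ _ _ _ (by omega),
    tensorι_π_of_ne_assoc _ _ _ _ _ _ _ _ _ (by omega)]
  simp

/-- The terms of the complex vanish outside the degrees `a, ..., b`. -/
def BoundedBy (C : ChainComplex (Rep.{u} k G) ℤ) (a b : ℤ) : Prop :=
  ∀ i : ℤ, i < a ∨ b < i → IsZero (C.X i)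

lemma isZero_tensor_left {M : Rep.{u} k G} (h : IsZero M) (N : Rep.{u} k G) :
    IsZero (M ⊗ N : Rep.{u} k G) := by
  rw [Rep.isZero_iff] at h ⊢
  refine subsingleton_of_forall_eq (0 : TensorProduct k M N) fun x => ?_
  induction x using TensorProduct.induction_on with
  | zero => rfl
  | tmul m n => rw [Subsingleton.elim m 0, TensorProduct.zero_tmul]
  | add x y hx hy => rw [hx, hy, add_zero]

lemma isZero_tensor_right (M : Rep.{u} k G) {N : Rep.{u} k G} (h : IsZero N) :
    IsZero (M ⊗ N : Rep.{u} k G) :=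
  (isZero_tensor_left h M).of_iso (β_ M N)

/-- Boundedness of one factor leaves finitely many nonzero summands, so the coproduct is a biproduct
and elements are determined by coordinates. -/
lemma tensor_sum_π_ι {C : ChainComplex (Rep.{u} k G) ℤ} {a b : ℤ} (hC : BoundedBy C a b)
    (D : ChainComplex (Rep.{u} k G) ℤ) (n : ℤ) :
    ∑ i ∈ Finset.Icc a b, tensorπ C D i (n - i) n (by omega) ≫ tensorι C D i (n - i) n (by omega)
      = 𝟙 _ := by
  refine tensor_hom_ext fun i j h => ?_
  rw [Preadditive.comp_sum, Category.comp_id]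
  by_cases hi : i ∈ Finset.Icc a b
  · obtain rfl : j = n - i := by omega
    rw [Finset.sum_eq_single_of_mem i hi fun i' _ hne => by
      rw [tensorι_π_of_ne_assoc _ _ _ _ _ _ _ _ _ hne.symm], tensorι_π_self_assoc]
  · refine (isZero_tensor_left (hC i ?_) _).eq_of_src _ _
    rw [Finset.mem_Icc] at hi
    omega

lemma BoundedBy.tensor {C D : ChainComplex (Rep.{u} k G) ℤ} {a b a' b' : ℤ}
    (hC : BoundedBy C a b) (hD : BoundedBy D a' b') :
    BoundedBy (tensor C D) (a + a') (b + b') := by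
  intro n hn
  rw [IsZero.iff_id_eq_zero]
  refine tensor_hom_ext fun i j h => ?_
  by_cases hi : i < a ∨ b < i
  · exact (isZero_tensor_left (hC i hi) _).eq_of_src _ _
  · exact (isZero_tensor_right _ (hD j (by omega))).eq_of_src _ _

end TensorSummands

/-! ### Duality: compatibility with tensor products and double duals -/

section Dual

variable {k : Type u} [Field k] {G : Type v} [Group G]

lemma dualMap_id (M : Rep.{u} k G) : dualMap (𝟙 M) = 𝟙 _ := rfl

lemma dualMap_add {M N : Rep.{u} k G} (f g : M ⟶ N) : dualMap (f + g) = dualMap f + dualMap g := by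
  refine Rep.hom_ext (DFunLike.ext _ _ fun φ => ?_)
  exact LinearMap.ext fun m => map_add (show N →ₗ[k] k from φ) _ _

/-- Duality as an additive map on morphisms. -/
def dualMapHom (M N : Rep.{u} k G) : (M ⟶ N) →+ (dualObj N ⟶ dualObj M) :=
  AddMonoidHom.mk' dualMap dualMap_add

lemma dualMap_units_smul {M N : Rep.{u} k G} (a : ℤˣ) (f : M ⟶ N) :
    dualMap (a • f) = a • dualMap f :=
  map_zsmul (dualMapHom M N) (a : ℤ) f

lemma dualMap_sum {M N : Rep.{u} k G} {ι : Type*} (s : Finset ι) (f : ι → (M ⟶ N)) :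
    dualMap (∑ i ∈ s, f i) = ∑ i ∈ s, dualMap (f i) :=
  map_sum (dualMapHom M N) f s

lemma isZero_dualObj {M : Rep.{u} k G} (h : IsZero M) : IsZero (dualObj M) := by
  rw [IsZero.iff_id_eq_zero] at h ⊢
  rw [← dualMap_id, h, dualMap_zero]

lemma dual_d (C : ChainComplex (Rep.{u} k G) ℤ) (i j : ℤ) :
    (dual C).d i j = Int.negOnePow (i + 1) • dualMap (C.d (-j) (-i)) := rfl

lemma BoundedBy.dual {C : ChainComplex (Rep.{u} k G) ℤ} {a b : ℤ} (hC : BoundedBy C a b) :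
    BoundedBy (dual C) (-b) (-a) :=
  fun i hi => isZero_dualObj (hC (-i) (by omega))

/-- The canonical equivariant map `M^* ⊗ N^* → (M ⊗ N)^*`. -/
def dualDistribMap (M N : Rep.{u} k G) :
    (M.ρ.dual.tprod N.ρ.dual).IntertwiningMap (M.ρ.tprod N.ρ).dual where
  toLinearMap := TensorProduct.dualDistrib k M N
  isIntertwining' := by
    intro g
    refine TensorProduct.ext' fun φ ψ => ?_
    refine TensorProduct.ext' (R := k) (M := M) (N := N) fun m n => ?_
    rfl

/-- The canonical map `M^* ⊗ N^* → (M ⊗ N)^*`. -/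
def dualTensor (M N : Rep.{u} k G) : dualObj M ⊗ dualObj N ⟶ dualObj (M ⊗ N) :=
  Rep.ofHom (dualDistribMap M N)

lemma dualTensor_naturality_left {M M' : Rep.{u} k G} (f : M ⟶ M') (N : Rep.{u} k G) :
    dualMap f ▷ dualObj N ≫ dualTensor M N = dualTensor M' N ≫ dualMap (f ▷ N) := by
  refine Rep.hom_ext (Representation.IntertwiningMap.ext ?_)
  refine TensorProduct.ext' (R := k) (M := Module.Dual k M') (N := Module.Dual k N) fun φ ψ => ?_
  refine TensorProduct.ext' (R := k) (M := M) (N := N) fun m n => ?_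
  rfl

lemma dualTensor_naturality_right (M : Rep.{u} k G) {N N' : Rep.{u} k G} (f : N ⟶ N') :
    dualObj M ◁ dualMap f ≫ dualTensor M N = dualTensor M N' ≫ dualMap (M ◁ f) := by
  refine Rep.hom_ext (Representation.IntertwiningMap.ext ?_)
  refine TensorProduct.ext' (R := k) (M := Module.Dual k M) (N := Module.Dual k N') fun φ ψ => ?_
  refine TensorProduct.ext' (R := k) (M := M) (N := N) fun m n => ?_
  rfl

lemma isIso_of_bijective {M N : Rep.{u} k G} (f : M ⟶ N) (h : Function.Bijective f.hom) :
    IsIso f := by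
  have := (Rep.mono_iff_injective f).2 h.1
  have := (Rep.epi_iff_surjective f).2 h.2
  exact isIso_of_mono_of_epi f

lemma isIso_dualTensor (M N : Rep.{u} k G) [Module.Finite k M] [Module.Finite k N] :
    IsIso (dualTensor M N) := by
  refine isIso_of_bijective _ ?_
  have h := (TensorProduct.dualDistribEquiv k M N).bijective
  have e : ((TensorProduct.dualDistribEquiv k M N : _ →ₗ[k] _)) =
    TensorProduct.dualDistrib k M N := rfl
  have e' : (TensorProduct.dualDistribEquiv k M N : _ → _) =
    TensorProduct.dualDistrib k M N := congrArg DFunLike.coe e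
  rw [e'] at h
  exact h

/-- The component `(C_{-i})^* ⊗ (D_{-j})^* → ((C ⊗ D)_{-n})^*` of the canonical map
`C^* ⊗ D^* → (C ⊗ D)^*`. -/
def dualTensorComponent (C D : ChainComplex (Rep.{u} k G) ℤ) (i j n : ℤ) (h : i + j = n) :
    (dual C).X i ⊗ (dual D).X j ⟶ (dual (tensor C D)).X n :=
  (Int.negOnePow (i * j) • (dualTensor (C.X (-i)) (D.X (-j)) ≫
    dualMap (tensorπ C D (-i) (-j) (-n) (by omega))) :
      dualObj (C.X (-i)) ⊗ dualObj (D.X (-j)) ⟶ dualObj ((tensor C D).X (-n)))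

lemma dualTensorComponent_d (C D : ChainComplex (Rep.{u} k G) ℤ) (i i' j j' n m : ℤ)
    (h : i + j = n) (hi : i' + 1 = i) (hj : j' + 1 = j) (hm : m + 1 = n) :
    dualTensorComponent C D i j n h ≫ (dual (tensor C D)).d n m =
      (dual C).d i i' ▷ (dual D).X j ≫ dualTensorComponent C D i' j m (by omega) +
        Int.negOnePow i • ((dual C).X i ◁ (dual D).d j j' ≫
          dualTensorComponent C D i j' m (by omega)) := by
  have e1 : (dual C).d i i' ▷ (dual D).X j =
      Int.negOnePow (i + 1) • (dualMap (C.d (-i') (-i)) ▷ dualObj (D.X (-j))) :=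
    ((tensorRight (dualObj (D.X (-j)))).map_zsmul (f := dualMap (C.d (-i') (-i)))
      (r := ((Int.negOnePow (i + 1) : ℤˣ) : ℤ)))
  have e2 : (dual C).X i ◁ (dual D).d j j' =
      Int.negOnePow (j + 1) • (dualObj (C.X (-i)) ◁ dualMap (D.d (-j') (-j))) :=
    ((tensorLeft (dualObj (C.X (-i)))).map_zsmul (f := dualMap (D.d (-j') (-j)))
      (r := ((Int.negOnePow (j + 1) : ℤˣ) : ℤ)))
  rw [e1, e2, dual_d]
  change (Int.negOnePow (i * j) • (dualTensor (C.X (-i)) (D.X (-j)) ≫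
      dualMap (tensorπ C D (-i) (-j) (-n) _))) ≫
      (Int.negOnePow (n + 1) • dualMap ((tensor C D).d (-m) (-n))) =
    (Int.negOnePow (i + 1) • (dualMap (C.d (-i') (-i)) ▷ dualObj (D.X (-j)))) ≫
      (Int.negOnePow (i' * j) • (dualTensor (C.X (-i')) (D.X (-j)) ≫
        dualMap (tensorπ C D (-i') (-j) (-m) _))) +
    Int.negOnePow i • ((Int.negOnePow (j + 1) • (dualObj (C.X (-i)) ◁ dualMap (D.d (-j') (-j)))) ≫
      (Int.negOnePow (i * j') • (dualTensor (C.X (-i)) (D.X (-j')) ≫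
        dualMap (tensorπ C D (-i) (-j') (-m) _))))
  simp only [Linear.units_smul_comp, Linear.comp_units_smul, Category.assoc, smul_smul,
    ← dualMap_comp]
  rw [tensor_d_π C D (-i') (-i) (-j') (-j) (-m) (-n) (by omega) (by omega) (by omega) (by omega),
    dualMap_add, dualMap_units_smul, dualMap_comp, dualMap_comp, Preadditive.comp_add,
    Linear.comp_units_smul, smul_add, smul_smul,
    reassoc_of% (dualTensor_naturality_left (C.d (-i') (-i)) (D.X (-j))),
    reassoc_of% (dualTensor_naturality_right (C.X (-i)) (D.d (-j') (-j)))]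
  simp only [← Int.negOnePow_add]
  obtain rfl : i = i' + 1 := by omega
  obtain rfl : j = j' + 1 := by omega
  obtain rfl : n = m + 1 := by omega
  obtain rfl : m = i' + (j' + 1) := by omega
  -- With everything expressed through `i'` and `j'`, the signs of the three duals, of the tensor
  -- differentials and of the twist `(-1)^(ij)` agree modulo 2 in each of the two terms.
  rw [(Int.negOnePow_eq_iff (i' * (j' + 1) + (i' + 1 + 1))
      (i' + (j' + 1) + 1 + 1 + (i' + 1) * (j' + 1))).2 ⟨-1-j', by ring⟩,
    (Int.negOnePow_eq_iff (i' + 1 + ((i' + 1) * j' + (j' + 1 + 1)))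
      (i' + (j' + 1) + 1 + 1 + (i' + 1) * (j' + 1) + -(i' + 1))).2 ⟨0, by ring⟩]

/-- The canonical chain map `C^* ⊗ D^* → (C ⊗ D)^*`. -/
def dualTensorHom (C D : ChainComplex (Rep.{u} k G) ℤ) :
    tensor (dual C) (dual D) ⟶ dual (tensor C D) where
  f n := tensorDesc fun i j h => dualTensorComponent C D i j n h
  comm' n m hnm := by
    change m + 1 = n at hnm
    refine tensor_hom_ext fun i j h => ?_
    rw [tensorι_desc_assoc, ← Category.assoc,
      tensorι_d _ _ i (i - 1) j (j - 1) n m h (by omega) (by omega) hnm, Preadditive.add_comp,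
      Linear.units_smul_comp, Category.assoc, Category.assoc, tensorι_desc, tensorι_desc,
      dualTensorComponent_d _ _ i (i - 1) j (j - 1) n m h (by omega) (by omega) hnm]

/-- The inverse of `dualTensorHom` on the summand with index `i`. -/
def dualTensorInvComponent (C D : ChainComplex (Rep.{u} k G) ℤ)
    [∀ i j, IsIso (dualTensor (C.X i) (D.X j))] (i j n : ℤ) (h : i + j = n) :
    (dual (tensor C D)).X n ⟶ (dual C).X i ⊗ (dual D).X j :=
  (Int.negOnePow (i * j) • (dualMap (tensorι C D (-i) (-j) (-n) (by omega)) ≫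
    inv (dualTensor (C.X (-i)) (D.X (-j)))) :
      dualObj ((tensor C D).X (-n)) ⟶ dualObj (C.X (-i)) ⊗ dualObj (D.X (-j)))

lemma dualTensorComponent_inv_self (C D : ChainComplex (Rep.{u} k G) ℤ)
    [∀ i j, IsIso (dualTensor (C.X i) (D.X j))] (i j n : ℤ) (h : i + j = n) :
    dualTensorComponent C D i j n h ≫ dualTensorInvComponent C D i j n h = 𝟙 _ := by
  change (Int.negOnePow (i * j) • (dualTensor (C.X (-i)) (D.X (-j)) ≫
      dualMap (tensorπ C D (-i) (-j) (-n) _))) ≫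
      (Int.negOnePow (i * j) • (dualMap (tensorι C D (-i) (-j) (-n) _) ≫
    inv (dualTensor (C.X (-i)) (D.X (-j))))) = 𝟙 _
  rw [Linear.units_smul_comp, Linear.comp_units_smul, smul_smul, Int.units_mul_self, one_smul,
    Category.assoc, ← Category.assoc (dualMap _), ← dualMap_comp, tensorι_π_self, dualMap_id,
    Category.id_comp, IsIso.hom_inv_id]

lemma dualTensorComponent_inv_of_ne (C D : ChainComplex (Rep.{u} k G) ℤ)
    [∀ i j, IsIso (dualTensor (C.X i) (D.X j))] (i j i' j' n : ℤ) (h : i + j = n)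
    (h' : i' + j' = n) (hne : i ≠ i') :
    dualTensorComponent C D i j n h ≫ dualTensorInvComponent C D i' j' n h' = 0 := by
  change (Int.negOnePow (i * j) • (dualTensor (C.X (-i)) (D.X (-j)) ≫
      dualMap (tensorπ C D (-i) (-j) (-n) _))) ≫
      (Int.negOnePow (i' * j') • (dualMap (tensorι C D (-i') (-j') (-n) _) ≫
    inv (dualTensor (C.X (-i')) (D.X (-j'))))) = 0
  rw [Linear.units_smul_comp, Linear.comp_units_smul,
    Category.assoc, ← Category.assoc (dualMap _), ← dualMap_comp,
    tensorι_π_of_ne _ _ _ _ _ _ _ _ _ (by omega), dualMap_zero, zero_comp, comp_zero, smul_zero,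
    smul_zero]

lemma dualTensorInv_component (C D : ChainComplex (Rep.{u} k G) ℤ)
    [∀ i j, IsIso (dualTensor (C.X i) (D.X j))] (i j n : ℤ) (h : i + j = n) :
    dualTensorInvComponent C D i j n h ≫ dualTensorComponent C D i j n h =
      dualMap (tensorπ C D (-i) (-j) (-n) (by omega) ≫
        tensorι C D (-i) (-j) (-n) (by omega)) := by
  change (Int.negOnePow (i * j) • (dualMap (tensorι C D (-i) (-j) (-n) _) ≫
    inv (dualTensor (C.X (-i)) (D.X (-j))))) ≫
    (Int.negOnePow (i * j) • (dualTensor (C.X (-i)) (D.X (-j)) ≫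
      dualMap (tensorπ C D (-i) (-j) (-n) _))) = _
  rw [Linear.units_smul_comp, Linear.comp_units_smul, smul_smul, Int.units_mul_self, one_smul,
    Category.assoc, IsIso.inv_hom_id_assoc, ← dualMap_comp]

/-- In each degree this is the dual of a finite direct sum against the sum of the duals; the inverse
is assembled from the inverses on the summands. -/
lemma isIso_dualTensorHom {C : ChainComplex (Rep.{u} k G) ℤ} {a b : ℤ} (hC : BoundedBy C a b)
    (D : ChainComplex (Rep.{u} k G) ℤ) [∀ i j, IsIso (dualTensor (C.X i) (D.X j))] :
    IsIso (dualTensorHom C D) := by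
  have : ∀ n, IsIso ((dualTensorHom C D).f n) := fun n => by
    refine ⟨∑ i ∈ Finset.Icc (-b) (-a), dualTensorInvComponent C D i (n - i) n (by omega) ≫
      tensorι (dual C) (dual D) i (n - i) n (by omega), ?_, ?_⟩
    · refine tensor_hom_ext fun i j h => ?_
      rw [Category.comp_id, Preadditive.comp_sum, Preadditive.comp_sum]
      dsimp only [dualTensorHom]
      by_cases hi : i ∈ Finset.Icc (-b) (-a)
      · obtain rfl : j = n - i := by omega
        rw [Finset.sum_eq_single_of_mem i hi fun i' _ hne => by
          rw [tensorι_desc_assoc, ← Category.assoc (dualTensorComponent _ _ _ _ _ _),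
            dualTensorComponent_inv_of_ne _ _ _ _ _ _ _ _ _ hne.symm, zero_comp],
          tensorι_desc_assoc, ← Category.assoc (dualTensorComponent _ _ _ _ _ _),
          dualTensorComponent_inv_self, Category.id_comp]
      · refine (isZero_tensor_left (hC.dual i ?_) _).eq_of_src _ _
        rw [Finset.mem_Icc] at hi
        omega
    · rw [Preadditive.sum_comp]
      dsimp only [dualTensorHom]
      have e : ∀ i ∈ Finset.Icc (-b) (-a),
          (dualTensorInvComponent C D i (n - i) n (by omega) ≫
            tensorι (dual C) (dual D) i (n - i) n (by omega)) ≫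
              (tensorDesc fun i j h => dualTensorComponent C D i j n h) =
          dualMap (tensorπ C D (-i) (-(n - i)) (-n) (by omega) ≫
            tensorι C D (-i) (-(n - i)) (-n) (by omega)) := fun i _ => by
        rw [Category.assoc, tensorι_desc, dualTensorInv_component]
      rw [Finset.sum_congr rfl e]
      -- This composite is the dual of the decomposition of the identity of `C ⊗ D` in degree `-n`,
      -- reindexed by `i ↦ -i`.
      refine (dualMap_sum _ _).symm.trans ?_
      refine (congrArg dualMap ?_).trans (dualMap_id _)
      rw [← tensor_sum_π_ι hC D (-n)]
      refine Finset.sum_nbij' (fun i => -i) (fun i => -i) ?_ ?_ ?_ ?_ ?_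
      · intro i hi; rw [Finset.mem_Icc] at hi ⊢; omega
      · intro i hi; rw [Finset.mem_Icc] at hi ⊢; omega
      · intro i _; exact neg_neg i
      · intro i _; exact neg_neg i
      · intro i _
        have e : -(n - i) = -n - -i := by omega
        generalize_proofs h1 h2
        revert h1 h2
        rw [e]
        intros; rfl
  exact HomologicalComplex.Hom.isIso_of_components _

/-- The evaluation map `M → M^{**}`. -/
def dualEval (M : Rep.{u} k G) : M ⟶ dualObj (dualObj M) :=
  Rep.ofHom (ρ := M.ρ) (σ := M.ρ.dual.dual)
    { toLinearMap := Module.Dual.eval k M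
      isIntertwining' := by
        intro g
        refine LinearMap.ext fun m => LinearMap.ext fun φ => ?_
        change φ (M.ρ g m) = φ (M.ρ (g⁻¹)⁻¹ m)
        rw [inv_inv] }

lemma dualEval_naturality {M N : Rep.{u} k G} (f : M ⟶ N) :
    f ≫ dualEval N = dualEval M ≫ dualMap (dualMap f) := rfl

lemma isIso_dualEval (M : Rep.{u} k G) [Module.Finite k M] : IsIso (dualEval M) :=
  isIso_of_bijective _ (Module.evalEquiv k M).bijective

/-- The component `C_n → (C_{-(-n)})^{**}` of the isomorphism `C ≅ C^{**}`. -/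
def doubleDualComponent (C : ChainComplex (Rep.{u} k G) ℤ) (n : ℤ) :
    C.X n ⟶ (dual (dual C)).X n :=
  (Int.negOnePow n • ((C.XIsoOfEq (neg_neg n).symm).hom ≫ dualEval (C.X (- -n))) :
    C.X n ⟶ dualObj (dualObj (C.X (- -n))))

/-- The chain map `C → C^{**}`, which involves the sign `(-1)^n` in degree `n`. -/
def doubleDualHom (C : ChainComplex (Rep.{u} k G) ℤ) : C ⟶ dual (dual C) where
  f n := doubleDualComponent C n
  comm' n m hnm := by
    change m + 1 = n at hnm
    change (Int.negOnePow n • ((C.XIsoOfEq (neg_neg n).symm).hom ≫ dualEval (C.X (- -n)))) ≫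
      (Int.negOnePow (n + 1) • dualMap (Int.negOnePow (-m + 1) • dualMap (C.d (- -n) (- -m)))) =
      C.d n m ≫ (Int.negOnePow m • ((C.XIsoOfEq (neg_neg m).symm).hom ≫ dualEval (C.X (- -m))))
    simp only [Linear.units_smul_comp, Linear.comp_units_smul, Category.assoc, smul_smul,
      dualMap_units_smul, ← dualEval_naturality, ← Int.negOnePow_add]
    rw [HomologicalComplex.XIsoOfEq_hom_comp_d_assoc,
      HomologicalComplex.d_comp_XIsoOfEq_hom_assoc]
    -- Dualizing twice multiplies the differential by `(-1)^(n-m) = -1`, which the alternating sign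
    -- of the components absorbs.
    congr 1
    rw [Int.negOnePow_eq_iff]
    exact ⟨n + 1 - m, by ring⟩

lemma isIso_units_smul {M N : Rep.{u} k G} (a : ℤˣ) (f : M ⟶ N) (h : IsIso f) : IsIso (a • f) :=
  ⟨a • inv f, by
    rw [Linear.units_smul_comp, Linear.comp_units_smul, smul_smul, Int.units_mul_self, one_smul,
      IsIso.hom_inv_id], by
    rw [Linear.units_smul_comp, Linear.comp_units_smul, smul_smul, Int.units_mul_self, one_smul,
      IsIso.inv_hom_id]⟩

lemma isIso_doubleDualHom (C : ChainComplex (Rep.{u} k G) ℤ) [∀ i, Module.Finite k (C.X i)] :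
    IsIso (doubleDualHom C) := by
  have : ∀ n, IsIso ((doubleDualHom C).f n) := fun n => by
    have := isIso_dualEval (C.X (- -n))
    have h : IsIso ((C.XIsoOfEq (neg_neg n).symm).hom ≫ dualEval (C.X (- -n))) := inferInstance
    exact isIso_units_smul (Int.negOnePow n) _ h
  exact HomologicalComplex.Hom.isIso_of_components _

end Dual

/-! ### Closure properties of `p`-permutation modules -/

section Permutation

variable {k : Type u} [Field k] {G : Type v} [Group G]

lemma IsPermutation.of_basis {H : Type v} [Group H] {V : Type u} [AddCommGroup V] [Module k V]
    {ρ : Representation k H V} {ι : Type*} [Finite ι] (b : Module.Basis ι k V)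
    (hb : ∀ h i, ∃ j, ρ h (b i) = b j) : IsPermutation ρ := by
  obtain ⟨n, ⟨e⟩⟩ := Finite.exists_equiv_fin ι
  refine ⟨n, b.reindex e, fun h i => ?_⟩
  obtain ⟨j, hj⟩ := hb h (e.symm i)
  exact ⟨e j, by simpa using hj⟩

lemma IsPermutation.finite {H : Type v} [Group H] {V : Type u} [AddCommGroup V] [Module k V]
    {ρ : Representation k H V} (h : IsPermutation ρ) : Module.Finite k V := by
  obtain ⟨n, b, -⟩ := h
  exact Module.Finite.of_basis b

lemma IsPPermutation.finite {p : ℕ} {M : Rep.{u} k G} (h : IsPPermutation p M) :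
    Module.Finite k M :=
  (h ⊥ IsPGroup.of_bot).finite

lemma IsPPermutation.dualObj {p : ℕ} {M : Rep.{u} k G} (h : IsPPermutation p M) :
    IsPPermutation p (dualObj M) := by
  intro P hP
  obtain ⟨n, b, hb⟩ := h P hP
  refine ⟨n, b.dualBasis, fun g i => ?_⟩
  obtain ⟨j, hj⟩ := hb g i
  refine ⟨j, b.ext fun l => ?_⟩
  change b.dualBasis i (M.ρ (g : G)⁻¹ (b l)) = b.dualBasis j (b l)
  obtain ⟨l', hl'⟩ := hb g⁻¹ l
  have hl2 : M.ρ (g : G)⁻¹ (b l) = b l' := hl'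
  have hj2 : M.ρ (g : G)⁻¹ (b j) = b i := by
    have : M.ρ (g : G) (b i) = b j := hj
    rw [← this, Representation.inv_self_apply]
  rw [hl2, b.dualBasis_apply_self, b.dualBasis_apply_self]
  -- The dual basis is permuted like the basis itself: `g⁻¹` sends `b l` to `b i` exactly when `g`
  -- sends `b i` to `b l`.
  have : l' = i ↔ l = j := by
    constructor
    · rintro rfl
      rw [← hj2] at hl2
      exact b.injective ((M.ρ.apply_bijective _).injective hl2)
    · rintro rfl
      rw [hj2] at hl2
      exact (b.injective hl2).symm
  simp [this]

lemma IsPPermutation.tensorObj {p : ℕ} {M N : Rep.{u} k G} (hM : IsPPermutation p M)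
    (hN : IsPPermutation p N) : IsPPermutation p (M ⊗ N) := by
  intro P hP
  obtain ⟨m, b, hb⟩ := hM P hP
  obtain ⟨n, c, hc⟩ := hN P hP
  refine .of_basis (b.tensorProduct c) fun g ⟨i, j⟩ => ?_
  obtain ⟨i', hi'⟩ := hb g i
  obtain ⟨j', hj'⟩ := hc g j
  refine ⟨(i', j'), ?_⟩
  rw [Module.Basis.tensorProduct_apply, Module.Basis.tensorProduct_apply]
  change TensorProduct.map (M.ρ g) (N.ρ g) _ = _
  rw [TensorProduct.map_tmul]
  exact congrArg₂ _ hi' hj'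

lemma IsPPermutation.of_isZero {p : ℕ} {M : Rep.{u} k G} (h : IsZero M) : IsPPermutation p M := by
  intro P _
  have : Subsingleton M := (Rep.isZero_iff _ _ M).1 h
  exact ⟨0, Module.Basis.empty M, fun _ i => i.elim0⟩

lemma IsPPermutation.of_iso {p : ℕ} {M N : Rep.{u} k G} (h : IsPPermutation p M) (e : M ≅ N) :
    IsPPermutation p N := by
  intro P hP
  obtain ⟨n, b, hb⟩ := h P hP
  refine ⟨n, b.map (Representation.equivOfIso e).toLinearEquiv, fun g i => ?_⟩
  obtain ⟨j, hj⟩ := hb g i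
  refine ⟨j, ?_⟩
  rw [Module.Basis.map_apply, Module.Basis.map_apply, ← hj]
  exact (Rep.hom_comm_apply e.hom (g : G) (b i)).symm

/-- Evaluation of morphisms at an element. -/
def evalHom {M : Rep.{u} k G} (x : M) (N : Rep.{u} k G) : (M ⟶ N) →+ N :=
  AddMonoidHom.mk' (fun f => f.hom x) fun _ _ => rfl

lemma sum_hom_apply {M N : Rep.{u} k G} {ι : Type*} (s : Finset ι) (f : ι → (M ⟶ N)) (x : M) :
    (∑ i ∈ s, f i).hom x = ∑ i ∈ s, (f i).hom x :=
  map_sum (evalHom x N) f s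

/-- A finite direct sum of `p`-permutation modules is a `p`-permutation module. -/
lemma IsPPermutation.of_sum {p : ℕ} {Z : Rep.{u} k G} {ι : Type*} [Fintype ι] [DecidableEq ι]
    (M : ι → Rep.{u} k G) (hM : ∀ i, IsPPermutation p (M i)) (s : ∀ i, M i ⟶ Z) (r : ∀ i, Z ⟶ M i)
    (h1 : ∀ i, s i ≫ r i = 𝟙 _) (h2 : ∀ i j, i ≠ j → s i ≫ r j = 0)
    (h3 : ∑ i, r i ≫ s i = 𝟙 Z) : IsPPermutation p Z := by
  intro P hP
  choose n b hb using fun i => hM i P hP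
  have h1' : ∀ i x, (r i).hom ((s i).hom x) = x := fun i x =>
    congrArg (fun f : M i ⟶ M i => f.hom x) (h1 i)
  have h2' : ∀ i j, i ≠ j → ∀ x, (r j).hom ((s i).hom x) = 0 := fun i j hij x =>
    congrArg (fun f : M i ⟶ M j => f.hom x) (h2 i j hij)
  have h3' : ∀ z, ∑ i, (s i).hom ((r i).hom z) = z := fun z => by
    have := congrArg (fun f : Z ⟶ Z => f.hom z) h3
    rw [sum_hom_apply] at this
    exact this
  let e : (∀ i, M i) ≃ₗ[k] Z :=
    { toFun := fun x => ∑ i, (s i).hom (x i)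
      invFun := fun z i => (r i).hom z
      map_add' := fun x y => by simp [Finset.sum_add_distrib]
      map_smul' := fun a x => by simp [Finset.smul_sum]
      left_inv := fun x => by
        funext j
        dsimp only
        rw [map_sum, Finset.sum_eq_single j (fun i _ hij => h2' i j hij _) (by simp), h1']
      right_inv := h3' }
  have he : ∀ i x, e (Pi.single (M := fun i => (M i : Type u)) i x) = (s i).hom x := fun i x => by
    change ∑ j, (s j).hom (Pi.single (M := fun i => (M i : Type u)) i x j) = _
    rw [Finset.sum_eq_single i (fun j _ hij => by rw [Pi.single_eq_of_ne hij, map_zero]) (by simp),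
      Pi.single_eq_same]
  refine .of_basis ((Pi.basis b).map e) fun g ⟨i, l⟩ => ?_
  obtain ⟨l', hl'⟩ := hb i g l
  refine ⟨⟨i, l'⟩, ?_⟩
  rw [Module.Basis.map_apply, Module.Basis.map_apply, Pi.basis_apply, Pi.basis_apply, he, he,
    ← hl']
  exact (Rep.hom_comm_apply (s i) (g : G) (b i l)).symm

lemma isPPermutation_tensor {p : ℕ} {C D : ChainComplex (Rep.{u} k G) ℤ} {a b : ℤ}
    (hC : BoundedBy C a b) (hC' : ∀ i, IsPPermutation p (C.X i))
    (hD : ∀ i, IsPPermutation p (D.X i)) (n : ℤ) : IsPPermutation p ((tensor C D).X n) := by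
  classical
  refine IsPPermutation.of_sum (ι := Finset.Icc a b) (fun i => C.X i ⊗ D.X (n - i))
    (fun i => (hC' i).tensorObj (hD _))
    (fun i => tensorι C D i (n - i) n (by omega)) (fun i => tensorπ C D i (n - i) n (by omega))
    (fun i => tensorι_π_self _ _ _ _ _ _)
    (fun i j hij => tensorι_π_of_ne _ _ _ _ _ _ _ _ _ (fun h => hij (Subtype.ext h))) ?_
  rw [← tensor_sum_π_ι hC D n]
  exact Finset.sum_coe_sort (Finset.Icc a b) (fun i => tensorπ C D i (n - i) n (by omega) ≫
    tensorι C D i (n - i) n (by omega))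

end Permutation

/-! ### Duals and tensor products of endotrivial complexes -/

section Group

variable {k : Type u} [Field k] {G : Type v} [Group G] {p : ℕ}

lemma IsEndotrivial.class_dual_add {C : ChainComplex (Rep.{u} k G) ℤ} (h : IsEndotrivial p C) :
    htpyClass (dual C) + htpyClass C = 0 :=
  htpyClass_eq_iff.2 h.endotrivial

lemma IsEndotrivial.finite {C : ChainComplex (Rep.{u} k G) ℤ} (h : IsEndotrivial p C) (i : ℤ) :
    Module.Finite k (C.X i) :=
  (h.pPermutation i).finite

lemma htpyClass_dual_dual {C : ChainComplex (Rep.{u} k G) ℤ} (h : ∀ i, Module.Finite k (C.X i)) :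
    htpyClass (dual (dual C)) = htpyClass C := by
  have := isIso_doubleDualHom C
  exact (htpyClass_eq_of_iso (asIso (doubleDualHom C))).symm

lemma IsEndotrivial.dual {C : ChainComplex (Rep.{u} k G) ℤ} (h : IsEndotrivial p C) :
    IsEndotrivial p (dual C) where
  bounded := by
    obtain ⟨a, b, hab⟩ := h.bounded
    exact ⟨-b, -a, BoundedBy.dual hab⟩
  pPermutation i := (h.pPermutation (-i)).dualObj
  endotrivial := htpyClass_eq_iff.1 <| by
    rw [htpyClass_tensor, htpyClass_dual_dual h.finite, add_comm, h.class_dual_add, htpyClass_unit]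

lemma IsEndotrivial.tensor {C D : ChainComplex (Rep.{u} k G) ℤ} (hC : IsEndotrivial p C)
    (hD : IsEndotrivial p D) : IsEndotrivial p (tensor C D) where
  bounded := by
    obtain ⟨a, b, hab⟩ := hC.bounded
    obtain ⟨a', b', hab'⟩ := hD.bounded
    exact ⟨a + a', b + b', BoundedBy.tensor hab hab'⟩
  pPermutation := by
    obtain ⟨a, b, hab⟩ := hC.bounded
    exact isPPermutation_tensor hab hC.pPermutation hD.pPermutation
  endotrivial := htpyClass_eq_iff.1 <| by
    obtain ⟨a, b, hab⟩ := hC.bounded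
    have := hC.finite
    have := hD.finite
    have : ∀ i j, IsIso (dualTensor (C.X i) (D.X j)) := fun i j => isIso_dualTensor _ _
    have := isIso_dualTensorHom hab D
    -- In the monoid of classes, `[C^*] + [D^*] + [C] + [D]` regroups into two pairs with sum zero.
    rw [htpyClass_tensor, ← htpyClass_eq_of_iso (asIso (dualTensorHom C D)), htpyClass_tensor,
      htpyClass_tensor, add_add_add_comm, hC.class_dual_add, hD.class_dual_add, htpyClass_unit,
      add_zero]

end Group

/-! ### Complexes in degree zero and one-dimensional modules -/

section OneDimensional

variable {k : Type u} [Field k] {G : Type v} [Group G]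

/-- A complex concentrated in degree `0`. -/
lemma nonempty_iso_inDegreeZero {C : ChainComplex (Rep.{u} k G) ℤ} (hC : BoundedBy C 0 0)
    {M : Rep.{u} k G} (e : C.X 0 ≅ M) : Nonempty (C ≅ inDegreeZero M) := by
  have hd : ∀ i, C.d i 0 = 0 := fun i => by
    by_cases hi : i = 0
    · subst hi
      exact C.shape _ _ (by simp)
    · exact (hC i (by omega)).eq_of_src _ _
  have hd' : ∀ i, C.d 0 i = 0 := fun i => by
    by_cases hi : i = 0
    · subst hi
      exact C.shape _ _ (by simp)
    · exact (hC i (by omega)).eq_of_tgt _ _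
  let f : C ⟶ inDegreeZero M := HomologicalComplex.mkHomToSingle e.hom fun i _ => by
    rw [hd, zero_comp]
  let g : inDegreeZero M ⟶ C := HomologicalComplex.mkHomFromSingle e.inv fun i _ => by
    rw [hd', comp_zero]
  refine ⟨⟨f, g, ?_, ?_⟩⟩
  · ext1 i
    by_cases hi : i = 0
    · subst hi
      simp [f, g]
    · exact (hC i (by omega)).eq_of_src _ _
  · refine HomologicalComplex.from_single_hom_ext ?_
    simp [f, g]

lemma boundedBy_inDegreeZero (M : Rep.{u} k G) : BoundedBy (inDegreeZero M) 0 0 :=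
  fun i hi => HomologicalComplex.isZero_single_obj_X _ _ _ _ (by omega)

/-- The term in degree `0` of `M[0]`. -/
def inDegreeZeroX (M : Rep.{u} k G) : (inDegreeZero M).X 0 ≅ M :=
  HomologicalComplex.singleObjXSelf _ _ _

lemma htpyClass_tensor_inDegreeZero (M N : Rep.{u} k G) :
    htpyClass (inDegreeZero M) + htpyClass (inDegreeZero N) = htpyClass (inDegreeZero (M ⊗ N)) := by
  have h : BoundedBy (tensor (inDegreeZero M) (inDegreeZero N)) 0 0 :=
    (boundedBy_inDegreeZero M).tensor (boundedBy_inDegreeZero N)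
  have hs := tensor_sum_π_ι (boundedBy_inDegreeZero M) (inDegreeZero N) 0
  rw [Finset.Icc_self, Finset.sum_singleton] at hs
  let e : (tensor (inDegreeZero M) (inDegreeZero N)).X 0 ≅
      (inDegreeZero M).X 0 ⊗ (inDegreeZero N).X 0 :=
    { hom := tensorπ _ _ 0 0 0 (by omega)
      inv := tensorι _ _ 0 0 0 (by omega)
      hom_inv_id := hs
      inv_hom_id := tensorι_π_self _ _ _ _ _ _ }
  obtain ⟨i⟩ := nonempty_iso_inDegreeZero h (e ≪≫ (inDegreeZeroX M ⊗ᵢ inDegreeZeroX N))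
  exact htpyClass_eq_of_iso i

/-- Isomorphic modules have isomorphic duals. -/
def dualIso {M N : Rep.{u} k G} (e : M ≅ N) : dualObj M ≅ dualObj N where
  hom := dualMap e.inv
  inv := dualMap e.hom
  hom_inv_id := by rw [← dualMap_comp, e.hom_inv_id, dualMap_id]
  inv_hom_id := by rw [← dualMap_comp, e.inv_hom_id, dualMap_id]

lemma htpyClass_dual_inDegreeZero (M : Rep.{u} k G) :
    htpyClass (dual (inDegreeZero M)) = htpyClass (inDegreeZero (dualObj M)) := by
  obtain ⟨i⟩ := nonempty_iso_inDegreeZero (C := dual (inDegreeZero M))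
    (boundedBy_inDegreeZero M).dual (M := dualObj M) (dualIso (inDegreeZeroX M))
  exact htpyClass_eq_of_iso i

lemma htpyClass_inDegreeZero_congr {M N : Rep.{u} k G} (h : Nonempty (M ≅ N)) :
    htpyClass (inDegreeZero M) = htpyClass (inDegreeZero N) := by
  obtain ⟨e⟩ := h
  exact htpyClass_eq_of_iso ((HomologicalComplex.single _ _ 0).mapIso e)

/-- The generator of `k_ω`. -/
def oneDimGen (ω : G →* kˣ) : oneDim ω := (1 : k)

lemma oneDimGen_ne_zero (ω : G →* kˣ) : oneDimGen ω ≠ 0 := one_ne_zero (α := k)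

lemma exists_smul_oneDimGen (ω : G →* kˣ) (x : oneDim ω) : ∃ a : k, a • oneDimGen ω = x :=
  ⟨x, mul_one (M := k) x⟩

lemma oneDim_gen (ω : G →* kˣ) (g : G) : (oneDim ω).ρ g (oneDimGen ω) = (ω g : k) • oneDimGen ω :=
  rfl

lemma oneDim_apply (ω : G →* kˣ) (g : G) (x : oneDim ω) : (oneDim ω).ρ g x = (ω g : k) • x := by
  obtain ⟨a, rfl⟩ := exists_smul_oneDimGen ω x
  rw [map_smul, oneDim_gen, smul_comm]

/-- The morphism `k_ω → M` given by an element `x` of `M` on which `G` acts by `ω`. -/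
def oneDimHom {M : Rep.{u} k G} (ω : G →* kˣ) (x : M) (h : ∀ g, M.ρ g x = (ω g : k) • x) :
    oneDim ω ⟶ M :=
  Rep.ofHom (ρ := (oneDim ω).ρ) (σ := M.ρ)
    { toLinearMap := LinearMap.toSpanSingleton k M x
      isIntertwining' := fun g => LinearMap.ext fun a : k => by
        change ((ω g : k) * a) • x = M.ρ g (a • x)
        rw [map_smul, h, smul_smul, mul_comm] }

lemma oneDimHom_gen {M : Rep.{u} k G} (ω : G →* kˣ) (x : M)
    (h : ∀ g, M.ρ g x = (ω g : k) • x) : (oneDimHom ω x h).hom (oneDimGen ω) = x :=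
  one_smul k x

lemma nonempty_iso_oneDim {M : Rep.{u} k G} (ω : G →* kˣ) (x : M) (hx : x ≠ 0)
    (hx' : ∀ y : M, ∃ a : k, a • x = y) (h : ∀ g, M.ρ g x = (ω g : k) • x) :
    Nonempty (M ≅ oneDim ω) := by
  have : IsIso (oneDimHom ω x h) := isIso_of_bijective _ ⟨smul_left_injective k hx, hx'⟩
  exact ⟨(asIso (oneDimHom ω x h)).symm⟩

lemma oneDim_tensor (ω ω' : G →* kˣ) : Nonempty (oneDim ω ⊗ oneDim ω' ≅ oneDim (ω * ω')) := by
  refine nonempty_iso_oneDim (M := oneDim ω ⊗ oneDim ω') (ω * ω')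
    (oneDimGen ω ⊗ₜ[k] oneDimGen ω' : TensorProduct k (oneDim ω) (oneDim ω')) ?_ ?_ fun g => ?_
  · intro h0
    have h1 := congrArg (TensorProduct.lid k k) h0
    exact one_ne_zero (α := k) ((mul_one (1 : k)).symm.trans (h1.trans (map_zero _)))
  · intro y
    change ∃ a : k, a • (oneDimGen ω ⊗ₜ[k] oneDimGen ω' :
      TensorProduct k (oneDim ω) (oneDim ω')) = y
    induction y using TensorProduct.induction_on with
    | zero => exact ⟨0, zero_smul _ _⟩
    | tmul x y =>
      obtain ⟨a, rfl⟩ := exists_smul_oneDimGen ω x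
      obtain ⟨b, rfl⟩ := exists_smul_oneDimGen ω' y
      exact ⟨a * b, by rw [TensorProduct.smul_tmul_smul]⟩
    | add x y hx hy =>
      obtain ⟨a, rfl⟩ := hx
      obtain ⟨b, rfl⟩ := hy
      exact ⟨a + b, add_smul _ _ _⟩
  · refine (TensorProduct.map_tmul ((oneDim ω).ρ g) ((oneDim ω').ρ g) (oneDimGen ω)
      (oneDimGen ω')).trans ?_
    rw [oneDim_gen, oneDim_gen, TensorProduct.smul_tmul_smul, ← Units.val_mul]
    rfl

lemma oneDim_dual (ω : G →* kˣ) : Nonempty (dualObj (oneDim ω) ≅ oneDim ω⁻¹) := by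
  refine nonempty_iso_oneDim (M := dualObj (oneDim ω)) (ω⁻¹) (LinearMap.id : k →ₗ[k] k) ?_ ?_
    fun g => ?_
  · intro h
    exact one_ne_zero (α := k) (LinearMap.congr_fun (show (LinearMap.id : k →ₗ[k] k) = 0 from h) 1)
  · intro (y : k →ₗ[k] k)
    refine ⟨y 1, LinearMap.ext_ring ?_⟩
    exact mul_one (y 1)
  · refine LinearMap.ext_ring (M₃ := k) ?_
    change (ω g⁻¹ : k) * 1 = ((ω⁻¹ g : kˣ) : k) * 1
    rw [map_inv, MonoidHom.inv_apply]

lemma oneDim_one : Nonempty (oneDim (1 : G →* kˣ) ≅ Rep.trivial k G k) := by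
  obtain ⟨e⟩ := nonempty_iso_oneDim (M := Rep.trivial k G k) (1 : G →* kˣ) (1 : k)
    (one_ne_zero (α := k)) (fun (y : k) => ⟨y, mul_one y⟩) fun g => (one_smul k (1 : k)).symm
  exact ⟨e.symm⟩

variable {p : ℕ} [Fact p.Prime] [CharP k p]

/-- In characteristic `p` the equation `x ^ p ^ n = 1` reads `(x - 1) ^ p ^ n = 0`, so a field has
no nontrivial roots of unity of `p`-power order. -/
lemma character_eq_one_of_isPGroup {P : Type*} [Group P] (hP : IsPGroup p P) (ω : P →* kˣ) (g : P) :
    ω g = 1 := by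
  obtain ⟨n, hn⟩ := hP g
  have h : (ω g : k) ^ p ^ n = 1 := by
    rw [← Units.val_pow_eq_pow_val, ← map_pow, hn, map_one, Units.val_one]
  have : ((ω g : k) - 1) ^ p ^ n = 0 := by rw [sub_pow_char_pow, h, one_pow, sub_self]
  exact Units.ext (sub_eq_zero.1 (eq_zero_of_pow_eq_zero this))

lemma isPPermutation_oneDim (ω : G →* kˣ) : IsPPermutation p (oneDim ω) := by
  intro P hP
  refine .of_basis (Module.Basis.singleton Unit k) fun g i => ⟨i, ?_⟩
  refine (oneDim_apply ω g _).trans ?_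
  rw [show ω g = (ω.comp P.subtype) g from rfl, character_eq_one_of_isPGroup hP, Units.val_one]
  exact one_smul k _

lemma isEndotrivial_oneDim (ω : G →* kˣ) : IsEndotrivial p (inDegreeZero (oneDim ω)) where
  bounded := ⟨0, 0, boundedBy_inDegreeZero _⟩
  pPermutation i := by
    by_cases hi : i = 0
    · subst hi
      exact (isPPermutation_oneDim ω).of_iso (inDegreeZeroX _).symm
    · exact .of_isZero (boundedBy_inDegreeZero _ i (by omega))
  endotrivial := htpyClass_eq_iff.1 <| by
    have h : ω⁻¹ * ω = 1 := inv_mul_cancel ω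
    rw [htpyClass_tensor, htpyClass_dual_inDegreeZero,
      htpyClass_inDegreeZero_congr (oneDim_dual ω), htpyClass_tensor_inDegreeZero,
      htpyClass_inDegreeZero_congr (oneDim_tensor _ _), h,
      htpyClass_inDegreeZero_congr oneDim_one]

end OneDimensional

/-! ### The Brauer quotient of a permutation module -/

section BrauerQuotient

variable {k : Type u} [Field k] {G : Type v} [Group G]

lemma fixedPts_apply {P : Subgroup G} {M : Rep.{u} k G} (m : fixedPts P M) {g : G} (hg : g ∈ P) :
    M.ρ g (m : M) = m :=
  (mem_fixedPts P M m).1 m.2 g hg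

lemma traceElt_mem_fixedPts [Finite G] {Q P : Subgroup G} {M : Rep.{u} k G} {m : M}
    (hm : m ∈ fixedPts Q M) : traceElt Q P M m ∈ fixedPts P M := by
  rw [mem_fixedPts]
  intro g hg
  let γ : P := ⟨g, hg⟩
  -- With the representative `γ⁻¹ * (γ • x).out` of `x`, multiplication by `g` produces the standard
  -- representative of `γ • x`, so `g` merely permutes the terms of the trace.
  have hs : ∀ x : P ⧸ Q.subgroupOf P,
      ((γ⁻¹ * (γ • x).out : P) : P ⧸ Q.subgroupOf P) = x := fun x => by
    have h : (((γ • x).out : P) : P ⧸ Q.subgroupOf P) = γ • x := Quotient.out_eq' _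
    have h2 : ((γ⁻¹ * (γ • x).out : P) : P ⧸ Q.subgroupOf P) =
        γ⁻¹ • (((γ • x).out : P) : P ⧸ Q.subgroupOf P) := rfl
    rw [h2, h, inv_smul_smul]
  refine (congrArg (M.ρ g) (traceElt_eq M hm _ hs)).trans ?_
  rw [← AddMonoidHom.coe_coe (M.ρ g), AddMonoidHom.map_finsum _ (Set.toFinite _), traceElt,
    ← finsum_comp_equiv (MulAction.toPerm γ)
      (f := fun x : P ⧸ Q.subgroupOf P => M.ρ ((x.out : P) : G) m)]
  refine finsum_congr fun x => ?_
  change M.ρ g (M.ρ ((γ⁻¹ * (γ • x).out : P) : G) m) = M.ρ ((γ • x).out : P) m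
  rw [← Module.End.mul_apply, ← map_mul]
  congr 2
  simp [γ]

lemma traceSub_le_fixedPts [Finite G] (P : Subgroup G) (M : Rep.{u} k G) :
    traceSub P M ≤ fixedPts P M := by
  refine Submodule.span_le.2 ?_
  rintro _ ⟨Q, -, m, hm, rfl⟩
  exact traceElt_mem_fixedPts hm

/-- A basis of `M` is permuted by the subgroup `P`. -/
def IsPermBasis (P : Subgroup G) (M : Rep.{u} k G) {ι : Type*} (b : Module.Basis ι k M) : Prop :=
  ∀ g ∈ P, ∀ i, ∃ j, M.ρ g (b i) = b j

/-- The basis vector with index `i` is fixed by `P`. -/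
def IsFixedIndex (P : Subgroup G) (M : Rep.{u} k G) {ι : Type*} (b : Module.Basis ι k M) (i : ι) :
    Prop := b i ∈ fixedPts P M

variable {P : Subgroup G} {M : Rep.{u} k G} {ι : Type*} {b : Module.Basis ι k M}

lemma IsPermBasis.repr_apply_of_eq (hb : IsPermBasis P M b) {g : G} (hg : g ∈ P) {i j : ι}
    (hij : M.ρ g (b i) = b j) (m : M) : b.repr (M.ρ g m) j = b.repr m i := by
  classical
  have h : (Finsupp.lapply j ∘ₗ b.repr.toLinearMap) ∘ₗ M.ρ g =
      Finsupp.lapply i ∘ₗ b.repr.toLinearMap := b.ext fun l => by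
    obtain ⟨l', hl'⟩ := hb g hg l
    change b.repr (M.ρ g (b l)) j = b.repr (b l) i
    rw [hl', b.repr_self_apply, b.repr_self_apply]
    have : l' = j ↔ l = i := by
      constructor
      · rintro rfl
        exact b.injective ((M.ρ.apply_bijective g).injective (hl'.trans hij.symm))
      · rintro rfl
        exact b.injective (hl'.symm.trans hij)
    simp [this]
  exact LinearMap.congr_fun h m

/-- At a fixed index all translates of `m` have the same coordinate, so that of the trace is a
multiple of the index of `Q` in `P`, a positive power of `p`. -/
lemma IsPermBasis.repr_traceElt_of_fixed {p : ℕ} [Fact p.Prime] [CharP k p] [Finite G]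
    (hb : IsPermBasis P M b) (hP : IsPGroup p P) {Q : Subgroup G} (hQ : Q < P) (m : M) {i : ι}
    (hi : IsFixedIndex P M b i) : b.repr (traceElt Q P M m) i = 0 := by
  classical
  have : Fintype (P ⧸ Q.subgroupOf P) := Fintype.ofFinite _
  rw [traceElt, finsum_eq_sum_of_fintype, map_sum, Finsupp.coe_finsetSum, Finset.sum_apply,
    Finset.sum_congr rfl fun x _ => hb.repr_apply_of_eq (x.out : P).2
      ((mem_fixedPts P M (b i)).1 hi _ (x.out : P).2) m, Finset.sum_const, Finset.card_univ,
    ← Nat.card_eq_fintype_card, ← Subgroup.index, nsmul_eq_mul]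
  obtain ⟨n, hn⟩ := hP.index (Q.subgroupOf P)
  have hn0 : n ≠ 0 := by
    rintro rfl
    rw [pow_zero, Subgroup.index_eq_one, Subgroup.subgroupOf_eq_top] at hn
    exact not_le_of_gt hQ hn
  rw [hn, Nat.cast_pow, CharP.cast_eq_zero, zero_pow hn0, zero_mul]

/-- Induction on the support. The coordinates of a fixed vector are constant along orbits, and a
nontrivial orbit sum is the trace of a basis vector from its stabilizer; subtracting a multiple of
it removes that orbit from the support. -/
lemma IsPermBasis.mem_traceSub [Finite G] [Finite ι] (hb : IsPermBasis P M b) {m : M}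
    (hm : m ∈ fixedPts P M) (h0 : ∀ i, IsFixedIndex P M b i → b.repr m i = 0) :
    m ∈ traceSub P M := by
  classical
  induction hn : (b.repr m).support.card using Nat.strong_induction_on generalizing m with
  | _ n ih =>
  by_cases hz : b.repr m = 0
  · rw [(LinearEquiv.map_eq_zero_iff _).1 hz]
    exact zero_mem _
  obtain ⟨i, hi⟩ := Finsupp.ne_iff.1 hz
  rw [Finsupp.coe_zero, Pi.zero_apply] at hi
  have hfix : ¬ IsFixedIndex P M b i := fun h => hi (h0 i h)
  -- The stabilizer of `b i` in `P`, a proper subgroup because `i` is not a fixed index.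
  let Q : Subgroup G :=
    { carrier := {g | g ∈ P ∧ M.ρ g (b i) = b i}
      mul_mem' := fun {g g'} hg hg' => ⟨mul_mem hg.1 hg'.1, by
        rw [map_mul, Module.End.mul_apply, hg'.2, hg.2]⟩
      one_mem' := ⟨one_mem P, by rw [map_one, Module.End.one_apply]⟩
      inv_mem' := fun {g} hg => ⟨inv_mem hg.1, by
        nth_rw 1 [← hg.2]; rw [Representation.inv_self_apply]⟩ }
  have hQP : Q < P := by
    refine lt_of_le_of_ne (fun g hg => hg.1) fun h => hfix ?_
    rw [IsFixedIndex, mem_fixedPts]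
    intro g hg
    rw [← h] at hg
    exact hg.2
  have hbQ : b i ∈ fixedPts Q M := (mem_fixedPts _ _ _).2 fun g hg => hg.2
  set t := traceElt Q P M (b i) with ht
  have ht' : t ∈ traceSub P M := Submodule.subset_span ⟨Q, hQP, b i, hbQ, rfl⟩
  -- `φ` enumerates the orbit of `i` by the cosets of its stabilizer, without repetition; hence `t`
  -- has coordinate `1` on the orbit and `0` off it.
  choose φ hφ using fun x : P ⧸ Q.subgroupOf P => hb (x.out : P) (x.out : P).2 i
  have hφi : Function.Injective φ := by
    intro x y hxy
    have h1 : M.ρ ((x.out : P) : G) (b i) = M.ρ ((y.out : P) : G) (b i) := by rw [hφ, hφ, hxy]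
    have h2 : ((x.out : P) : P ⧸ Q.subgroupOf P) = (y.out : P) := by
      rw [QuotientGroup.eq, Subgroup.mem_subgroupOf]
      refine ⟨(x.out⁻¹ * y.out : P).2, ?_⟩
      rw [Subgroup.coe_mul, map_mul, Module.End.mul_apply, ← h1, Subgroup.coe_inv,
        Representation.inv_self_apply]
    rwa [show ((x.out : P) : P ⧸ Q.subgroupOf P) = x from Quotient.out_eq' _,
      show ((y.out : P) : P ⧸ Q.subgroupOf P) = y from Quotient.out_eq' _] at h2
  have : Fintype (P ⧸ Q.subgroupOf P) := Fintype.ofFinite _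
  have htj : ∀ j, b.repr t j = ∑ x, if φ x = j then 1 else 0 := fun j => by
    rw [ht, traceElt, finsum_eq_sum_of_fintype, map_sum, Finsupp.coe_finsetSum, Finset.sum_apply]
    refine Finset.sum_congr rfl fun x _ => ?_
    rw [hφ, b.repr_self_apply]
  have ht1 : ∀ x, b.repr t (φ x) = 1 := fun x => by
    rw [htj, Finset.sum_eq_single x (fun y _ hy => if_neg (hφi.ne hy)) (by simp), if_pos rfl]
  have ht0 : ∀ j, j ∉ Set.range φ → b.repr t j = 0 := fun j hj => by
    rw [htj]
    exact Finset.sum_eq_zero fun x _ => if_neg fun h => hj ⟨x, h⟩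
  have hmφ : ∀ x, b.repr m (φ x) = b.repr m i := fun x => by
    have := hb.repr_apply_of_eq (x.out : P).2 (hφ x) m
    rwa [(mem_fixedPts P M m).1 hm _ (x.out : P).2] at this
  have hi1 : i ∈ Set.range φ := by
    refine ⟨((1 : P) : P ⧸ Q.subgroupOf P), b.injective ?_⟩
    rw [← hφ]
    have h2 : ((((1 : P) : P ⧸ Q.subgroupOf P).out : P) : P ⧸ Q.subgroupOf P) = (1 : P) :=
      Quotient.out_eq' _
    rw [eq_comm, QuotientGroup.eq, Subgroup.mem_subgroupOf, inv_one, one_mul] at h2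
    exact h2.2
  have key : m - b.repr m i • t ∈ traceSub P M := by
    refine ih (b.repr (m - b.repr m i • t)).support.card ?_ (sub_mem hm (Submodule.smul_mem _ _
      (traceSub_le_fixedPts P M ht'))) ?_ rfl
    · rw [← hn]
      refine Finset.card_lt_card ⟨fun j hj => ?_, fun h => ?_⟩
      · rw [Finsupp.mem_support_iff] at hj ⊢
        intro hj0
        apply hj
        rw [map_sub, map_smul, Finsupp.sub_apply, Finsupp.smul_apply, hj0]
        by_cases hjφ : j ∈ Set.range φ
        · obtain ⟨x, rfl⟩ := hjφ
          rw [hmφ] at hj0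
          exact absurd hj0 hi
        · rw [ht0 j hjφ, smul_zero, sub_zero]
      · have := h (Finsupp.mem_support_iff.2 hi)
        rw [Finsupp.mem_support_iff] at this
        apply this
        obtain ⟨x, hx⟩ := hi1
        rw [map_sub, map_smul, Finsupp.sub_apply, Finsupp.smul_apply, ← hx, ht1,
          smul_eq_mul, mul_one, sub_self]
    · intro j hj
      rw [map_sub, map_smul, Finsupp.sub_apply, Finsupp.smul_apply, h0 j hj, ht0 j, smul_zero,
        sub_zero]
      rintro ⟨x, rfl⟩
      apply hfix
      -- A fixed vector in the orbit of `b i` would be `b i` itself, so subtracting `t` leaves the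
      -- coordinates at fixed indices untouched.
      have : b i = b (φ x) := by
        refine (M.ρ.apply_bijective ((x.out : P) : G)).injective ?_
        rw [hφ, (mem_fixedPts P M _).1 hj _ (x.out : P).2]
      rwa [IsFixedIndex, this]
  simpa using add_mem key (Submodule.smul_mem _ (b.repr m i) ht')

variable (P M) in
/-- The vector space underlying the Brauer construction `M(P)`. -/
abbrev BrauerSpace : Type u := fixedPts P M ⧸ traceFixed P M

/-- The class in `M(P)` of a fixed point. -/
abbrev brauerMk (m : fixedPts P M) : BrauerSpace P M := Submodule.Quotient.mk m

lemma brauerMk_eq_zero_iff (m : fixedPts P M) :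
    brauerMk m = 0 ↔ (m : M) ∈ traceSub P M :=
  Submodule.Quotient.mk_eq_zero _

lemma brauerMk_surjective (x : BrauerSpace P M) : ∃ m, brauerMk m = x :=
  Submodule.Quotient.mk_surjective _ x

variable {p : ℕ} [Fact p.Prime] [CharP k p] [Finite G] [Finite ι]

/-- The images of the fixed basis vectors form a basis of `M(P)`. -/
def brauerBasis (hP : IsPGroup p P) (hb : IsPermBasis P M b) :
    Module.Basis {i : ι // IsFixedIndex P M b i} k (BrauerSpace P M) := by
  classical
  have : Fintype ι := Fintype.ofFinite ι
  refine Module.Basis.mk (v := fun i => brauerMk (P := P) (M := M) ⟨b i.1, i.2⟩) ?_ ?_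
  · rw [Fintype.linearIndependent_iff]
    intro a ha i
    have h1 : brauerMk (∑ i, a i • (⟨b i.1, i.2⟩ : fixedPts P M)) = 0 := by
      rw [← ha]
      exact map_sum (Submodule.mkQ (traceFixed P M)) _ _
    rw [brauerMk_eq_zero_iff] at h1
    -- The coordinates at fixed indices descend to the quotient by traces, which gives independence.
    have h2 : ∀ m ∈ traceSub P M, b.repr m i.1 = 0 := by
      intro m hm
      induction hm using Submodule.span_induction with
      | mem x hx =>
        obtain ⟨Q, hQ, m, -, rfl⟩ := hx
        exact hb.repr_traceElt_of_fixed hP hQ m i.2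
      | zero => simp
      | add x y _ _ hx hy => simp [hx, hy]
      | smul c x _ hx => simp [hx]
    have h3 := h2 _ h1
    rw [AddSubmonoidClass.coe_finsetSum, map_sum, Finsupp.coe_finsetSum, Finset.sum_apply,
      Finset.sum_eq_single i] at h3
    · simpa using h3
    · intro j _ hj
      simp [Subtype.coe_injective.ne hj]
    · simp
  · intro x _
    obtain ⟨m, rfl⟩ := brauerMk_surjective x
    -- The part of `m` supported on the fixed indices; the remainder is a sum of traces by
    -- `IsPermBasis.mem_traceSub`.
    let m' : fixedPts P M := ∑ i : {i // IsFixedIndex P M b i}, b.repr m i.1 • ⟨b i.1, i.2⟩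
    have h1 : brauerMk (m - m') = 0 := by
      rw [brauerMk_eq_zero_iff]
      refine hb.mem_traceSub (m - m').2 fun i hi => ?_
      rw [AddSubgroupClass.coe_sub, AddSubmonoidClass.coe_finsetSum, map_sub, map_sum,
        Finsupp.sub_apply, Finsupp.coe_finsetSum, Finset.sum_apply, Finset.sum_eq_single ⟨i, hi⟩]
      · simp
      · intro j _ hj
        have : (j : ι) ≠ i := fun h => hj (Subtype.ext h)
        simp [this]
      · simp
    have h2 : brauerMk m = ∑ i : {i // IsFixedIndex P M b i}, b.repr m i.1 •
        brauerMk (P := P) (M := M) ⟨b i.1, i.2⟩ := by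
      have h3 : brauerMk m' = ∑ i : {i // IsFixedIndex P M b i}, b.repr m i.1 •
        brauerMk (P := P) (M := M) ⟨b i.1, i.2⟩ := map_sum (Submodule.mkQ (traceFixed P M)) _ _
      rw [← h3, ← sub_eq_zero]
      exact h1
    rw [h2]
    exact Submodule.sum_mem _ fun i _ => Submodule.smul_mem _ _ (Submodule.subset_span ⟨i, rfl⟩)

lemma brauerBasis_apply (hP : IsPGroup p P) (hb : IsPermBasis P M b)
    (i : {i : ι // IsFixedIndex P M b i}) :
    brauerBasis hP hb i = brauerMk ⟨b i.1, i.2⟩ := by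
  rw [brauerBasis, Module.Basis.mk_apply]

/-- The linear map `M(P) → N(P)` induced by a homomorphism. -/
abbrev brauerLin (P : Subgroup G) {M N : Rep.{u} k G} (f : M ⟶ N) :
    BrauerSpace P M →ₗ[k] BrauerSpace P N :=
  (traceFixed P M).mapQ (traceFixed P N) (fixedMap P f) (traceFixed_le_comap P f)

lemma brauerLin_id (P : Subgroup G) (M : Rep.{u} k G) : brauerLin P (𝟙 M) = LinearMap.id := by
  refine LinearMap.ext fun x => ?_
  obtain ⟨m, rfl⟩ := brauerMk_surjective x
  rfl

lemma brauerLin_comp (P : Subgroup G) {L M N : Rep.{u} k G} (f : L ⟶ M) (g : M ⟶ N) :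
    brauerLin P (f ≫ g) = brauerLin P g ∘ₗ brauerLin P f := by
  refine LinearMap.ext fun x => ?_
  obtain ⟨m, rfl⟩ := brauerMk_surjective x
  rfl

lemma brauerLin_add (P : Subgroup G) {M N : Rep.{u} k G} (f g : M ⟶ N) :
    brauerLin P (f + g) = brauerLin P f + brauerLin P g := by
  refine LinearMap.ext fun x => ?_
  obtain ⟨m, rfl⟩ := brauerMk_surjective x
  rfl

/-- The Brauer construction on morphisms as an additive map. -/
def brauerLinHom (P : Subgroup G) (M N : Rep.{u} k G) :
    (M ⟶ N) →+ (BrauerSpace P M →ₗ[k] BrauerSpace P N) :=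
  AddMonoidHom.mk' (brauerLin P) (brauerLin_add P)

lemma brauerLin_zero (P : Subgroup G) (M N : Rep.{u} k G) : brauerLin P (0 : M ⟶ N) = 0 :=
  map_zero (brauerLinHom P M N)

lemma brauerLin_units_smul (P : Subgroup G) {M N : Rep.{u} k G} (a : ℤˣ) (f : M ⟶ N) :
    brauerLin P (a • f) = a • brauerLin P f :=
  map_zsmul (brauerLinHom P M N) (a : ℤ) f

lemma brauerLin_sum (P : Subgroup G) {M N : Rep.{u} k G} {κ : Type*} (s : Finset κ)
    (f : κ → (M ⟶ N)) : brauerLin P (∑ i ∈ s, f i) = ∑ i ∈ s, brauerLin P (f i) :=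
  map_sum (brauerLinHom P M N) f s

lemma brauerLin_brauerRep (P : Subgroup G) {M N : Rep.{u} k G} (f : M ⟶ N) (g : Nor P)
    (x : BrauerSpace P M) :
    brauerLin P f (brauerRep P M g x) = brauerRep P N g (brauerLin P f x) := by
  obtain ⟨m, rfl⟩ := brauerMk_surjective x
  exact congrArg (Submodule.Quotient.mk (p := traceFixed P N))
    (Subtype.ext (Rep.hom_comm_apply f (g : G) (m : M)))

end BrauerQuotient

/-! ### The Brauer construction and tensor products of modules -/

section BrauerTensor

variable {k : Type u} [Field k] {G : Type v} [Group G] {P : Subgroup G}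

/-- The tensor product of fixed points. -/
def fixedTensor (P : Subgroup G) (M N : Rep.{u} k G) :
    fixedPts P M →ₗ[k] fixedPts P N →ₗ[k] fixedPts P (M ⊗ N : Rep.{u} k G) :=
  LinearMap.mk₂ k (fun m n => ⟨(m : M) ⊗ₜ[k] (n : N), (mem_fixedPts P (M ⊗ N) _).2 fun g hg => by
      change TensorProduct.map (M.ρ g) (N.ρ g) _ = _
      rw [TensorProduct.map_tmul, fixedPts_apply m hg, fixedPts_apply n hg]⟩)
    (fun _ _ _ => Subtype.ext (TensorProduct.add_tmul _ _ _))
    (fun _ _ _ => Subtype.ext (TensorProduct.smul_tmul' _ _ _).symm)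
    (fun _ _ _ => Subtype.ext (TensorProduct.tmul_add _ _ _))
    (fun _ _ _ => Subtype.ext (TensorProduct.tmul_smul _ _ _))

lemma tmul_mem_fixedPts {M N : Rep.{u} k G} {Q : Subgroup G} {m : M} {n : N}
    (hm : m ∈ fixedPts Q M) (hn : n ∈ fixedPts Q N) :
    (m ⊗ₜ[k] n : TensorProduct k M N) ∈ fixedPts Q (M ⊗ N : Rep.{u} k G) :=
  (fixedTensor Q M N ⟨m, hm⟩ ⟨n, hn⟩).2

lemma fixedPts_anti {Q P : Subgroup G} (h : Q ≤ P) (M : Rep.{u} k G) :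
    fixedPts P M ≤ fixedPts Q M := fun m hm =>
  (mem_fixedPts Q M m).2 fun g hg => (mem_fixedPts P M m).1 hm g (h hg)

variable [Finite G]

/-- The projection formula: a `P`-fixed factor passes through the trace. It lets the product of
fixed points descend to Brauer quotients. -/
lemma traceElt_tmul_left {M N : Rep.{u} k G} {Q : Subgroup G} (m : M) (n : fixedPts P N) :
    (traceElt Q P M m ⊗ₜ[k] (n : N) : TensorProduct k M N) =
      traceElt Q P (M ⊗ N : Rep.{u} k G) (m ⊗ₜ[k] (n : N) : TensorProduct k M N) := by
  let f : M →+ (M ⊗ N : Rep.{u} k G) := ((TensorProduct.mk k M N).flip n : M →+ TensorProduct k M N)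
  refine (AddMonoidHom.map_finsum f (Set.toFinite _)).trans (finsum_congr fun x => ?_)
  change M.ρ (x.out : P) m ⊗ₜ[k] (n : N) = TensorProduct.map (M.ρ _) (N.ρ _) (m ⊗ₜ[k] (n : N))
  rw [TensorProduct.map_tmul, fixedPts_apply n (x.out : P).2]

lemma traceElt_tmul_right {M N : Rep.{u} k G} {Q : Subgroup G} (m : fixedPts P M) (n : N) :
    ((m : M) ⊗ₜ[k] traceElt Q P N n : TensorProduct k M N) =
      traceElt Q P (M ⊗ N : Rep.{u} k G) ((m : M) ⊗ₜ[k] n : TensorProduct k M N) := by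
  let f : N →+ (M ⊗ N : Rep.{u} k G) := (TensorProduct.mk k M N m : N →+ TensorProduct k M N)
  refine (AddMonoidHom.map_finsum f (Set.toFinite _)).trans (finsum_congr fun x => ?_)
  change (m : M) ⊗ₜ[k] N.ρ (x.out : P) n = TensorProduct.map (M.ρ _) (N.ρ _) ((m : M) ⊗ₜ[k] n)
  rw [TensorProduct.map_tmul, fixedPts_apply m (x.out : P).2]

lemma tmul_mem_traceSub_left {M N : Rep.{u} k G} {m : M} (hm : m ∈ traceSub P M)
    (n : fixedPts P N) :
    (m ⊗ₜ[k] (n : N) : TensorProduct k M N) ∈ traceSub P (M ⊗ N : Rep.{u} k G) := by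
  have h : traceSub P M ≤ (traceSub P (M ⊗ N : Rep.{u} k G)).comap
      ((TensorProduct.mk k M N).flip (n : N) : M →ₗ[k] TensorProduct k M N) := by
    refine Submodule.span_le.2 ?_
    rintro _ ⟨Q, hQ, m, hm, rfl⟩
    exact Submodule.subset_span ⟨Q, hQ, _, tmul_mem_fixedPts hm (fixedPts_anti hQ.le N n.2),
      traceElt_tmul_left m n⟩
  exact h hm

lemma tmul_mem_traceSub_right {M N : Rep.{u} k G} (m : fixedPts P M) {n : N}
    (hn : n ∈ traceSub P N) :
    ((m : M) ⊗ₜ[k] n : TensorProduct k M N) ∈ traceSub P (M ⊗ N : Rep.{u} k G) := by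
  have h : traceSub P N ≤ (traceSub P (M ⊗ N : Rep.{u} k G)).comap
      (TensorProduct.mk k M N (m : M) : N →ₗ[k] TensorProduct k M N) := by
    refine Submodule.span_le.2 ?_
    rintro _ ⟨Q, hQ, n, hn, rfl⟩
    exact Submodule.subset_span ⟨Q, hQ, _, tmul_mem_fixedPts (fixedPts_anti hQ.le M m.2) hn,
      traceElt_tmul_right m n⟩
  exact h hn

/-- The bilinear map `M(P) × N(P) → (M ⊗ N)(P)`. -/
def brauerMul₂ (P : Subgroup G) (M N : Rep.{u} k G) :
    BrauerSpace P M →ₗ[k] BrauerSpace P N →ₗ[k] BrauerSpace P (M ⊗ N : Rep.{u} k G) :=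
  (traceFixed P M).liftQ
    (LinearMap.flip ((traceFixed P N).liftQ
      ((fixedTensor P M N).compr₂ (Submodule.mkQ (traceFixed P (M ⊗ N : Rep.{u} k G)))).flip
      (fun n hn => LinearMap.ext fun m =>
        (brauerMk_eq_zero_iff _).2 (tmul_mem_traceSub_right m hn))))
    (fun m hm => LinearMap.ext fun y => by
      obtain ⟨n, rfl⟩ := brauerMk_surjective y
      exact (brauerMk_eq_zero_iff _).2 (tmul_mem_traceSub_left hm n))

/-- The linear map `M(P) ⊗ N(P) → (M ⊗ N)(P)`. -/
def brauerMul (P : Subgroup G) (M N : Rep.{u} k G) :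
    TensorProduct k (BrauerSpace P M) (BrauerSpace P N) →ₗ[k]
      BrauerSpace P (M ⊗ N : Rep.{u} k G) :=
  TensorProduct.lift (brauerMul₂ P M N)

lemma brauerMul_mk {M N : Rep.{u} k G} (m : fixedPts P M) (n : fixedPts P N) :
    brauerMul P M N (brauerMk m ⊗ₜ brauerMk n) = brauerMk (fixedTensor P M N m n) := rfl

lemma brauerMul_whiskerRight {M M' : Rep.{u} k G} (f : M ⟶ M') (N : Rep.{u} k G)
    (x : BrauerSpace P M) (y : BrauerSpace P N) :
    brauerLin P (f ▷ N) (brauerMul P M N (x ⊗ₜ y)) =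
      brauerMul P M' N (brauerLin P f x ⊗ₜ y) := by
  obtain ⟨m, rfl⟩ := brauerMk_surjective x
  obtain ⟨n, rfl⟩ := brauerMk_surjective y
  rfl

lemma brauerMul_whiskerLeft (M : Rep.{u} k G) {N N' : Rep.{u} k G} (f : N ⟶ N')
    (x : BrauerSpace P M) (y : BrauerSpace P N) :
    brauerLin P (M ◁ f) (brauerMul P M N (x ⊗ₜ y)) =
      brauerMul P M N' (x ⊗ₜ brauerLin P f y) := by
  obtain ⟨m, rfl⟩ := brauerMk_surjective x
  obtain ⟨n, rfl⟩ := brauerMk_surjective y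
  rfl

lemma brauerMul_brauerRep (M N : Rep.{u} k G) (g : Nor P)
    (x : BrauerSpace P M) (y : BrauerSpace P N) :
    brauerRep P (M ⊗ N : Rep.{u} k G) g (brauerMul P M N (x ⊗ₜ y)) =
      brauerMul P M N (brauerRep P M g x ⊗ₜ brauerRep P N g y) := by
  obtain ⟨m, rfl⟩ := brauerMk_surjective x
  obtain ⟨n, rfl⟩ := brauerMk_surjective y
  rfl

/-- A product of vectors from permuted bases is fixed exactly when both factors are, so the bases
from `brauerBasis` correspond. -/
lemma brauerMul_bijective {p : ℕ} [Fact p.Prime] [CharP k p] (hP : IsPGroup p P)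
    {M N : Rep.{u} k G} (hM : IsPPermutation p M) (hN : IsPPermutation p N) :
    Function.Bijective (brauerMul P M N) := by
  obtain ⟨m, b, hb⟩ := hM P hP
  obtain ⟨n, c, hc⟩ := hN P hP
  replace hb : IsPermBasis P M b := fun g hg i => hb ⟨g, hg⟩ i
  replace hc : IsPermBasis P N c := fun g hg i => hc ⟨g, hg⟩ i
  let d : Module.Basis (Fin m × Fin n) k (M ⊗ N : Rep.{u} k G) := b.tensorProduct c
  have hd' : ∀ i j, d (i, j) = (b i ⊗ₜ[k] c j : TensorProduct k M N) :=
    fun i j => b.tensorProduct_apply c i j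
  have hρ : ∀ g i j, (M ⊗ N : Rep.{u} k G).ρ g (d (i, j)) =
      (M.ρ g (b i) ⊗ₜ[k] N.ρ g (c j) : TensorProduct k M N) := fun g i j => by
    rw [hd']
    exact TensorProduct.map_tmul _ _ _ _
  have hd : IsPermBasis P (M ⊗ N : Rep.{u} k G) d := fun g hg ⟨i, j⟩ => by
    obtain ⟨i', hi'⟩ := hb g hg i
    obtain ⟨j', hj'⟩ := hc g hg j
    exact ⟨(i', j'), by rw [hρ, hi', hj', hd']⟩
  have hfix : ∀ i j, IsFixedIndex P (M ⊗ N : Rep.{u} k G) d (i, j) ↔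
      IsFixedIndex P M b i ∧ IsFixedIndex P N c j := fun i j => by
    constructor
    · intro h
      rw [IsFixedIndex, mem_fixedPts] at h
      have key : ∀ g ∈ P, M.ρ g (b i) = b i ∧ N.ρ g (c j) = c j := fun g hg => by
        obtain ⟨i', hi'⟩ := hb g hg i
        obtain ⟨j', hj'⟩ := hc g hg j
        have h1 := h g hg
        rw [hρ, hi', hj', ← hd', d.injective.eq_iff, Prod.mk.injEq] at h1
        rw [hi', hj', h1.1, h1.2]
        exact ⟨rfl, rfl⟩
      exact ⟨(mem_fixedPts _ _ _).2 fun g hg => (key g hg).1,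
        (mem_fixedPts _ _ _).2 fun g hg => (key g hg).2⟩
    · rintro ⟨h1, h2⟩
      rw [IsFixedIndex, hd']
      exact tmul_mem_fixedPts h1 h2
  let e : {i // IsFixedIndex P M b i} × {j // IsFixedIndex P N c j} ≃
      {x // IsFixedIndex P (M ⊗ N : Rep.{u} k G) d x} :=
    { toFun := fun x => ⟨(x.1.1, x.2.1), (hfix _ _).2 ⟨x.1.2, x.2.2⟩⟩
      invFun := fun x => (⟨x.1.1, ((hfix _ _).1 x.2).1⟩, ⟨x.1.2, ((hfix _ _).1 x.2).2⟩)
      left_inv := fun _ => rfl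
      right_inv := fun _ => rfl }
  let E := ((brauerBasis hP hb).tensorProduct (brauerBasis hP hc)).equiv (brauerBasis hP hd) e
  have hE : brauerMul P M N = E.toLinearMap := by
    refine ((brauerBasis hP hb).tensorProduct (brauerBasis hP hc)).ext fun ⟨i, j⟩ => ?_
    change _ = E _
    rw [Module.Basis.equiv_apply, Module.Basis.tensorProduct_apply, brauerBasis_apply,
      brauerBasis_apply, brauerBasis_apply, brauerMul_mk]
    exact congrArg brauerMk (Subtype.ext (hd' _ _).symm)
  rw [hE]
  exact E.bijective

/-- The isomorphism `M(P) ⊗ N(P) ≅ (M ⊗ N)(P)` for `p`-permutation modules. -/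
def brauerMulEquiv {p : ℕ} [Fact p.Prime] [CharP k p] (hP : IsPGroup p P)
    {M N : Rep.{u} k G} (hM : IsPPermutation p M) (hN : IsPPermutation p N) :
    TensorProduct k (BrauerSpace P M) (BrauerSpace P N) ≃ₗ[k]
      BrauerSpace P (M ⊗ N : Rep.{u} k G) :=
  LinearEquiv.ofBijective (brauerMul P M N) (brauerMul_bijective hP hM hN)

end BrauerTensor

/-! ### Homology in terms of elements -/

section Homology

variable {k : Type u} [Field k] {H : Type v} [Group H]

lemma exists_cycles (X : ChainComplex (Rep.{u} k H) ℤ) (i : ℤ) (x : X.X i)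
    (hx : (X.d i (i - 1)).hom x = 0) : ∃ z : X.cycles i, (X.iCycles i).hom z = x := by
  -- The kernel as a subrepresentation serves as a test object: its inclusion factors through the
  -- abstract cycles.
  let W : Submodule k (X.X i) := LinearMap.ker (X.d i (i - 1)).hom.toLinearMap
  have hW : ∀ g, W ≤ W.comap ((X.X i).ρ g) := fun g y hy => by
    change (X.d i (i - 1)).hom ((X.X i).ρ g y) = 0
    rw [Rep.hom_comm_apply, show (X.d i (i - 1)).hom y = 0 from hy, map_zero]
  have h0 : Rep.subtype _ W hW ≫ X.d i (i - 1) = 0 := by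
    refine Rep.hom_ext (DFunLike.ext _ _ fun y => ?_)
    exact y.2
  refine ⟨(X.liftCycles (Rep.subtype _ W hW) (i - 1) (by simp) h0).hom ⟨x, hx⟩, ?_⟩
  exact congrArg (fun f : Rep.subrepresentation _ W hW ⟶ X.X i => f.hom ⟨x, hx⟩)
    (X.liftCycles_i (Rep.subtype _ W hW) (i - 1) (by simp) h0)

lemma iCycles_injective (X : ChainComplex (Rep.{u} k H) ℤ) (i : ℤ) :
    Function.Injective (X.iCycles i).hom :=
  (Rep.mono_iff_injective _).1 inferInstance

lemma homologyπ_surjective (X : ChainComplex (Rep.{u} k H) ℤ) (i : ℤ) :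
    Function.Surjective (X.homologyπ i).hom :=
  (Rep.epi_iff_surjective _).1 inferInstance

lemma d_iCycles (X : ChainComplex (Rep.{u} k H) ℤ) (i : ℤ) (z : X.cycles i) :
    (X.d i (i - 1)).hom ((X.iCycles i).hom z) = 0 :=
  congrArg (fun f : X.cycles i ⟶ X.X (i - 1) => f.hom z) (X.iCycles_d i (i - 1))

lemma homologyπ_eq_zero_iff (X : ChainComplex (Rep.{u} k H) ℤ) (i : ℤ) (z : X.cycles i) :
    (X.homologyπ i).hom z = 0 ↔ ∃ y, (X.d (i + 1) i).hom y = (X.iCycles i).hom z := by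
  constructor
  · intro hz
    let S : ShortComplex (Rep.{u} k H) := ShortComplex.mk (X.toCycles (i + 1) i) (X.homologyπ i)
      (X.toCycles_comp_homologyπ _ _)
    have hS : S.Exact := S.exact_of_g_is_cokernel (X.homologyIsCokernel (i + 1) i (by simp))
    have hS' := hS.map (forget₂ (Rep.{u} k H) (ModuleCat.{u} k))
    rw [ShortComplex.moduleCat_exact_iff] at hS'
    obtain ⟨y, hy⟩ := hS' z hz
    refine ⟨y, ?_⟩
    have h1 : (X.toCycles (i + 1) i).hom y = z := hy
    rw [← h1]
    exact (congrArg (fun f : X.X (i + 1) ⟶ X.X i => f.hom y) (X.toCycles_i (i + 1) i)).symm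
  · rintro ⟨y, hy⟩
    have h1 : (X.toCycles (i + 1) i).hom y = z := by
      apply iCycles_injective
      rw [← hy]
      exact congrArg (fun f : X.X (i + 1) ⟶ X.X i => f.hom y) (X.toCycles_i (i + 1) i)
    rw [← h1]
    exact congrArg (fun f : X.X (i + 1) ⟶ X.homology i => f.hom y)
      (X.toCycles_comp_homologyπ (i + 1) i)

lemma isZero_homology_iff (X : ChainComplex (Rep.{u} k H) ℤ) (i : ℤ) :
    IsZero (X.homology i) ↔
      ∀ x, (X.d i (i - 1)).hom x = 0 → ∃ y, (X.d (i + 1) i).hom y = x := by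
  rw [Rep.isZero_iff]
  constructor
  · intro h x hx
    obtain ⟨z, rfl⟩ := exists_cycles X i x hx
    exact (homologyπ_eq_zero_iff X i z).1 (Subsingleton.elim _ _)
  · intro h
    refine subsingleton_of_forall_eq 0 fun w => ?_
    obtain ⟨z, rfl⟩ := homologyπ_surjective X i w
    exact (homologyπ_eq_zero_iff X i z).2 (h _ (d_iCycles X i z))

/-- Reduces one-dimensional homology to a spanning cycle that is an eigenvector modulo boundaries,
so later arguments can work with elements of the complex. -/
lemma nonempty_homology_iso_oneDim_iff (X : ChainComplex (Rep.{u} k H) ℤ) (i : ℤ) (χ : H →* kˣ) :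
    Nonempty (X.homology i ≅ oneDim χ) ↔
      ∃ x, (X.d i (i - 1)).hom x = 0 ∧ (¬ ∃ y, (X.d (i + 1) i).hom y = x) ∧
        (∀ x', (X.d i (i - 1)).hom x' = 0 → ∃ a : k, ∃ y, (X.d (i + 1) i).hom y = x' - a • x) ∧
        ∀ g, ∃ y, (X.d (i + 1) i).hom y = (X.X i).ρ g x - (χ g : k) • x := by
  constructor
  · rintro ⟨e⟩
    obtain ⟨z, hz⟩ := homologyπ_surjective X i (e.inv.hom (oneDimGen χ))
    refine ⟨(X.iCycles i).hom z, d_iCycles X i z, ?_, ?_, ?_⟩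
    · rw [← homologyπ_eq_zero_iff, hz]
      intro h
      apply oneDimGen_ne_zero χ
      rw [← Rep.hom_inv_apply _ _ e (oneDimGen χ), h, map_zero]
    · intro x' hx'
      obtain ⟨z', rfl⟩ := exists_cycles X i x' hx'
      obtain ⟨a, ha⟩ := exists_smul_oneDimGen χ (e.hom.hom ((X.homologyπ i).hom z'))
      refine ⟨a, ?_⟩
      rw [← map_smul, ← map_sub, ← homologyπ_eq_zero_iff, map_sub, map_smul, hz, ← map_smul, ha,
        Rep.inv_hom_apply, sub_self]
    · intro g
      rw [← Rep.hom_comm_apply, ← map_smul, ← map_sub, ← homologyπ_eq_zero_iff, map_sub, map_smul,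
        Rep.hom_comm_apply, hz, ← map_smul, ← oneDim_gen, Rep.hom_comm_apply, sub_self]
  · rintro ⟨x, hx, hx0, hx1, hg⟩
    obtain ⟨z, rfl⟩ := exists_cycles X i x hx
    refine nonempty_iso_oneDim χ ((X.homologyπ i).hom z) ?_ ?_ ?_
    · rwa [Ne, homologyπ_eq_zero_iff]
    · intro w
      obtain ⟨z', rfl⟩ := homologyπ_surjective X i w
      obtain ⟨a, ha⟩ := hx1 _ (d_iCycles X i z')
      refine ⟨a, ?_⟩
      rw [← map_smul, ← map_sub, ← homologyπ_eq_zero_iff, map_sub, map_smul, sub_eq_zero] at ha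
      exact ha.symm
    · intro g
      have := hg g
      rw [← Rep.hom_comm_apply, ← map_smul, ← map_sub, ← homologyπ_eq_zero_iff, map_sub, map_smul,
        Rep.hom_comm_apply, sub_eq_zero] at this
      exact this

/-- A group acts on a line through scalars; these are multiplicative in the group element and hence
units. -/
lemma exists_iso_oneDim {M : Rep.{u} k H} (x : M) (hx : x ≠ 0)
    (hx' : ∀ y : M, ∃ a : k, a • x = y) : ∃ χ : H →* kˣ, Nonempty (M ≅ oneDim χ) := by
  choose a ha using fun g => hx' (M.ρ g x)
  have hinj : Function.Injective fun c : k => c • x := smul_left_injective k hx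
  let A : H →* k :=
    { toFun := a
      map_one' := hinj (by
        change a 1 • x = (1 : k) • x
        rw [ha, map_one, one_smul, Module.End.one_apply])
      map_mul' := fun g g' => hinj (by
        change a (g * g') • x = (a g * a g') • x
        rw [ha, map_mul, Module.End.mul_apply, ← ha g', map_smul, ← ha g, smul_smul, mul_comm]) }
  exact ⟨A.toHomUnits, nonempty_iso_oneDim _ x hx hx' fun g => (ha g).symm⟩

lemma exists_homology_iso_oneDim (X : ChainComplex (Rep.{u} k H) ℤ) (i : ℤ) (x : X.X i)
    (hx : (X.d i (i - 1)).hom x = 0) (hx0 : ¬ ∃ y, (X.d (i + 1) i).hom y = x)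
    (hx1 : ∀ x', (X.d i (i - 1)).hom x' = 0 →
      ∃ a : k, ∃ y, (X.d (i + 1) i).hom y = x' - a • x) :
    ∃ χ : H →* kˣ, Nonempty (X.homology i ≅ oneDim χ) := by
  obtain ⟨z, rfl⟩ := exists_cycles X i x hx
  refine exists_iso_oneDim ((X.homologyπ i).hom z) ?_ ?_
  · rwa [Ne, homologyπ_eq_zero_iff]
  · intro w
    obtain ⟨z', rfl⟩ := homologyπ_surjective X i w
    obtain ⟨a, ha⟩ := hx1 _ (d_iCycles X i z')
    refine ⟨a, ?_⟩
    rw [← map_smul, ← map_sub, ← homologyπ_eq_zero_iff, map_sub, map_smul, sub_eq_zero] at ha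
    exact ha.symm

end Homology

/-! ### Local homology, marks and their uniqueness -/

section LocalHomology

variable {k : Type u} [Field k] {G : Type v} [Group G] [Finite G]

/-- The class `x ∈ C(P)_i` is a cycle. -/
def IsCycle (C : ChainComplex (Rep.{u} k G) ℤ) (P : Subgroup G) (i : ℤ)
    (x : BrauerSpace P (C.X i)) : Prop :=
  brauerLin P (C.d i (i - 1)) x = 0

/-- The class `x ∈ C(P)_i` is a boundary. -/
def IsBoundary (C : ChainComplex (Rep.{u} k G) ℤ) (P : Subgroup G) (i : ℤ)
    (x : BrauerSpace P (C.X i)) : Prop :=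
  ∃ y, brauerLin P (C.d (i + 1) i) y = x

lemma isZero_localHomology_iff (C : ChainComplex (Rep.{u} k G) ℤ) (P : Subgroup G) (i : ℤ) :
    IsZero (localHomology C P i) ↔ ∀ x, IsCycle C P i x → IsBoundary C P i x :=
  isZero_homology_iff _ i

/-- The homology of `C(P)` in degree `i` is one-dimensional, spanned by the class of `x`. -/
structure SpansHomology (C : ChainComplex (Rep.{u} k G) ℤ) (P : Subgroup G) (i : ℤ)
    (x : BrauerSpace P (C.X i)) : Prop where
  cycle : IsCycle C P i x
  not_boundary : ¬ IsBoundary C P i x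
  span : ∀ x', IsCycle C P i x' → ∃ a : k, IsBoundary C P i (x' - a • x)

lemma nonempty_localHomology_iso_iff (C : ChainComplex (Rep.{u} k G) ℤ) (P : Subgroup G) (i : ℤ)
    (χ : LocalGroup P →* kˣ) :
    Nonempty (localHomology C P i ≅ oneDim χ) ↔
      ∃ x, SpansHomology C P i x ∧
        ∀ g : Nor P, IsBoundary C P i (brauerRep P (C.X i) g x - (χ g : k) • x) := by
  refine (nonempty_homology_iso_oneDim_iff _ i χ).trans ?_
  constructor
  · rintro ⟨x, h1, h2, h3, h4⟩
    exact ⟨x, ⟨h1, h2, h3⟩, fun g => h4 g⟩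
  · rintro ⟨x, ⟨h1, h2, h3⟩, h4⟩
    refine ⟨x, h1, h2, h3, fun g => ?_⟩
    obtain ⟨g, rfl⟩ := QuotientGroup.mk_surjective g
    exact h4 g

lemma SpansHomology.exists_character {C : ChainComplex (Rep.{u} k G) ℤ} {P : Subgroup G} {i : ℤ}
    {x : BrauerSpace P (C.X i)} (h : SpansHomology C P i x) :
    ∃ χ : LocalGroup P →* kˣ, Nonempty (localHomology C P i ≅ oneDim χ) :=
  exists_homology_iso_oneDim
    (((brauer P).mapHomologicalComplex (ComplexShape.down ℤ)).obj C) i x h.1 h.2 h.3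

/-- Homotopy equivalent complexes have isomorphic local homology. -/
def localHomologyIso {C D : ChainComplex (Rep.{u} k G) ℤ} (e : HomotopyEquiv C D)
    (P : Subgroup G) (i : ℤ) : localHomology C P i ≅ localHomology D P i :=
  ((brauer P).mapHomotopyEquiv e).toHomologyIso i

lemma not_isZero_oneDim {H : Type v} [Group H] (χ : H →* kˣ) : ¬ IsZero (oneDim χ) := by
  rw [Rep.isZero_iff]
  exact fun h => oneDimGen_ne_zero χ (Subsingleton.elim _ _)

lemma character_eq_of_iso {H : Type v} [Group H] {χ ψ : H →* kˣ}
    (h : Nonempty (oneDim χ ≅ oneDim ψ)) : χ = ψ := by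
  obtain ⟨e⟩ := h
  ext g
  have h1 := Rep.hom_comm_apply e.hom g (oneDimGen χ)
  rw [oneDim_gen, map_smul, oneDim_apply] at h1
  have hne : e.hom.hom (oneDimGen χ) ≠ 0 := fun h0 => oneDimGen_ne_zero χ (by
    rw [← Rep.inv_hom_apply _ _ e (oneDimGen χ), h0, map_zero])
  exact smul_left_injective k hne h1

/-- The homology of `C(P)` is one-dimensional, concentrated in degree `n`, and `N_G(P)/P` acts on
it by `χ`. -/
structure HasMark (C : ChainComplex (Rep.{u} k G) ℤ) (P : Subgroup G) (n : ℤ)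
    (χ : LocalGroup P →* kˣ) : Prop where
  iso : Nonempty (localHomology C P n ≅ oneDim χ)
  isZero : ∀ i, i ≠ n → IsZero (localHomology C P i)

variable {C D : ChainComplex (Rep.{u} k G) ℤ} {P : Subgroup G} {n : ℤ} {χ : LocalGroup P →* kˣ}

lemma HasMark.not_isZero_iff (h : HasMark C P n χ) (i : ℤ) :
    ¬ IsZero (localHomology C P i) ↔ i = n := by
  obtain ⟨e⟩ := h.iso
  refine ⟨fun hi => by_contra fun hne => hi (h.isZero i hne), ?_⟩
  rintro rfl hz
  exact not_isZero_oneDim χ (hz.of_iso e.symm)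

lemma HasMark.degree_unique (h : HasMark C P n χ) {m : ℤ} {ψ : LocalGroup P →* kˣ}
    (h' : HasMark C P m ψ) : n = m :=
  (h'.not_isZero_iff n).1 ((h.not_isZero_iff n).2 rfl)

lemma HasMark.character_unique (h : HasMark C P n χ) {m : ℤ} {ψ : LocalGroup P →* kˣ}
    (h' : HasMark C P m ψ) : χ = ψ := by
  obtain rfl := h.degree_unique h'
  obtain ⟨e⟩ := h.iso
  obtain ⟨e'⟩ := h'.iso
  exact character_eq_of_iso ⟨e.symm ≪≫ e'⟩

lemma HasMark.of_homotopyEquiv (h : HasMark C P n χ) (e : HomotopyEquiv C D) :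
    HasMark D P n χ := by
  obtain ⟨f⟩ := h.iso
  exact ⟨⟨(localHomologyIso e P n).symm ≪≫ f⟩, fun i hi =>
    (h.isZero i hi).of_iso (localHomologyIso e P i).symm⟩

lemma HasMark.spansHomology (h : HasMark C P n χ) : ∃ x, SpansHomology C P n x ∧
    ∀ g : Nor P, IsBoundary C P n (brauerRep P (C.X n) g x - (χ g : k) • x) :=
  (nonempty_localHomology_iso_iff C P n χ).1 h.iso

lemma IsBoundary.add {i : ℤ} {x y : BrauerSpace P (C.X i)} (hx : IsBoundary C P i x)
    (hy : IsBoundary C P i y) : IsBoundary C P i (x + y) := by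
  obtain ⟨x', rfl⟩ := hx
  obtain ⟨y', rfl⟩ := hy
  exact ⟨x' + y', map_add _ _ _⟩

lemma IsBoundary.smul {i : ℤ} {x : BrauerSpace P (C.X i)} (a : k) (hx : IsBoundary C P i x) :
    IsBoundary C P i (a • x) := by
  obtain ⟨x', rfl⟩ := hx
  exact ⟨a • x', map_smul _ _ _⟩

end LocalHomology

/-! ### External products of local homology classes -/

section Product

variable {k : Type u} [Field k] {G : Type v} [Group G] [Finite G]
  {C D : ChainComplex (Rep.{u} k G) ℤ} {P : Subgroup G}

/-- The product `C(P)_i × D(P)_j → (C ⊗ D)(P)_n`, where `i + j = n`. -/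
def externalProduct (C D : ChainComplex (Rep.{u} k G) ℤ) (P : Subgroup G) (i j n : ℤ)
    (h : i + j = n) (x : BrauerSpace P (C.X i)) (y : BrauerSpace P (D.X j)) :
    BrauerSpace P ((tensor C D).X n) :=
  brauerLin P (tensorι C D i j n h) (brauerMul P (C.X i) (D.X j) (x ⊗ₜ y))

lemma brauerMul_rTensor {M M' : Rep.{u} k G} (f : M ⟶ M') (N : Rep.{u} k G)
    (t : TensorProduct k (BrauerSpace P M) (BrauerSpace P N)) :
    brauerLin P (f ▷ N) (brauerMul P M N t) =
      brauerMul P M' N ((brauerLin P f).rTensor _ t) := by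
  induction t using TensorProduct.induction_on with
  | zero => simp only [map_zero]
  | tmul x y => exact brauerMul_whiskerRight f N x y
  | add x y hx hy => simp only [map_add, hx, hy]

lemma brauerMul_lTensor (M : Rep.{u} k G) {N N' : Rep.{u} k G} (f : N ⟶ N')
    (t : TensorProduct k (BrauerSpace P M) (BrauerSpace P N)) :
    brauerLin P (M ◁ f) (brauerMul P M N t) =
      brauerMul P M N' ((brauerLin P f).lTensor _ t) := by
  induction t using TensorProduct.induction_on with
  | zero => simp only [map_zero]
  | tmul x y => exact brauerMul_whiskerLeft M f x y
  | add x y hx hy => simp only [map_add, hx, hy]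

lemma isCycle_externalProduct {i j n : ℤ} (h : i + j = n) {x : BrauerSpace P (C.X i)}
    {y : BrauerSpace P (D.X j)} (hx : IsCycle C P i x) (hy : IsCycle D P j y) :
    IsCycle (tensor C D) P n (externalProduct C D P i j n h x y) := by
  change (brauerLin P ((tensor C D).d n (n - 1)) ∘ₗ brauerLin P (tensorι C D i j n h)) _ = 0
  rw [← brauerLin_comp, tensorι_d C D i (i - 1) j (j - 1) n (n - 1) h (by omega) (by omega)
    (by omega), brauerLin_add, brauerLin_units_smul, brauerLin_comp, brauerLin_comp]
  change brauerLin P (tensorι C D (i - 1) j (n - 1) _) (brauerLin P (C.d i (i - 1) ▷ D.X j) _) +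
    Int.negOnePow i • brauerLin P (tensorι C D i (j - 1) (n - 1) _)
      (brauerLin P (C.X i ◁ D.d j (j - 1)) _) = 0
  rw [brauerMul_whiskerRight, brauerMul_whiskerLeft, show brauerLin P (C.d i (i - 1)) x = 0 from hx,
    show brauerLin P (D.d j (j - 1)) y = 0 from hy, TensorProduct.zero_tmul,
    TensorProduct.tmul_zero, map_zero, map_zero, map_zero, map_zero, smul_zero, add_zero]

/-- Choose functionals `α`, `β` that kill the boundaries but not `x`, `y`. On the coordinate `(i,
j)`, the functional `α ⊗ β` kills every boundary of the tensor product, yet its value on the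
external product is `α x * β y ≠ 0`. -/
lemma not_isBoundary_externalProduct {p : ℕ} [Fact p.Prime] [CharP k p] (hP : IsPGroup p P)
    (hC : ∀ i, IsPPermutation p (C.X i)) (hD : ∀ i, IsPPermutation p (D.X i))
    {i j n : ℤ} (h : i + j = n) {x : BrauerSpace P (C.X i)}
    {y : BrauerSpace P (D.X j)} (hx : ¬ IsBoundary C P i x) (hy : ¬ IsBoundary D P j y) :
    ¬ IsBoundary (tensor C D) P n (externalProduct C D P i j n h x y) := by
  obtain ⟨α, hα, hα'⟩ := Submodule.exists_le_ker_of_notMem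
    (p := LinearMap.range (brauerLin P (C.d (i + 1) i))) (v := x) hx
  obtain ⟨β, hβ, hβ'⟩ := Submodule.exists_le_ker_of_notMem
    (p := LinearMap.range (brauerLin P (D.d (j + 1) j))) (v := y) hy
  rintro ⟨w, hw⟩
  let γ : BrauerSpace P (C.X i ⊗ D.X j : Rep.{u} k G) →ₗ[k] k :=
    LinearMap.mul' k k ∘ₗ TensorProduct.map α β ∘ₗ
      (brauerMulEquiv hP (hC i) (hD j)).symm.toLinearMap
  have hγ : ∀ t, γ (brauerMul P _ _ t) = LinearMap.mul' k k (TensorProduct.map α β t) := fun t => by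
    have : (brauerMulEquiv hP (hC i) (hD j)).symm (brauerMul P _ _ t) = t :=
      (brauerMulEquiv hP (hC i) (hD j)).symm_apply_apply t
    change LinearMap.mul' k k (TensorProduct.map α β
      ((brauerMulEquiv hP (hC i) (hD j)).symm (brauerMul P _ _ t))) = _
    rw [this]
  have e1 : γ (brauerLin P (tensorπ C D i j n h) (externalProduct C D P i j n h x y)) =
      α x * β y := by
    change γ ((brauerLin P (tensorπ C D i j n h) ∘ₗ brauerLin P (tensorι C D i j n h)) _) = _
    rw [← brauerLin_comp, tensorι_π_self, brauerLin_id, LinearMap.id_apply, hγ,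
      TensorProduct.map_tmul, LinearMap.mul'_apply]
  have e2 : γ (brauerLin P (tensorπ C D i j n h) (externalProduct C D P i j n h x y)) = 0 := by
    rw [← hw]
    change γ ((brauerLin P (tensorπ C D i j n h) ∘ₗ brauerLin P ((tensor C D).d (n + 1) n)) _) = _
    rw [← brauerLin_comp, tensor_d_π C D (i + 1) i (j + 1) j (n + 1) n h rfl rfl rfl,
      brauerLin_add, brauerLin_units_smul, brauerLin_comp, brauerLin_comp]
    obtain ⟨t, ht⟩ := (brauerMul_bijective hP (hC (i + 1)) (hD j)).surjective
      (brauerLin P (tensorπ C D (i + 1) j (n + 1) (by omega)) w)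
    obtain ⟨t', ht'⟩ := (brauerMul_bijective hP (hC i) (hD (j + 1))).surjective
      (brauerLin P (tensorπ C D i (j + 1) (n + 1) (by omega)) w)
    change γ (brauerLin P (C.d (i + 1) i ▷ D.X j) (brauerLin P (tensorπ C D (i + 1) j (n + 1) _) w)
      + Int.negOnePow i • brauerLin P (C.X i ◁ D.d (j + 1) j)
        (brauerLin P (tensorπ C D i (j + 1) (n + 1) _) w)) = 0
    have h1 : ∀ t, LinearMap.mul' k k (TensorProduct.map α β
        ((brauerLin P (C.d (i + 1) i)).rTensor _ t)) = 0 := fun t => by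
      induction t using TensorProduct.induction_on with
      | zero => simp only [map_zero]
      | tmul x y =>
        rw [LinearMap.rTensor_tmul, TensorProduct.map_tmul, LinearMap.mul'_apply,
          LinearMap.mem_ker.1 (hα' ⟨x, rfl⟩), zero_mul]
      | add x y hx hy => simp only [map_add, hx, hy, add_zero]
    have h2 : ∀ t, LinearMap.mul' k k (TensorProduct.map α β
        ((brauerLin P (D.d (j + 1) j)).lTensor _ t)) = 0 := fun t => by
      induction t using TensorProduct.induction_on with
      | zero => simp only [map_zero]
      | tmul x y =>
        rw [LinearMap.lTensor_tmul, TensorProduct.map_tmul, LinearMap.mul'_apply,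
          LinearMap.mem_ker.1 (hβ' ⟨y, rfl⟩), mul_zero]
      | add x y hx hy => simp only [map_add, hx, hy, add_zero]
    rw [← ht, ← ht', brauerMul_rTensor, brauerMul_lTensor, map_add, Units.smul_def, map_zsmul, hγ,
      hγ, h1, h2, smul_zero, add_zero]
  exact mul_ne_zero hα hβ (e1.symm.trans e2)

lemma externalProduct_brauerRep {i j n : ℤ} (h : i + j = n) (x : BrauerSpace P (C.X i))
    (y : BrauerSpace P (D.X j)) (g : Nor P) :
    brauerRep P ((tensor C D).X n) g (externalProduct C D P i j n h x y) =
      externalProduct C D P i j n h (brauerRep P (C.X i) g x) (brauerRep P (D.X j) g y) := by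
  rw [externalProduct, externalProduct, ← brauerLin_brauerRep, brauerMul_brauerRep]

end Product

/-! ### Tensoring with an acyclic complex -/

section Kunneth

variable {k : Type u} [Field k] {G : Type v} [Group G] [Finite G]

lemma exists_generalized_inverse {V W : Type u} [AddCommGroup V] [Module k V] [AddCommGroup W]
    [Module k W] (f : V →ₗ[k] W) : ∃ r : W →ₗ[k] V, ∀ x, f (r (f x)) = f x := by
  obtain ⟨g, hg⟩ := f.rangeRestrict.exists_rightInverse_of_surjective f.range_rangeRestrict
  obtain ⟨r, hr⟩ := LinearMap.exists_extend g
  refine ⟨r, fun x => ?_⟩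
  have h1 : r (f x) = g (f.rangeRestrict x) :=
    LinearMap.congr_fun hr (f.rangeRestrict x)
  rw [h1]
  exact congrArg Subtype.val (LinearMap.congr_fun hg (f.rangeRestrict x))

/-- Over a field an acyclic complex is contractible. If `r` satisfies `d r d = d` in each degree,
then `x - r d x` is a cycle, hence a boundary, and `s = r (1 - r d)` contracts. -/
lemma exists_local_contraction {C : ChainComplex (Rep.{u} k G) ℤ} {P : Subgroup G}
    (h : ∀ i x, IsCycle C P i x → IsBoundary C P i x) :
    ∃ s : ∀ i j, BrauerSpace P (C.X i) →ₗ[k] BrauerSpace P (C.X j),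
      ∀ i i' i'', i + 1 = i' → i'' + 1 = i → ∀ x,
        brauerLin P (C.d i' i) (s i i' x) + s i'' i (brauerLin P (C.d i i'') x) = x := by
  choose r hr using fun i j => exists_generalized_inverse (brauerLin P (C.d j i))
  have hdd : ∀ i j l x, brauerLin P (C.d j l) (brauerLin P (C.d i j) x) = 0 := fun i j l x => by
    change (brauerLin P (C.d j l) ∘ₗ brauerLin P (C.d i j)) x = 0
    rw [← brauerLin_comp, C.d_comp_d, brauerLin_zero, LinearMap.zero_apply]
  refine ⟨fun i j => r i j ∘ₗ (LinearMap.id - r (i - 1) i ∘ₗ brauerLin P (C.d i (i - 1))), ?_⟩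
  rintro i _ i'' rfl hi x
  obtain rfl : i'' = i - 1 := by omega
  obtain ⟨y, hy⟩ := h i (x - r (i - 1) i (brauerLin P (C.d i (i - 1)) x)) (by
    rw [IsCycle, map_sub, hr, sub_self])
  simp only [LinearMap.comp_apply, LinearMap.sub_apply, LinearMap.id_apply, hdd, map_zero, sub_zero]
  rw [← hy, hr, hy, sub_add_cancel]

/-- The hypothesis covers `i = a` and `i = b + 1`, the two terms in which the sums differ. The lemma
makes a telescoping sum collapse. -/
lemma sum_Icc_shift {A : Type*} [AddCommGroup A] (U : ℤ → A) {a b : ℤ}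
    (hU : ∀ i, i ≤ a ∨ b < i → U i = 0) :
    ∑ i ∈ Finset.Icc a b, U (i + 1) = ∑ i ∈ Finset.Icc a b, U i := by
  rw [← finsum_eq_sum_of_support_subset, ← finsum_eq_sum_of_support_subset]
  · exact finsum_comp_equiv (f := U) (Equiv.addRight (1 : ℤ))
  · intro i hi
    rw [Finset.coe_Icc, Set.mem_Icc]
    by_contra h
    exact hi (hU i (by omega))
  · intro i hi
    rw [Finset.coe_Icc, Set.mem_Icc]
    by_contra h
    exact hi (hU _ (by omega))

-- If `s` contracts `C(P)`, then `1 ⊗ s` with the sign `(-1)^i` contracts `(D ⊗ C)(P)`. Since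
-- `brauerMul` is bijective, the coordinates of `z` lift to tensors `zf`, on which `1 ⊗ s` can be
-- applied.
set_option maxHeartbeats 1600000 in
lemma isBoundary_tensor_of_acyclic {p : ℕ} [Fact p.Prime] [CharP k p] {P : Subgroup G}
    (hP : IsPGroup p P) {C D : ChainComplex (Rep.{u} k G) ℤ}
    (hC : ∀ i, IsPPermutation p (C.X i)) (hD : ∀ i, IsPPermutation p (D.X i)) {a b : ℤ}
    (hb : BoundedBy D a b) (h : ∀ i x, IsCycle C P i x → IsBoundary C P i x) {n : ℤ}
    (z : BrauerSpace P ((tensor D C).X n)) (hz : IsCycle (tensor D C) P n z) :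
    IsBoundary (tensor D C) P n z := by
  obtain ⟨s, hs⟩ := exists_local_contraction h
  choose zf hzf using fun i j hij => (brauerMul_bijective hP (hD i) (hC j)).surjective
    (brauerLin P (tensorπ D C i j n hij) z)
  -- The cycle condition for `z`, read off in the coordinate `(i', j')`.
  have hcyc : ∀ i i' j j' (_ : i' + 1 = i) (_ : j' + 1 = j) (h1 : i + j' = n) (h2 : i' + j = n),
      (brauerLin P (C.d j j')).lTensor _ (zf i' j h2) =
        - (Int.negOnePow i' • (brauerLin P (D.d i i')).rTensor _ (zf i j' h1)) := by
    intro i i' j j' hi hj h1 h2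
    apply (brauerMul_bijective hP (hD i') (hC j')).injective
    have e := congrArg (brauerLin P (tensorπ D C i' j' (n - 1) (by omega))) hz
    change (brauerLin P (tensorπ D C i' j' (n - 1) _) ∘ₗ brauerLin P ((tensor D C).d n (n - 1))) z
      = _ at e
    rw [← brauerLin_comp, tensor_d_π D C i i' j j' n (n - 1) (by omega) hi hj (by omega),
      brauerLin_add, brauerLin_units_smul, brauerLin_comp, brauerLin_comp, map_zero] at e
    change brauerLin P (D.d i i' ▷ C.X j') (brauerLin P (tensorπ D C i j' n _) z) +
      Int.negOnePow i' • brauerLin P (D.X i' ◁ C.d j j') (brauerLin P (tensorπ D C i' j n _) z) = 0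
      at e
    rw [← hzf, ← hzf, brauerMul_rTensor, brauerMul_lTensor] at e
    rw [map_neg, Units.smul_def, map_zsmul, ← Units.smul_def, eq_neg_of_add_eq_zero_left e, smul_neg,
      smul_smul, Int.units_mul_self, one_smul, neg_neg]
  -- The cross terms `d ⊗ s`. Each occurs in the boundaries of two neighbouring `W i`, and the
  -- alternating sum cancels them.
  let T : ∀ i i' j j', i + j = n → i' + j' = n → BrauerSpace P ((tensor D C).X n) :=
    fun i i' j j' h1 h2 => brauerLin P (tensorι D C i' j' n h2) (brauerMul P _ _
      (TensorProduct.map (brauerLin P (D.d i i')) (s j j') (zf i j h1)))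
  let W : ℤ → BrauerSpace P ((tensor D C).X (n + 1)) := fun i =>
    brauerLin P (tensorι D C i (n - i + 1) (n + 1) (by omega)) (brauerMul P _ _
      ((s (n - i) (n - i + 1)).lTensor _ (zf i (n - i) (by omega))))
  have hW : ∀ i, brauerLin P ((tensor D C).d (n + 1) n) (W i) =
      T i (i - 1) (n - i) (n - i + 1) (by omega) (by omega) + Int.negOnePow i •
        brauerLin P (tensorπ D C i (n - i) n (by omega) ≫ tensorι D C i (n - i) n (by omega)) z +
      T (i + 1) i (n - i - 1) (n - i) (by omega) (by omega) := by
    intro i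
    change (brauerLin P ((tensor D C).d (n + 1) n) ∘ₗ brauerLin P (tensorι D C i _ (n + 1) _)) _ = _
    rw [← brauerLin_comp, tensorι_d D C i (i - 1) (n - i + 1) (n - i) (n + 1) n (by omega) (by omega)
      (by omega) rfl, brauerLin_add, brauerLin_units_smul, brauerLin_comp, brauerLin_comp]
    change brauerLin P (tensorι D C (i - 1) (n - i + 1) n _) (brauerLin P (D.d i (i - 1) ▷ _) _) +
      Int.negOnePow i • brauerLin P (tensorι D C i (n - i) n _)
        (brauerLin P (D.X i ◁ C.d (n - i + 1) (n - i)) _) = _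
    rw [brauerMul_rTensor, brauerMul_lTensor]
    have e1 : (brauerLin P (C.d (n - i + 1) (n - i))).lTensor (BrauerSpace P (D.X i))
        ((s (n - i) (n - i + 1)).lTensor _ (zf i (n - i) (by omega))) = zf i (n - i) (by omega) -
          (s (n - i - 1) (n - i)).lTensor _ ((brauerLin P (C.d (n - i) (n - i - 1))).lTensor _
            (zf i (n - i) (by omega))) := by
      rw [eq_sub_iff_add_eq, ← LinearMap.comp_apply, ← LinearMap.comp_apply,
        ← LinearMap.lTensor_comp, ← LinearMap.lTensor_comp, ← LinearMap.add_apply,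
        ← LinearMap.lTensor_add]
      rw [show brauerLin P (C.d (n - i + 1) (n - i)) ∘ₗ s (n - i) (n - i + 1) +
        s (n - i - 1) (n - i) ∘ₗ brauerLin P (C.d (n - i) (n - i - 1)) = LinearMap.id from
          LinearMap.ext fun x => hs (n - i) _ (n - i - 1) rfl (by omega) x, LinearMap.lTensor_id,
        LinearMap.id_apply]
    rw [e1, hcyc (i + 1) i (n - i) (n - i - 1) rfl (by omega) (by omega) (by omega), map_neg,
      sub_neg_eq_add, map_add, map_add, hzf, smul_add]
    refine Eq.trans ?_ (add_assoc _ _ _).symm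
    congr 1
    · exact congrArg (fun t => brauerLin P _ (brauerMul P _ _ t)) (LinearMap.congr_fun
        (LinearMap.rTensor_comp_lTensor _ _ _) (zf i (n - i) _))
    · congr 1
      · rw [brauerLin_comp]
        rfl
      · rw [Units.smul_def, Units.smul_def, map_zsmul, map_zsmul, map_zsmul, smul_smul,
          ← Units.val_mul, Int.units_mul_self, Units.val_one, one_smul]
        exact congrArg (fun t => brauerLin P _ (brauerMul P _ _ t)) (LinearMap.congr_fun
          (LinearMap.lTensor_comp_rTensor _ _ _) (zf (i + 1) (n - i - 1) _))
  -- At `i = a` the source `D_a` may be nonzero, but the target `D_{a-1}` vanishes; this is the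
  -- boundary case that `sum_Icc_shift` needs.
  have hT : ∀ i i' j j' h1 h2, i' + 1 = i → i ≤ a ∨ b < i → T i i' j j' h1 h2 = 0 := by
    intro i i' j j' h1 h2 hi hi'
    have : D.d i i' = 0 := by
      rcases hi' with hi' | hi'
      · exact (hb i' (by omega)).eq_of_tgt _ _
      · exact (hb i (by omega)).eq_of_src _ _
    change brauerLin P _ (brauerMul P _ _ (TensorProduct.map (brauerLin P (D.d i i')) _ _)) = 0
    rw [this, brauerLin_zero, TensorProduct.map_zero_left, LinearMap.zero_apply, map_zero, map_zero]
  let U : ℤ → BrauerSpace P ((tensor D C).X n) := fun i =>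
    Int.negOnePow i • T i (i - 1) (n - i) (n - i + 1) (by omega) (by omega)
  have hU : ∀ i, Int.negOnePow i • T (i + 1) i (n - i - 1) (n - i) (by omega) (by omega) =
      - U (i + 1) := by
    intro i
    have e : ∀ i' j j' h1 h2, i' = i → j = n - i - 1 → j' = n - i →
        T (i + 1) i (n - i - 1) (n - i) (by omega) (by omega) = T (i + 1) i' j j' h1 h2 := by
      rintro _ _ _ _ _ rfl rfl rfl
      rfl
    change _ = - (Int.negOnePow (i + 1) • T (i + 1) (i + 1 - 1) (n - (i + 1)) (n - (i + 1) + 1) _ _)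
    rw [Int.negOnePow_succ, Units.neg_smul, neg_neg]
    exact congrArg (Int.negOnePow i • ·) (e _ _ _ _ _ (by omega) (by omega) (by omega))
  refine ⟨∑ i ∈ Finset.Icc a b, Int.negOnePow i • W i, ?_⟩
  have e : ∀ i, brauerLin P ((tensor D C).d (n + 1) n) (Int.negOnePow i • W i) = U i - U (i + 1) +
        brauerLin P (tensorπ D C i (n - i) n (by omega) ≫ tensorι D C i (n - i) n (by omega)) z := by
    intro i
    rw [Units.smul_def, map_zsmul, ← Units.smul_def, hW, smul_add, smul_add, smul_smul,
      Int.units_mul_self, one_smul, hU]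
    change U i + _ + - U (i + 1) = _
    abel
  rw [map_sum, Finset.sum_congr rfl fun i _ => e i, Finset.sum_add_distrib, Finset.sum_sub_distrib,
    sum_Icc_shift U fun i hi => ?_, sub_self, zero_add]
  · rw [← LinearMap.sum_apply, ← brauerLin_sum, tensor_sum_π_ι hb, brauerLin_id, LinearMap.id_apply]
  · change Int.negOnePow i • T i _ _ _ _ _ = 0
    rw [hT _ _ _ _ _ _ (by omega) hi, smul_zero]

end Kunneth

/-! ### Marks of one-dimensional modules -/

section OneDim

variable {k : Type u} [Field k] {G : Type v} [Group G]

/-- The character of `N_G(P)/P` induced by a character of `G`, for a `p`-subgroup `P`. -/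
def localCharacter {p : ℕ} [Fact p.Prime] [CharP k p] {P : Subgroup G} (hP : IsPGroup p P)
    (ω : G →* kˣ) : LocalGroup P →* kˣ :=
  QuotientGroup.lift (inNor P) (ω.comp (Nor P).subtype) fun g hg =>
    character_eq_one_of_isPGroup hP (ω.comp P.subtype) ⟨g, hg⟩

variable [Finite G]

lemma brauerSpace_eq_zero {M : Rep.{u} k G} (h : IsZero M) {P : Subgroup G} (x : BrauerSpace P M) :
    x = 0 := by
  rw [← LinearMap.id_apply (R := k) x, ← brauerLin_id, (IsZero.iff_id_eq_zero M).1 h, brauerLin_zero,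
    LinearMap.zero_apply]

lemma isZero_localHomology_of_isZero {C : ChainComplex (Rep.{u} k G) ℤ} {P : Subgroup G} {i : ℤ}
    (h : IsZero (C.X i)) : IsZero (localHomology C P i) :=
  (isZero_localHomology_iff C P i).2 fun x _ => ⟨0, by rw [map_zero, brauerSpace_eq_zero h x]⟩

variable {p : ℕ} [Fact p.Prime] [CharP k p] {P : Subgroup G}

lemma hasMark_oneDim (hP : IsPGroup p P) (ω : G →* kˣ) :
    HasMark (inDegreeZero (oneDim ω)) P 0 (localCharacter hP ω) := by
  have hgen : oneDimGen ω ∈ fixedPts P (oneDim ω) := (mem_fixedPts _ _ _).2 fun g hg => by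
    rw [oneDim_gen, show ω g = (ω.comp P.subtype) ⟨g, hg⟩ from rfl,
      character_eq_one_of_isPGroup hP, Units.val_one, one_smul]
  let x₀ : BrauerSpace P (oneDim ω) := brauerMk ⟨oneDimGen ω, hgen⟩
  -- `P` acts trivially on `k_ω`, so the generator is a fixed basis vector and survives in the
  -- Brauer quotient.
  have hx₀ : x₀ ≠ 0 := by
    let b : Module.Basis Unit k (oneDim ω) := Module.Basis.singleton Unit k
    have hb : ∀ i, b i = oneDimGen ω := fun i => Module.Basis.singleton_apply Unit k i
    have hb' : IsPermBasis P (oneDim ω) b := fun g hg i => ⟨i, by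
      rw [hb]
      exact (mem_fixedPts _ _ _).1 hgen g hg⟩
    have h := (brauerBasis hP hb').ne_zero ⟨(), by rwa [IsFixedIndex, hb]⟩
    rw [brauerBasis_apply] at h
    intro h0
    apply h
    rw [brauerMk_eq_zero_iff] at h0 ⊢
    change b () ∈ traceSub P (oneDim ω)
    rw [hb]
    exact h0
  have hspan : ∀ x : BrauerSpace P (oneDim ω), ∃ a : k, a • x₀ = x := fun x => by
    obtain ⟨⟨m, hm⟩, rfl⟩ := brauerMk_surjective x
    obtain ⟨a, rfl⟩ := exists_smul_oneDimGen ω m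
    exact ⟨a, rfl⟩
  let e := inDegreeZeroX (oneDim ω)
  have he : ∀ x, brauerLin P e.inv (brauerLin P e.hom x) = x := fun x => by
    rw [← LinearMap.comp_apply, ← brauerLin_comp, e.hom_inv_id, brauerLin_id, LinearMap.id_apply]
  have he' : ∀ x, brauerLin P e.hom (brauerLin P e.inv x) = x := fun x => by
    rw [← LinearMap.comp_apply, ← brauerLin_comp, e.inv_hom_id, brauerLin_id, LinearMap.id_apply]
  refine ⟨(nonempty_localHomology_iso_iff _ _ _ _).2 ⟨brauerLin P e.inv x₀, ⟨?_, ?_, ?_⟩, ?_⟩,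
    fun i hi => isZero_localHomology_of_isZero (boundedBy_inDegreeZero _ i (by omega))⟩
  · exact brauerSpace_eq_zero (boundedBy_inDegreeZero _ _ (by omega)) _
  · rintro ⟨y, hy⟩
    apply hx₀
    rw [← he' x₀, ← hy, brauerSpace_eq_zero (boundedBy_inDegreeZero _ _ (by omega)) y, map_zero,
      map_zero]
  · intro x _
    obtain ⟨a, ha⟩ := hspan (brauerLin P e.hom x)
    exact ⟨a, 0, by rw [map_zero, ← map_smul, ha, he, sub_self]⟩
  · intro g
    refine ⟨0, ?_⟩
    rw [map_zero, ← brauerLin_brauerRep, ← map_smul, ← map_sub]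
    refine ((congrArg _ ?_).trans (map_zero _)).symm
    exact sub_eq_zero.2 (congrArg (Submodule.Quotient.mk (p := traceFixed P _))
      (Subtype.ext (oneDim_gen ω g)))

end OneDim

/-! ### Existence and additivity of marks -/

section Marks

variable {k : Type u} [Field k] {G : Type v} [Group G] [Finite G]
  {C D : ChainComplex (Rep.{u} k G) ℤ} {P : Subgroup G}

lemma HasMark.of_htpyClass_eq {n : ℤ} {χ : LocalGroup P →* kˣ} (h : HasMark C P n χ)
    (e : htpyClass C = htpyClass D) : HasMark D P n χ := by
  obtain ⟨f⟩ := htpyClass_eq_iff.1 e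
  exact h.of_homotopyEquiv f

lemma HasMark.of_isZero {n : ℤ} {χ : LocalGroup P →* kˣ} (h : HasMark C P n χ) {i : ℤ}
    {x : BrauerSpace P (C.X i)} (hx : IsCycle C P i x) (hx' : ¬ IsBoundary C P i x) : i = n :=
  (h.not_isZero_iff i).1 fun hz => hx' ((isZero_localHomology_iff C P i).1 hz x hx)

lemma externalProduct_sub_smul {i j n : ℤ} (h : i + j = n) (x : BrauerSpace P (C.X i))
    (y y' : BrauerSpace P (D.X j)) (c : k) :
    externalProduct C D P i j n h x (y - c • y') =
      externalProduct C D P i j n h x y - c • externalProduct C D P i j n h x y' := by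
  rw [externalProduct, TensorProduct.tmul_sub, TensorProduct.tmul_smul, map_sub, map_smul, map_sub,
    map_smul]
  rfl

lemma isBoundary_externalProduct_left {i j n : ℤ} (h : i + j = n) {x : BrauerSpace P (C.X i)}
    {y : BrauerSpace P (D.X j)} (hx : IsBoundary C P i x) (hy : IsCycle D P j y) :
    IsBoundary (tensor C D) P n (externalProduct C D P i j n h x y) := by
  obtain ⟨w, rfl⟩ := hx
  refine ⟨externalProduct C D P (i + 1) j (n + 1) (by omega) w y, ?_⟩
  change (brauerLin P ((tensor C D).d (n + 1) n) ∘ₗ brauerLin P (tensorι C D (i + 1) j (n + 1) _)) _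
    = _
  rw [← brauerLin_comp, tensorι_d C D (i + 1) i j (j - 1) (n + 1) n (by omega) rfl (by omega)
    rfl, brauerLin_add, brauerLin_units_smul, brauerLin_comp, brauerLin_comp]
  change brauerLin P (tensorι C D i j n _) (brauerLin P (C.d (i + 1) i ▷ D.X j) _) +
    Int.negOnePow (i + 1) • brauerLin P (tensorι C D (i + 1) (j - 1) n _)
      (brauerLin P (C.X (i + 1) ◁ D.d j (j - 1)) _) = _
  rw [brauerMul_whiskerRight, brauerMul_whiskerLeft, show brauerLin P (D.d j (j - 1)) y = 0 from hy,
    TensorProduct.tmul_zero, map_zero, map_zero, smul_zero, add_zero]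
  rfl

lemma isBoundary_externalProduct_right {i j n : ℤ} (h : i + j = n) {x : BrauerSpace P (C.X i)}
    {y : BrauerSpace P (D.X j)} (hx : IsCycle C P i x) (hy : IsBoundary D P j y) :
    IsBoundary (tensor C D) P n (externalProduct C D P i j n h x y) := by
  obtain ⟨w, rfl⟩ := hy
  refine ⟨Int.negOnePow i • externalProduct C D P i (j + 1) (n + 1) (by omega) x w, ?_⟩
  rw [Units.smul_def, map_zsmul, ← Units.smul_def]
  change Int.negOnePow i • (brauerLin P ((tensor C D).d (n + 1) n) ∘ₗ
    brauerLin P (tensorι C D i (j + 1) (n + 1) _)) _ = _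
  rw [← brauerLin_comp, tensorι_d C D i (i - 1) (j + 1) j (n + 1) n (by omega) (by omega) rfl
    rfl, brauerLin_add, brauerLin_units_smul, brauerLin_comp, brauerLin_comp]
  change Int.negOnePow i • (brauerLin P (tensorι C D (i - 1) (j + 1) n _)
    (brauerLin P (C.d i (i - 1) ▷ D.X (j + 1)) _) +
    Int.negOnePow i • brauerLin P (tensorι C D i j n _)
      (brauerLin P (C.X i ◁ D.d (j + 1) j) _)) = _
  rw [brauerMul_whiskerRight, brauerMul_whiskerLeft, show brauerLin P (C.d i (i - 1)) x = 0 from hx,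
    TensorProduct.zero_tmul, map_zero, map_zero, zero_add, smul_smul, Int.units_mul_self, one_smul]
  rfl

variable {p : ℕ} [Fact p.Prime] [CharP k p]

lemma SpansHomology.of_cycle {i : ℤ} {u x : BrauerSpace P (C.X i)} (hu : SpansHomology C P i u)
    (hx : IsCycle C P i x) (hx' : ¬ IsBoundary C P i x) : SpansHomology C P i x := by
  refine ⟨hx, hx', fun y hy => ?_⟩
  obtain ⟨a, ha⟩ := hu.span x hx
  obtain ⟨b, hb⟩ := hu.span y hy
  have ha0 : a ≠ 0 := by
    rintro rfl
    rw [zero_smul, sub_zero] at ha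
    exact hx' ha
  refine ⟨b * a⁻¹, ?_⟩
  have := hb.add (ha.smul (-(b * a⁻¹)))
  convert this using 1
  rw [smul_sub, smul_smul, neg_mul, mul_assoc, inv_mul_cancel₀ ha0, mul_one, neg_smul, neg_smul]
  abel

/-- The complex `C^* ⊗ C` has the homology of `k[0]`, so neither factor is acyclic at `P`. With `y`
a fixed non-bounding cycle of `C^*(P)` in degree `j`, every non-bounding cycle of `C(P)` must lie in
degree `-j`; two such are proportional modulo boundaries because their products with `y` are. -/
lemma exists_hasMark (hC : IsEndotrivial p C) (hP : IsPGroup p P) :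
    ∃ n χ, HasMark C P n χ := by
  have hD := hC.dual
  obtain ⟨χ₀, h0⟩ : ∃ χ, HasMark (tensor (dual C) C) P 0 χ :=
    ⟨_, (hasMark_oneDim hP 1).of_htpyClass_eq (by
      rw [htpyClass_inDegreeZero_congr oneDim_one, htpyClass_tensor, hC.class_dual_add,
        htpyClass_unit])⟩
  -- `isBoundary_tensor_of_acyclic` concerns an acyclic right factor; exchanging the factors handles
  -- an acyclic `C^*(P)`.
  have h0' := h0.of_homotopyEquiv (HomotopyEquiv.ofIso (tensorComm (dual C) C))
  obtain ⟨a, b, hab⟩ := hC.bounded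
  obtain ⟨a', b', hab'⟩ := hD.bounded
  obtain ⟨i, x, hx, hx'⟩ : ∃ i x, IsCycle C P i x ∧ ¬ IsBoundary C P i x := by
    by_contra! h
    refine (h0.not_isZero_iff 0).2 rfl ((isZero_localHomology_iff _ _ _).2 fun z hz => ?_)
    exact isBoundary_tensor_of_acyclic hP hC.pPermutation hD.pPermutation hab' h z hz
  obtain ⟨j, y, hy, hy'⟩ : ∃ j y, IsCycle (dual C) P j y ∧ ¬ IsBoundary (dual C) P j y := by
    by_contra! h
    refine (h0'.not_isZero_iff 0).2 rfl ((isZero_localHomology_iff _ _ _).2 fun z hz => ?_)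
    exact isBoundary_tensor_of_acyclic hP hD.pPermutation hC.pPermutation hab h z hz
  have key : ∀ i' (x' : BrauerSpace P (C.X i')), IsCycle C P i' x' → ¬ IsBoundary C P i' x' →
      j + i' = 0 := fun i' x' h h' =>
    h0.of_isZero (isCycle_externalProduct rfl hy h)
      (not_isBoundary_externalProduct hP hD.pPermutation hC.pPermutation rfl hy' h')
  have hij := key i x hx hx'
  obtain ⟨u, hu, -⟩ := h0.spansHomology
  have hw := hu.of_cycle (isCycle_externalProduct hij hy hx)
    (not_isBoundary_externalProduct hP hD.pPermutation hC.pPermutation hij hy' hx')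
  have hspan : SpansHomology C P i x := by
    refine ⟨hx, hx', fun x' h => ?_⟩
    obtain ⟨a, ha⟩ := hw.span _ (isCycle_externalProduct hij hy h)
    -- If `x' - a • x` were not a boundary, neither would be its product with `y`, contrary to `ha`.
    refine ⟨a, ?_⟩
    rw [← externalProduct_sub_smul] at ha
    by_contra hne
    exact not_isBoundary_externalProduct hP hD.pPermutation hC.pPermutation hij hy' hne ha
  obtain ⟨χ, hχ⟩ := hspan.exists_character
  refine ⟨i, χ, hχ, fun i' hi' => (isZero_localHomology_iff _ _ _).2 fun x' h => ?_⟩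
  by_contra h'
  have := key i' x' h h'
  omega

/-- Since `C ⊗ D` is endotrivial it already has some mark, so one non-bounding cycle, the product of
spanning cycles, determines its degree and character. -/
lemma HasMark.tensor (hC : IsEndotrivial p C) (hD : IsEndotrivial p D) (hP : IsPGroup p P)
    {n m : ℤ} {χ ψ : LocalGroup P →* kˣ} (h : HasMark C P n χ) (h' : HasMark D P m ψ) :
    HasMark (tensor C D) P (n + m) (χ * ψ) := by
  obtain ⟨l, θ, hl⟩ := exists_hasMark (hC.tensor hD) hP
  obtain ⟨x, hx, hgx⟩ := h.spansHomology
  obtain ⟨y, hy, hgy⟩ := h'.spansHomology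
  have hc := isCycle_externalProduct rfl hx.cycle hy.cycle
  have hb := not_isBoundary_externalProduct hP hC.pPermutation hD.pPermutation rfl
    hx.not_boundary hy.not_boundary
  obtain rfl := hl.of_isZero hc hb
  obtain ⟨u, hu, -⟩ := hl.spansHomology
  refine ⟨(nonempty_localHomology_iso_iff _ _ _ _).2 ⟨_, hu.of_cycle hc hb, fun g => ?_⟩, hl.isZero⟩
  rw [externalProduct_brauerRep]
  have h1 : IsCycle D P m (brauerRep P (D.X m) g y) := by
    rw [IsCycle, brauerLin_brauerRep, show brauerLin P (D.d m (m - 1)) y = 0 from hy.cycle, map_zero]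
  -- The splitting used is `gx ⊗ gy - χψ (x ⊗ y) = (gx - χx) ⊗ gy + χ (x ⊗ (gy - ψy))`, with `χ`,
  -- `ψ` evaluated at `g`.
  have e1 := isBoundary_externalProduct_left rfl (hgx g) h1
  have e2 := (isBoundary_externalProduct_right rfl hx.cycle (hgy g)).smul (χ g : k)
  convert e1.add e2 using 1
  rw [externalProduct_sub_smul, smul_sub, smul_smul, externalProduct, externalProduct,
    externalProduct, externalProduct, TensorProduct.sub_tmul, ← TensorProduct.smul_tmul', map_sub,
    map_smul, map_sub, map_smul, sub_add_sub_cancel, MonoidHom.mul_apply, Units.val_mul]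

end Marks

/-! ### Invariance of h-marks under conjugation -/

section Conjugation

variable {k : Type u} [Field k] {G : Type v} [Group G]

lemma map_mem_fixedPts {P P' : Subgroup G} (g : G) (h : P.map (MulAut.conj g).toMonoidHom = P')
    {M : Rep.{u} k G} {m : M} (hm : m ∈ fixedPts P M) : M.ρ g m ∈ fixedPts P' M := by
  subst h
  rw [mem_fixedPts] at hm ⊢
  rintro _ ⟨q, hq, rfl⟩
  have : (MulAut.conj g).toMonoidHom q * g = g * q := by simp
  rw [← Module.End.mul_apply, ← map_mul, this, map_mul, Module.End.mul_apply, hm q hq]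

variable [Finite G]

lemma map_mem_traceSub {P P' : Subgroup G} (g : G) (h : P.map (MulAut.conj g).toMonoidHom = P')
    (M : Rep.{u} k G) : traceSub P M ≤ (traceSub P' M).comap (M.ρ g) := by
  subst h
  refine Submodule.span_le.2 ?_
  rintro _ ⟨Q, hQ, m, hm, rfl⟩
  set Q' : Subgroup G := Q.map (MulAut.conj g).toMonoidHom with hQ'
  set P' : Subgroup G := P.map (MulAut.conj g).toMonoidHom with hP'
  have hm' := map_mem_fixedPts g hQ'.symm hm
  refine Submodule.subset_span ⟨Q', (Subgroup.map_lt_map_iff_of_injective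
    (MulAut.conj g).injective).2 hQ, M.ρ g m, hm', ?_⟩
  let c : P ≃* P' := P.equivMapOfInjective (MulAut.conj g).toMonoidHom (MulAut.conj g).injective
  have hc : ∀ x : P, ((c x : P') : G) = g * x * g⁻¹ := fun x => rfl
  let e : P ⧸ Q.subgroupOf P ≃ P' ⧸ Q'.subgroupOf P' := by
    refine Quotient.congr c.toEquiv fun a b => ?_
    refine Quotient.eq.symm.trans (Iff.trans ?_ Quotient.eq)
    change ((a : P ⧸ Q.subgroupOf P) = b) ↔ ((c a : P' ⧸ Q'.subgroupOf P') = c b)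
    rw [QuotientGroup.eq, QuotientGroup.eq, Subgroup.mem_subgroupOf, Subgroup.mem_subgroupOf,
      ← map_inv, ← map_mul]
    exact (Subgroup.mem_map_iff_mem (MulAut.conj g).injective).symm
  have he : ∀ x : P, e (x : P ⧸ Q.subgroupOf P) = (c x : P' ⧸ Q'.subgroupOf P') := fun x => rfl
  rw [traceElt_eq M hm' (fun y => c (e.symm y).out)]
  · rw [traceElt, ← AddMonoidHom.coe_coe (M.ρ g),
      AddMonoidHom.map_finsum _ (Set.toFinite _), ← finsum_comp_equiv e]
    refine finsum_congr fun x => ?_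
    change M.ρ g (M.ρ (x.out : P) m) = M.ρ (c (e.symm (e x)).out : P') (M.ρ g m)
    rw [e.symm_apply_apply, hc, ← Module.End.mul_apply, ← map_mul, ← Module.End.mul_apply,
      ← map_mul, inv_mul_cancel_right]
  · intro y
    rw [← he]
    have := Quotient.out_eq' (e.symm y)
    exact (congrArg e this).trans (e.apply_symm_apply y)

/-- The action of `g` as a map `M(P) → M(gPg⁻¹)`. -/
def conjLin {P P' : Subgroup G} (g : G) (h : P.map (MulAut.conj g).toMonoidHom = P')
    (M : Rep.{u} k G) : BrauerSpace P M →ₗ[k] BrauerSpace P' M :=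
  (traceFixed P M).mapQ (traceFixed P' M) ((M.ρ g).restrict fun _ hm => map_mem_fixedPts g h hm)
    fun _ hm => map_mem_traceSub g h M hm

lemma brauerLin_conjLin {P P' : Subgroup G} (g : G) (h : P.map (MulAut.conj g).toMonoidHom = P')
    {M N : Rep.{u} k G} (f : M ⟶ N) (x : BrauerSpace P M) :
    brauerLin P' f (conjLin g h M x) = conjLin g h N (brauerLin P f x) := by
  obtain ⟨m, rfl⟩ := brauerMk_surjective x
  exact congrArg (Submodule.Quotient.mk (p := traceFixed P' N))
    (Subtype.ext (Rep.hom_comm_apply f g (m : M)))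

lemma conjLin_conjLin {P P' : Subgroup G} (g : G) (h : P.map (MulAut.conj g).toMonoidHom = P')
    (h' : P'.map (MulAut.conj g⁻¹).toMonoidHom = P) (M : Rep.{u} k G) (x : BrauerSpace P M) :
    conjLin g⁻¹ h' M (conjLin g h M x) = x := by
  obtain ⟨m, rfl⟩ := brauerMk_surjective x
  refine congrArg (Submodule.Quotient.mk (p := traceFixed P M)) (Subtype.ext ?_)
  change M.ρ g⁻¹ (M.ρ g m) = m
  rw [← Module.End.mul_apply, ← map_mul, inv_mul_cancel, map_one, Module.End.one_apply]

/-- The action of `g` identifies `C(P)` with `C(P')` compatibly with the differentials. -/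
lemma isZero_localHomology_of_conj {P P' : Subgroup G} (g : G)
    (h : P.map (MulAut.conj g).toMonoidHom = P') {C : ChainComplex (Rep.{u} k G) ℤ} {i : ℤ}
    (hz : IsZero (localHomology C P' i)) : IsZero (localHomology C P i) := by
  have h' : P'.map (MulAut.conj g⁻¹).toMonoidHom = P := by
    subst h
    ext x
    simp [Subgroup.mem_map, mul_assoc]
  rw [isZero_localHomology_iff] at hz ⊢
  intro x hx
  obtain ⟨y, hy⟩ := hz (conjLin g h _ x) (by
    rw [IsCycle, brauerLin_conjLin, show brauerLin P (C.d i (i - 1)) x = 0 from hx, map_zero])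
  exact ⟨conjLin g⁻¹ h' _ y, by rw [brauerLin_conjLin, hy, conjLin_conjLin]⟩

lemma HasMark.conj {P P' : Subgroup G} (h : ∃ g : G, P.map (MulAut.conj g).toMonoidHom = P')
    {C : ChainComplex (Rep.{u} k G) ℤ} {n n' : ℤ} {χ : LocalGroup P →* kˣ}
    {χ' : LocalGroup P' →* kˣ} (hn : HasMark C P n χ) (hn' : HasMark C P' n' χ') : n = n' := by
  obtain ⟨g, hg⟩ := h
  exact (hn'.not_isZero_iff n).1 fun hz =>
    (hn.not_isZero_iff n).2 rfl (isZero_localHomology_of_conj g hg hz)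

end Conjugation

/-! ### Lifting maps out of `p`-permutation modules -/

section Lifting

variable {k : Type u} [Field k] {G : Type v} [Group G] {p : ℕ}

/-- Lifting through `f` equivariantly for a `p`-subgroup `S`. -/
lemma exists_lift_of_isPGroup {S : Subgroup G} (hS : IsPGroup p S) {M A B : Rep.{u} k G}
    (hM : IsPPermutation p M) (f : A ⟶ B) (u : M ⟶ B)
    (h : ∀ Q : Subgroup G, IsPGroup p Q → ∀ m ∈ fixedPts Q M, ∃ a ∈ fixedPts Q A,
      f.hom a = u.hom m) :
    ∃ v : M →ₗ[k] A, (∀ g ∈ S, ∀ m, v (M.ρ g m) = A.ρ g (v m)) ∧ ∀ m, f.hom (v m) = u.hom m := by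
  obtain ⟨n, b, hb⟩ := hM S hS
  let st : Setoid (Fin n) :=
    { r := fun i j => ∃ s : S, M.ρ s (b i) = b j
      iseqv :=
        { refl := fun i => ⟨1, by simp⟩
          symm := by
            rintro i j ⟨s, hs⟩
            refine ⟨s⁻¹, ?_⟩
            rw [← hs, ← Module.End.mul_apply, ← map_mul, Subgroup.coe_inv, inv_mul_cancel, map_one,
              Module.End.one_apply]
          trans := by
            rintro i j l ⟨s, hs⟩ ⟨t, ht⟩
            refine ⟨t * s, ?_⟩
            rw [← ht, ← hs, Subgroup.coe_mul, map_mul, Module.End.mul_apply] } }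
  -- `r i` is the chosen representative of the `S`-orbit of `i`, and `t i` below moves `b (r i)` to
  -- `b i`.
  let r : Fin n → Fin n := fun i => (Quotient.mk st i).out
  have hr : ∀ i, ∃ s : S, M.ρ s (b (r i)) = b i := fun i => Quotient.exact (s := st)
    (Quotient.out_eq _)
  choose t ht using hr
  let stab : Fin n → Subgroup G := fun i =>
    { carrier := {g | g ∈ S ∧ M.ρ g (b i) = b i}
      one_mem' := ⟨one_mem _, by simp⟩
      mul_mem' := fun {x y} hx hy => ⟨mul_mem hx.1 hy.1, by
        rw [map_mul, Module.End.mul_apply, hy.2, hx.2]⟩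
      inv_mem' := fun {x} hx => ⟨inv_mem hx.1, by
        nth_rewrite 1 [← hx.2]
        rw [← Module.End.mul_apply, ← map_mul, inv_mul_cancel, map_one, Module.End.one_apply]⟩ }
  -- A lift fixed by the stabilizer can be translated along the orbit without ambiguity; this is why
  -- fixed points of all `p`-subgroups enter the hypothesis.
  choose a ha ha' using fun i => h (stab i) (hS.to_le fun g hg => hg.1) (b i)
    ((mem_fixedPts _ _ _).2 fun g hg => hg.2)
  let v : M →ₗ[k] A := b.constr k fun i => A.ρ (t i : G) (a (r i))
  have hv : ∀ i, v (b i) = A.ρ (t i : G) (a (r i)) := fun i => b.constr_basis k _ i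
  refine ⟨v, fun g hg m => ?_, fun m => ?_⟩
  · have key : v ∘ₗ M.ρ g = A.ρ g ∘ₗ v := b.ext fun i => by
      obtain ⟨j, hj⟩ := hb ⟨g, hg⟩ i
      change M.ρ g (b i) = b j at hj
      have hrij : r j = r i := congrArg Quotient.out
        (Quotient.sound (s := st) (show ∃ s : S, M.ρ s (b i) = b j from ⟨⟨g, hg⟩, hj⟩)).symm
      -- Both `t j` and `g * t i` carry the representative to `b j`, so they differ by an element of
      -- its stabilizer.
      have hq : (t j : G)⁻¹ * (g * t i) ∈ stab (r i) := by
        refine ⟨mul_mem (inv_mem (t j).2) (mul_mem hg (t i).2), ?_⟩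
        rw [map_mul, map_mul, Module.End.mul_apply, Module.End.mul_apply, ht i, hj, ← ht j, hrij,
          ← Module.End.mul_apply, ← map_mul, inv_mul_cancel, map_one, Module.End.one_apply]
      have h1 := (mem_fixedPts _ _ _).1 (ha (r i)) _ hq
      change v (M.ρ g (b i)) = A.ρ g (v (b i))
      rw [hj, hv, hv, hrij]
      nth_rewrite 1 [← h1]
      rw [← Module.End.mul_apply, ← map_mul, mul_inv_cancel_left, map_mul, Module.End.mul_apply]
    exact LinearMap.congr_fun key m
  · have key : f.hom.toLinearMap ∘ₗ v = u.hom.toLinearMap := b.ext fun i => by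
      change f.hom (v (b i)) = u.hom (b i)
      rw [hv, Rep.hom_comm_apply, ha', ← Rep.hom_comm_apply, ht]
    exact LinearMap.congr_fun key m

/-- Maps out of a `p`-permutation module lift through `f` if they do so on the fixed points of all
`p`-subgroups. -/
lemma exists_lift [Fact p.Prime] [CharP k p] [Finite G] {M A B : Rep.{u} k G}
    (hM : IsPPermutation p M) (f : A ⟶ B) (u : M ⟶ B)
    (h : ∀ Q : Subgroup G, IsPGroup p Q → ∀ m ∈ fixedPts Q M, ∃ a ∈ fixedPts Q A,
      f.hom a = u.hom m) :
    ∃ v : M ⟶ A, v ≫ f = u := by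
  obtain ⟨S⟩ : Nonempty (Sylow p G) := inferInstance
  obtain ⟨v, hv, hv'⟩ := exists_lift_of_isPGroup S.2 hM f u h
  let L : Rep.{u} k G := Rep.of (Representation.linHom M.ρ A.ρ)
  have hL : ∀ (g : G) (φ : L) (m : M), (show M →ₗ[k] A from L.ρ g φ) m =
    A.ρ g ((show M →ₗ[k] A from φ) (M.ρ g⁻¹ m)) := fun g φ m => rfl
  have hvS : (v : L) ∈ fixedPts (S : Subgroup G) L := (mem_fixedPts _ _ _).2 fun g hg =>
    LinearMap.ext fun m => by
      refine (hL g v m).trans ?_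
      change A.ρ g (v (M.ρ g⁻¹ m)) = v m
      rw [← hv g hg, ← Module.End.mul_apply, ← map_mul, mul_inv_cancel, map_one,
        Module.End.one_apply]
  -- The trace of `v` from `S` to `G` in `Hom_k(M, A)` is `G`-equivariant and lifts `[G : S] • u`;
  -- the index of a Sylow subgroup is invertible in `k`.
  let w : M →ₗ[k] A := traceElt (S : Subgroup G) ⊤ L v
  have hw : ∀ g m, w (M.ρ g m) = A.ρ g (w m) := fun g m => by
    have h1 := (mem_fixedPts _ _ _).1 (traceElt_mem_fixedPts (P := ⊤) hvS) g trivial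
    have h2 := LinearMap.congr_fun (show L.ρ g w = w from h1) (M.ρ g m)
    rw [← h2]
    refine (hL g w _).trans ?_
    change A.ρ g (w (M.ρ g⁻¹ (M.ρ g m))) = _
    rw [← Module.End.mul_apply (M.ρ g⁻¹), ← map_mul, inv_mul_cancel, map_one, Module.End.one_apply]
  have hfw : ∀ m, f.hom (w m) = ((S : Subgroup G).index : k) • u.hom m := fun m => by
    let F : L →+ B := AddMonoidHom.mk' (fun φ => f.hom ((show M →ₗ[k] A from φ) m)) fun φ ψ =>
      map_add f.hom _ _
    have h1 : ∀ x : (⊤ : Subgroup G) ⧸ (S : Subgroup G).subgroupOf ⊤,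
        F (L.ρ ((x.out : (⊤ : Subgroup G)) : G) v) = u.hom m := fun x => by
      change f.hom (A.ρ _ (v (M.ρ _ m))) = _
      rw [Rep.hom_comm_apply, hv', Rep.hom_comm_apply, ← Module.End.mul_apply, ← map_mul,
        mul_inv_cancel, map_one, Module.End.one_apply]
    have : Fintype ((⊤ : Subgroup G) ⧸ (S : Subgroup G).subgroupOf ⊤) := Fintype.ofFinite _
    change F (traceElt (S : Subgroup G) ⊤ L v) = _
    rw [traceElt, AddMonoidHom.map_finsum _ (Set.toFinite _), finsum_congr h1,
      finsum_eq_sum_of_fintype, Finset.sum_const, Finset.card_univ, ← Nat.card_eq_fintype_card,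
      ← Subgroup.index, ← Subgroup.relIndex, Subgroup.relIndex_top_right, Nat.cast_smul_eq_nsmul]
  have hN : ((S : Subgroup G).index : k) ≠ 0 := fun h0 =>
    S.not_dvd_index ((CharP.cast_eq_zero_iff k p _).1 h0)
  refine ⟨Rep.ofHom (ρ := M.ρ) (σ := A.ρ) ⟨((S : Subgroup G).index : k)⁻¹ • w, fun g =>
    LinearMap.ext fun m => ?_⟩, Rep.hom_ext (DFunLike.ext _ _ fun m => ?_)⟩
  · change ((S : Subgroup G).index : k)⁻¹ • w (M.ρ g m) =
      A.ρ g (((S : Subgroup G).index : k)⁻¹ • w m)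
    rw [hw, map_smul]
  · change f.hom (((S : Subgroup G).index : k)⁻¹ • w m) = u.hom m
    rw [map_smul, hfw, smul_smul, inv_mul_cancel₀ hN, one_smul]

end Lifting

/-! ### Dualizing contractions -/

section Contraction

variable {k : Type u} [Field k] {G : Type v} [Group G]

/-- The family `s` of maps `C_i → C_{i + 1}` contracts `C` in degree `i`. -/
def ContractsAt (C : ChainComplex (Rep.{u} k G) ℤ) (s : ∀ i j, C.X i ⟶ C.X j) (i : ℤ) : Prop :=
  C.d i (i - 1) ≫ s (i - 1) i + s i (i + 1) ≫ C.d (i + 1) i = 𝟙 (C.X i)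

/-- Duality exchanges the degrees `i` and `-i`, so the contraction transposes. Its signs copy those
of `dual`, so that every composite carries a square. -/
lemma exists_contraction_of_pos {E : ChainComplex (Rep.{u} k G) ℤ} {s : ∀ i j, E.X i ⟶ E.X j}
    (hs : ∀ i < 0, ContractsAt E s i) :
    ∃ t : ∀ i j, (dual E).X i ⟶ (dual E).X j, ∀ i > 0, ContractsAt (dual E) t i := by
  refine ⟨fun i j => (Int.negOnePow (j + 1) • dualMap (s (-j) (-i)) :
    dualObj (E.X (-i)) ⟶ dualObj (E.X (-j))), fun i hi => ?_⟩
  have h1 : E.d (-i) (-(i + 1)) ≫ s (-(i + 1)) (-i) + s (-i) (-(i - 1)) ≫ E.d (-(i - 1)) (-i) =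
      𝟙 _ := by
    have h2 : ∀ j j', j = -i - 1 → j' = -i + 1 →
        E.d (-i) j ≫ s j (-i) + s (-i) j' ≫ E.d j' (-i) = 𝟙 _ := by
      rintro _ _ rfl rfl
      exact hs (-i) (by omega)
    exact h2 _ _ (by omega) (by omega)
  have h3 := congrArg dualMap h1
  rw [dualMap_add, dualMap_comp, dualMap_comp, dualMap_id] at h3
  change (Int.negOnePow (i + 1) • dualMap (E.d (-(i - 1)) (-i))) ≫
    (Int.negOnePow (i + 1) • dualMap (s (-i) (-(i - 1)))) +
    (Int.negOnePow (i + 1 + 1) • dualMap (s (-(i + 1)) (-i))) ≫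
    (Int.negOnePow (i + 1 + 1) • dualMap (E.d (-i) (-(i + 1)))) = 𝟙 (dualObj (E.X (-i)))
  rw [Linear.units_smul_comp, Linear.comp_units_smul, Linear.units_smul_comp,
    Linear.comp_units_smul, smul_smul, smul_smul, Int.units_mul_self, Int.units_mul_self, one_smul,
    one_smul, add_comm]
  exact h3

end Contraction

/-! ### Equivariant contraction in negative degrees -/

section FixedContraction

variable {k : Type u} [Field k] {G : Type v} [Group G] [Finite G] {p : ℕ}

/-- Induction on the order of `Q`. As `C(Q)` is exact in degree `m`, a fixed cycle is the boundary
of a fixed element plus traces from subgroups `R < Q`. The projection `e` onto cycles turns these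
into traces of `R`-fixed cycles, which bound fixed elements by induction, and it leaves the cycle
they add up to unchanged. -/
lemma exists_fixed_boundary {C : ChainComplex (Rep.{u} k G) ℤ} {m : ℤ}
    (h : ∀ Q : Subgroup G, IsPGroup p Q → IsZero (localHomology C Q m)) (e : C.X m ⟶ C.X m)
    (he : e ≫ C.d m (m - 1) = 0) (he' : ∀ z, (C.d m (m - 1)).hom z = 0 → e.hom z = z)
    (Q : Subgroup G) (hQ : IsPGroup p Q) (z : C.X m) (hz : z ∈ fixedPts Q (C.X m))
    (hdz : (C.d m (m - 1)).hom z = 0) :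
    ∃ y ∈ fixedPts Q (C.X (m + 1)), (C.d (m + 1) m).hom y = z := by
  induction hn : Nat.card Q using Nat.strong_induction_on generalizing Q z with
  | _ n ih =>
    have key : traceSub Q (C.X m) ≤ ((fixedPts Q (C.X (m + 1))).map
        (C.d (m + 1) m).hom.toLinearMap).comap e.hom.toLinearMap := by
      refine Submodule.span_le.2 ?_
      rintro _ ⟨R, hR, x, hx, rfl⟩
      obtain ⟨y, hy, hy'⟩ := ih (Nat.card R) (hn ▸ Set.ncard_lt_ncard hR (Set.toFinite _)) R
        (hQ.to_le hR.le) (e.hom x) (fixedMap R e ⟨x, hx⟩).2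
        (congrArg (fun f : C.X m ⟶ C.X (m - 1) => f.hom x) he) rfl
      refine ⟨traceElt R Q _ y, traceElt_mem_fixedPts hy, ?_⟩
      change (C.d (m + 1) m).hom (traceElt R Q _ y) = e.hom (traceElt R Q _ x)
      rw [traceElt_map, traceElt_map, hy']
    obtain ⟨y, hy⟩ := (isZero_localHomology_iff C Q m).1 (h Q hQ) (brauerMk ⟨z, hz⟩) (by
      refine (brauerMk_eq_zero_iff (fixedMap Q (C.d m (m - 1)) ⟨z, hz⟩)).2 ?_
      change (C.d m (m - 1)).hom z ∈ _
      rw [hdz]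
      exact zero_mem _)
    obtain ⟨⟨y, hy0⟩, rfl⟩ := brauerMk_surjective y
    have h1 : z - (C.d (m + 1) m).hom y ∈ traceSub Q (C.X m) :=
      (Submodule.Quotient.eq (traceFixed Q (C.X m))).1 hy.symm
    have hdd : (C.d m (m - 1)).hom ((C.d (m + 1) m).hom y) = 0 :=
      congrArg (fun f : C.X (m + 1) ⟶ C.X (m - 1) => f.hom y) (C.d_comp_d _ _ _)
    obtain ⟨w, hw, hw'⟩ := key h1
    change (C.d (m + 1) m).hom w = e.hom (z - (C.d (m + 1) m).hom y) at hw'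
    rw [he' _ (by rw [map_sub, hdz, hdd, sub_zero])] at hw'
    exact ⟨w + y, add_mem hw hy0, by rw [map_add, hw', sub_add_cancel]⟩

lemma exists_contraction_of_neg [Fact p.Prime] [CharP k p] {C : ChainComplex (Rep.{u} k G) ℤ}
    {a b : ℤ} (hab : BoundedBy C a b) (hC : ∀ i, IsPPermutation p (C.X i))
    (h : ∀ Q : Subgroup G, IsPGroup p Q → ∀ i < 0, IsZero (localHomology C Q i)) :
    ∃ s : ∀ i j, C.X i ⟶ C.X j, ∀ i < 0, ContractsAt C s i := by
  -- The contraction is built upwards from degree `a`, below which the complex vanishes.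
  have key : ∀ N : ℕ, ∃ s : ∀ i j, C.X i ⟶ C.X j, ∀ i < 0, i < a + N → ContractsAt C s i := by
    intro N
    induction N with
    | zero =>
      refine ⟨fun _ _ => 0, fun i _ hi => ?_⟩
      exact (hab i (by left; simpa using hi)).eq_of_src _ _
    | succ N ih =>
      obtain ⟨s, hs⟩ := ih
      obtain ⟨m, hm⟩ : ∃ m, m = a + N := ⟨_, rfl⟩
      by_cases hm0 : m < 0
      -- The contraction in degree `m - 1` makes `e` a projection onto the cycles. A lift `v` of `e`
      -- through the next differential is exactly the missing component of the contraction in degree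
      -- `m`.
      · let e : C.X m ⟶ C.X m := 𝟙 _ - C.d m (m - 1) ≫ s (m - 1) m
        have he : e ≫ C.d m (m - 1) = 0 := by
          have h1 := hs (m - 1) (by omega) (by omega)
          have h2 : ∀ m', m' = m → C.d m (m - 1) ≫ s (m - 1) m' ≫ C.d m' (m - 1) =
              C.d m (m - 1) ≫ s (m - 1) m ≫ C.d m (m - 1) := by rintro _ rfl; rfl
          have h3 := congrArg (fun f => C.d m (m - 1) ≫ f) h1
          change C.d m (m - 1) ≫ (_ + _) = C.d m (m - 1) ≫ 𝟙 _ at h3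
          rw [Preadditive.comp_add, C.d_comp_d_assoc, zero_comp, zero_add,
            h2 _ (sub_add_cancel m 1), Category.comp_id] at h3
          change (𝟙 _ - C.d m (m - 1) ≫ s (m - 1) m) ≫ C.d m (m - 1) = 0
          rw [Preadditive.sub_comp, Category.id_comp, Category.assoc, h3, sub_self]
        have he' : ∀ z, (C.d m (m - 1)).hom z = 0 → e.hom z = z := fun z hz => by
          change z - (s (m - 1) m).hom ((C.d m (m - 1)).hom z) = z
          rw [hz, map_zero, sub_zero]
        obtain ⟨v, hv⟩ := exists_lift (hC m) (C.d (m + 1) m) e fun Q hQ x hx =>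
          exists_fixed_boundary (fun Q hQ => h Q hQ m hm0) e he he' Q hQ (e.hom x)
            (fixedMap Q e ⟨x, hx⟩).2 (congrArg (fun f : C.X m ⟶ C.X (m - 1) => f.hom x) he)
        refine ⟨fun i j => if hij : i = m ∧ j = m + 1 then
          eqToHom (congrArg C.X hij.1) ≫ v ≫ eqToHom (congrArg C.X hij.2.symm) else s i j,
          fun i hi hi' => ?_⟩
        push_cast at hi'
        unfold ContractsAt
        beta_reduce
        rw [dif_neg (by omega)]
        by_cases him : i = m
        · subst him
          rw [dif_pos ⟨rfl, rfl⟩, eqToHom_refl, eqToHom_refl, Category.id_comp, Category.comp_id,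
            hv, add_sub_cancel]
        · rw [dif_neg (by omega)]
          exact hs i hi (by omega)
      · exact ⟨s, fun i hi hi' => hs i hi (by omega)⟩
  -- This number of steps makes `a + N` nonnegative, so all negative degrees are reached.
  obtain ⟨s, hs⟩ := key (-a).toNat
  exact ⟨s, fun i hi => hs i hi (by omega)⟩

end FixedContraction

/-! ### Reduction to the homology in degree zero -/

section Splitting

variable {k : Type u} [Field k] {G : Type v} [Group G]

/-- A complex which is contractible in all degrees other than `0` and whose homology in degree `0`
is the module `k_ω` is homotopy equivalent to `k_ω[0]`. -/
lemma nonempty_homotopyEquiv_oneDim {C : ChainComplex (Rep.{u} k G) ℤ}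
    {s : ∀ i j, C.X i ⟶ C.X j} (hs : ∀ i ≠ 0, ContractsAt C s i) (ω : G →* kˣ) (x : C.X 0)
    (hx : (C.d 0 (-1)).hom x = 0) (hx' : ¬ ∃ y, (C.d 1 0).hom y = x)
    (hspan : ∀ z, (C.d 0 (-1)).hom z = 0 → ∃ a : k, ∃ y, (C.d 1 0).hom y = z - a • x)
    (hg : ∀ g, ∃ y, (C.d 1 0).hom y = (C.X 0).ρ g x - (ω g : k) • x) :
    Nonempty (HomotopyEquiv C (inDegreeZero (oneDim ω))) := by
  let N : C ⟶ C := Homotopy.nullHomotopicMap' (c := ComplexShape.down ℤ) fun i j _ => s i j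
  have hN : Homotopy N 0 := Homotopy.nullHomotopy' _
  have hNf : ∀ i i' i'', i' + 1 = i → i + 1 = i'' →
      N.f i = C.d i i' ≫ s i' i + s i i'' ≫ C.d i'' i := fun i i' i'' h h' =>
    Homotopy.nullHomotopicMap'_f (c := ComplexShape.down ℤ) h' h _
  -- `f` is homotopic to the identity and vanishes outside degree `0`; hence `f.f 0` kills
  -- boundaries and has cycles as values.
  let f : C ⟶ C := 𝟙 C - N
  have hf : Homotopy f (𝟙 C) := (Homotopy.equivSubZero.symm
    ((Homotopy.ofEq (sub_sub_cancel (𝟙 C) N)).trans hN)).symm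
  have hf0 : ∀ i ≠ 0, f.f i = 0 := fun i hi => by
    change 𝟙 (C.X i) - N.f i = 0
    rw [hNf i (i - 1) (i + 1) (by omega) rfl, hs i hi, sub_self]
  have hf1 : ∀ y, (f.f 0).hom ((C.d 1 0).hom y) = 0 := fun y => by
    have h1 := f.comm 1 0
    rw [hf0 1 one_ne_zero, zero_comp] at h1
    exact (congrArg (fun g : C.X 1 ⟶ C.X 0 => g.hom y) h1).symm
  have hf2 : ∀ c, (C.d 0 (-1)).hom ((f.f 0).hom c) = 0 := fun c => by
    have h1 := f.comm 0 (-1)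
    rw [hf0 (-1) (by omega), comp_zero] at h1
    exact congrArg (fun g : C.X 0 ⟶ C.X (-1) => g.hom c) h1
  -- `y` is homologous to `x`. As `f` kills boundaries, `y` is fixed by `f` and is an honest
  -- eigenvector, not only one modulo boundaries.
  obtain ⟨y, hy⟩ : ∃ y, y = (f.f 0).hom x := ⟨_, rfl⟩
  have hyx : y = x - (C.d 1 0).hom ((s 0 1).hom x) := by
    have h1 : (f.f 0).hom x = x - ((s (-1) 0).hom ((C.d 0 (-1)).hom x) +
        (C.d 1 0).hom ((s 0 1).hom x)) := by
      change x - (N.f 0).hom x = _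
      rw [hNf 0 (-1) 1 (by omega) (by omega)]
      rfl
    rw [hy, h1, hx, map_zero, zero_add]
  have hfy : (f.f 0).hom y = y := by
    rw [hyx, map_sub, hf1, sub_zero, ← hyx, hy]
  have hy0 : y ≠ 0 := fun h0 => hx' ⟨_, (sub_eq_zero.1 (hyx ▸ h0)).symm⟩
  have hyg : ∀ g, (C.X 0).ρ g y = (ω g : k) • y := fun g => by
    obtain ⟨w, hw⟩ := hg g
    rw [eq_sub_iff_add_eq] at hw
    rw [hy, ← Rep.hom_comm_apply, ← hw, map_add, hf1, zero_add, map_smul]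
  -- One application of `f` gives a cycle `a • x` plus a boundary, and the second sends it to `a •
  -- y`. Thus `f ≫ f`, still homotopic to the identity, factors through `k_ω`.
  have hspan' : ∀ c, ∃ a : k, (f.f 0).hom ((f.f 0).hom c) = a • y := fun c => by
    obtain ⟨a, w, hw⟩ := hspan _ (hf2 c)
    rw [eq_sub_iff_add_eq] at hw
    exact ⟨a, by rw [← hw, map_add, hf1, zero_add, map_smul, hy]⟩
  choose α hα using hspan'
  have hinj : Function.Injective fun a : k => a • y := smul_left_injective k hy0
  let A : C.X 0 ⟶ oneDim ω := Rep.ofHom (ρ := (C.X 0).ρ) (σ := (oneDim ω).ρ)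
    { toFun := fun c => α c • oneDimGen ω
      map_add' := fun c c' => by
        rw [← add_smul]
        refine congrArg (· • oneDimGen ω) (hinj ?_)
        change α (c + c') • y = (α c + α c') • y
        rw [← hα, add_smul, ← hα, ← hα, map_add, map_add]
      map_smul' := fun r c => by
        rw [RingHom.id_apply, smul_smul]
        refine congrArg (· • oneDimGen ω) (hinj ?_)
        change α (r • c) • y = (r * α c) • y
        rw [← hα, mul_smul, ← hα, map_smul, map_smul]
      isIntertwining' := fun g => LinearMap.ext fun c => by
        change α ((C.X 0).ρ g c) • oneDimGen ω = (oneDim ω).ρ g (α c • oneDimGen ω)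
        rw [oneDim_apply, smul_smul]
        refine congrArg (· • oneDimGen ω) (hinj ?_)
        change α ((C.X 0).ρ g c) • y = ((ω g : k) * α c) • y
        rw [← hα, Rep.hom_comm_apply, Rep.hom_comm_apply, hα, map_smul, hyg, smul_smul, mul_comm] }
  have hA : ∀ c, A.hom c = α c • oneDimGen ω := fun c => rfl
  let B : oneDim ω ⟶ C.X 0 := oneDimHom ω y hyg
  have hAB : A ≫ B = f.f 0 ≫ f.f 0 := by
    refine Rep.hom_ext (DFunLike.ext _ _ fun c => ?_)
    change B.hom (A.hom c) = (f.f 0).hom ((f.f 0).hom c)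
    rw [hA, map_smul, oneDimHom_gen, hα]
  have hBA : B ≫ A = 𝟙 _ := by
    refine Rep.hom_ext (DFunLike.ext _ _ fun c => ?_)
    obtain ⟨a, rfl⟩ := exists_smul_oneDimGen ω c
    change A.hom (B.hom (a • oneDimGen ω)) = a • oneDimGen ω
    rw [map_smul, map_smul, oneDimHom_gen, hA]
    have : α y = 1 := hinj (by
      change α y • y = (1 : k) • y
      rw [← hα, hfy, hfy, one_smul])
    rw [this, one_smul]
  let F : C ⟶ inDegreeZero (oneDim ω) := HomologicalComplex.mkHomToSingle A (by
    intro i hi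
    obtain rfl : (1 : ℤ) = i := hi
    refine Rep.hom_ext (DFunLike.ext _ _ fun c => ?_)
    change A.hom ((C.d 1 0).hom c) = 0
    have : α ((C.d 1 0).hom c) = 0 := hinj (by
      change _ • y = (0 : k) • y
      rw [← hα, hf1, map_zero, zero_smul])
    rw [hA, this, zero_smul])
  let F' : inDegreeZero (oneDim ω) ⟶ C := HomologicalComplex.mkHomFromSingle B (by
    intro i hi
    obtain rfl : i = -1 := by
      change i + 1 = 0 at hi
      omega
    refine Rep.hom_ext (DFunLike.ext _ _ fun c => ?_)
    obtain ⟨a, rfl⟩ := exists_smul_oneDimGen ω c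
    change (C.d 0 (-1)).hom (B.hom (a • oneDimGen ω)) = 0
    rw [map_smul, oneDimHom_gen, map_smul, hy, hf2, smul_zero])
  have e1 : F ≫ F' = f ≫ f := by
    ext1 i
    by_cases hi : i = 0
    · subst hi
      rw [HomologicalComplex.comp_f, HomologicalComplex.comp_f, HomologicalComplex.mkHomToSingle_f,
        HomologicalComplex.mkHomFromSingle_f, Category.assoc, Iso.inv_hom_id_assoc, hAB]
    · rw [HomologicalComplex.comp_f, HomologicalComplex.comp_f, hf0 i hi, zero_comp,
        (boundedBy_inDegreeZero (oneDim ω) i (by omega)).eq_of_tgt (F.f i) 0, zero_comp]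
  have e2 : F' ≫ F = 𝟙 _ := by
    ext1
    rw [HomologicalComplex.comp_f, HomologicalComplex.mkHomToSingle_f,
      HomologicalComplex.mkHomFromSingle_f, Category.assoc, reassoc_of% hBA, Iso.hom_inv_id]
    rfl
  exact ⟨⟨F, F', (Homotopy.ofEq e1).trans ((hf.comp hf).trans (Homotopy.ofEq (by simp))),
    Homotopy.ofEq e2⟩⟩

end Splitting

/-! ### Complexes all of whose h-marks vanish -/

section Kernel

variable {k : Type u} [Field k] {G : Type v} [Group G]

lemma mem_nor_bot (g : G) : g ∈ Nor (⊥ : Subgroup G) :=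
  Subgroup.mem_normalizer_iff.2 fun x => by simp [Subgroup.mem_bot]

lemma mem_fixedPts_bot (M : Rep.{u} k G) (m : M) : m ∈ fixedPts (⊥ : Subgroup G) M :=
  (mem_fixedPts _ _ _).2 fun g hg => by
    rw [Subgroup.mem_bot.1 hg, map_one, Module.End.one_apply]

lemma traceSub_bot (M : Rep.{u} k G) : traceSub (⊥ : Subgroup G) M = ⊥ := by
  refine Submodule.span_eq_bot.2 ?_
  rintro _ ⟨Q, hQ, -⟩
  exact absurd hQ not_lt_bot

/-- The isomorphism `M ≅ M(1)`, as a map. -/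
def brauerBot {M : Rep.{u} k G} (m : M) : BrauerSpace (⊥ : Subgroup G) M :=
  brauerMk ⟨m, mem_fixedPts_bot M m⟩

lemma brauerBot_injective {M : Rep.{u} k G} :
    Function.Injective (brauerBot : M → BrauerSpace (⊥ : Subgroup G) M) := fun m m' h => by
  have h1 : m - m' ∈ traceSub (⊥ : Subgroup G) M := (Submodule.Quotient.eq (traceFixed ⊥ M)).1 h
  rw [traceSub_bot, Submodule.mem_bot, sub_eq_zero] at h1
  exact h1

lemma brauerBot_surjective {M : Rep.{u} k G} (x : BrauerSpace (⊥ : Subgroup G) M) :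
    ∃ m, brauerBot m = x := by
  obtain ⟨m, rfl⟩ := brauerMk_surjective x
  exact ⟨m, rfl⟩

variable [Finite G]

lemma isBoundary_brauerBot {C : ChainComplex (Rep.{u} k G) ℤ} {i : ℤ} {m : C.X i} :
    IsBoundary C ⊥ i (brauerBot m) ↔ ∃ y, (C.d (i + 1) i).hom y = m := by
  constructor
  · rintro ⟨y, hy⟩
    obtain ⟨y, rfl⟩ := brauerBot_surjective y
    exact ⟨y, brauerBot_injective hy⟩
  · rintro ⟨y, rfl⟩
    exact ⟨brauerBot y, rfl⟩

lemma isCycle_brauerBot {C : ChainComplex (Rep.{u} k G) ℤ} {i : ℤ} {m : C.X i} :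
    IsCycle C ⊥ i (brauerBot m) ↔ (C.d i (i - 1)).hom m = 0 :=
  ⟨fun h => brauerBot_injective h, fun h => congrArg brauerBot h⟩

variable {p : ℕ} [Fact p.Prime] [CharP k p]

/-- An endotrivial complex all of whose marks are in degree `0` is, up to homotopy, a
one-dimensional module in degree `0`. -/
lemma exists_htpyClass_eq_oneDim {C : ChainComplex (Rep.{u} k G) ℤ} (hC : IsEndotrivial p C)
    (h : ∀ P : Subgroup G, IsPGroup p P → ∃ χ, HasMark C P 0 χ) :
    ∃ ω : G →* kˣ, htpyClass C = htpyClass (inDegreeZero (oneDim ω)) := by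
  have hE := hC.dual
  have hEmark : ∀ P : Subgroup G, IsPGroup p P → ∃ χ, HasMark (dual C) P 0 χ := fun P hP => by
    obtain ⟨χ, hχ⟩ := h P hP
    obtain ⟨n, ψ, hψ⟩ := exists_hasMark hE hP
    have h1 := (hψ.tensor hE hC hP hχ).of_htpyClass_eq
      (D := inDegreeZero (oneDim (1 : G →* kˣ))) (by
        rw [htpyClass_inDegreeZero_congr oneDim_one, htpyClass_tensor, hC.class_dual_add,
          htpyClass_unit])
    obtain rfl : n = 0 := by simpa using h1.degree_unique (hasMark_oneDim hP 1)
    exact ⟨ψ, hψ⟩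
  have hdd : htpyClass (dual (dual C)) = htpyClass C := htpyClass_dual_dual hC.finite
  have hmark : ∀ P : Subgroup G, IsPGroup p P → ∃ χ, HasMark (dual (dual C)) P 0 χ := fun P hP => by
    obtain ⟨χ, hχ⟩ := h P hP
    exact ⟨χ, hχ.of_htpyClass_eq hdd.symm⟩
  have hC' := hE.dual
  obtain ⟨a, b, hab⟩ := hE.bounded
  obtain ⟨a', b', hab'⟩ := hC'.bounded
  have hz : ∀ D : ChainComplex (Rep.{u} k G) ℤ,
      (∀ P : Subgroup G, IsPGroup p P → ∃ χ, HasMark D P 0 χ) → ∀ Q : Subgroup G, IsPGroup p Q →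
        ∀ i < 0, IsZero (localHomology D Q i) := fun D hD Q hQ i hi => by
    obtain ⟨χ, hχ⟩ := hD Q hQ
    exact hχ.isZero i hi.ne
  -- Transposing the contraction of `C^*` gives one of `C^{**}` in positive degrees. The contraction
  -- in negative degrees is therefore built on `C^{**}` too, rather than on `C`.
  obtain ⟨s', hs'⟩ := exists_contraction_of_neg hab hE.pPermutation (hz _ hEmark)
  obtain ⟨t, ht⟩ := exists_contraction_of_pos hs'
  obtain ⟨s, hs⟩ := exists_contraction_of_neg hab' hC'.pPermutation (hz _ hmark)
  obtain ⟨χ, hχ⟩ := hmark ⊥ IsPGroup.of_bot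
  obtain ⟨x, hx, hg⟩ := hχ.spansHomology
  obtain ⟨x, rfl⟩ := brauerBot_surjective x
  -- For the trivial subgroup, `N_G(1)/1` is `G` and `C(1)` is `C`.
  let ω : G →* kˣ := χ.comp ((QuotientGroup.mk' _).comp
    ((MonoidHom.id G).codRestrict (Nor (⊥ : Subgroup G)) mem_nor_bot))
  refine ⟨ω, hdd.symm.trans (htpyClass_eq_iff.2 (nonempty_homotopyEquiv_oneDim
    -- Contracting in degree `i` uses only the maps out of degrees `i - 1` and `i`, which for `i ≠
    -- 0` come from the same family.
    (s := fun i j => if i < 0 then s i j else t i j) (fun i hi => ?_) ω x ?_ ?_ ?_ ?_))⟩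
  · unfold ContractsAt
    beta_reduce
    rcases lt_or_gt_of_ne hi with hi | hi
    · rw [if_pos (by omega), if_pos hi]
      exact hs i hi
    · rw [if_neg (by omega), if_neg (by omega)]
      exact ht i hi
  · exact isCycle_brauerBot.1 hx.cycle
  · exact fun h => hx.not_boundary (isBoundary_brauerBot.2 h)
  · intro z hz
    obtain ⟨a, ha⟩ := hx.span (brauerBot z) (isCycle_brauerBot.2 hz)
    exact ⟨a, isBoundary_brauerBot.1 ha⟩
  · exact fun g => isBoundary_brauerBot.1 (hg ⟨g, mem_nor_bot g⟩)

end Kernel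

/-! ### Ranks of abelian groups under maps with finite kernel -/

section FiniteKernel

lemma fg_and_finrank_le_of_finite_ker {A B : Type*} [AddCommGroup A] [AddCommGroup B]
    [Module.Finite ℤ B] (f : A →ₗ[ℤ] B) (hf : (LinearMap.ker f : Set A).Finite) :
    Module.Finite ℤ A ∧ Module.finrank ℤ A ≤ Module.finrank ℤ B := by
  have hfin : Module.Finite ℤ A := by
    refine ⟨Submodule.fg_of_fg_map_of_fg_inf_ker f (IsNoetherian.noetherian _) ?_⟩
    rw [top_inf_eq]
    exact ⟨hf.toFinset, by rw [Set.Finite.coe_toFinset, Submodule.span_eq]⟩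
  refine ⟨hfin, ?_⟩
  have : Finite (LinearMap.ker f) := hf
  have h0 : Module.finrank ℤ (LinearMap.ker f) = 0 := by
    refine Module.finrank_eq_zero_of_rank_eq_zero (rank_eq_zero_iff.2 fun x => ?_)
    have hx := isOfFinAddOrder_of_finite x
    exact ⟨(addOrderOf x : ℤ), by exact_mod_cast hx.addOrderOf_pos.ne', by
      rw [natCast_zsmul, addOrderOf_nsmul_eq_zero]⟩
  have h1 := Submodule.finrank_quotient_add_finrank (LinearMap.ker f)
  have h2 := Submodule.finrank_le (LinearMap.range f)
  have h3 := f.quotKerEquivRange.finrank_eq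
  omega

end FiniteKernel

/-! ### The group of endotrivial classes -/

section GroupStructure

variable (k : Type u) [Field k] (G : Type v) [Group G] (p : ℕ) [Fact p.Prime] [CharP k p]

/-- The homotopy classes of endotrivial complexes, among all homotopy classes of complexes. -/
def endotrivialSubmonoid : AddSubmonoid (ComplexClasses k G) where
  carrier := {x | ∃ C, IsEndotrivial p C ∧ htpyClass C = x}
  zero_mem' := ⟨_, isEndotrivial_oneDim 1, by
    rw [htpyClass_inDegreeZero_congr oneDim_one, htpyClass_unit]⟩
  add_mem' := by
    rintro _ _ ⟨C, hC, rfl⟩ ⟨D, hD, rfl⟩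
    exact ⟨_, hC.tensor hD, htpyClass_tensor C D⟩

lemma exists_neg_endotrivialSubmonoid (x : endotrivialSubmonoid k G p) :
    ∃ y : endotrivialSubmonoid k G p, y + x = 0 := by
  obtain ⟨_, C, hC, rfl⟩ := x
  exact ⟨⟨_, dual C, hC.dual, rfl⟩, Subtype.ext hC.class_dual_add⟩

instance : Neg (endotrivialSubmonoid k G p) :=
  ⟨fun x => (exists_neg_endotrivialSubmonoid k G p x).choose⟩

instance : AddCommGroup (endotrivialSubmonoid k G p) where
  zsmul := zsmulRec
  neg_add_cancel x := (exists_neg_endotrivialSubmonoid k G p x).choose_spec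

/-- The map `E_k(G) → ComplexClasses k G`, onto the endotrivial classes. -/
def toEndotrivialSubmonoid (x : EndotrivialClasses k G p) : endotrivialSubmonoid k G p :=
  Quotient.lift (s := htpySetoid k G p)
    (fun C => (⟨htpyClass C.1, C.1, C.2, rfl⟩ : endotrivialSubmonoid k G p))
    (fun _ _ h => Subtype.ext (htpyClass_eq_iff.2 h)) x

lemma toEndotrivialSubmonoid_bijective : Function.Bijective (toEndotrivialSubmonoid k G p) := by
  constructor
  · intro x y h
    induction x using Quotient.inductionOn with | _ C =>
    induction y using Quotient.inductionOn with | _ D =>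
    exact Quotient.sound (s := htpySetoid k G p) (htpyClass_eq_iff.1 (congrArg Subtype.val h))
  · rintro ⟨_, C, hC, rfl⟩
    exact ⟨Quotient.mk (htpySetoid k G p) ⟨C, hC⟩, rfl⟩

/-- `E_k(G)` as a subset of the homotopy classes of complexes. -/
def endotrivialEquiv : EndotrivialClasses k G p ≃ endotrivialSubmonoid k G p :=
  Equiv.ofBijective _ (toEndotrivialSubmonoid_bijective k G p)

/-- The group law of `E_k(G)`, given by the tensor product. -/
instance : AddCommGroup (EndotrivialClasses k G p) := (endotrivialEquiv k G p).addCommGroup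

variable {k G p}

lemma isClass_iff {C : ChainComplex (Rep.{u} k G) ℤ} {x : EndotrivialClasses k G p} :
    IsClass C x ↔ IsEndotrivial p C ∧
      (endotrivialEquiv k G p x : ComplexClasses k G) = htpyClass C := by
  constructor
  · rintro ⟨hC, rfl⟩
    exact ⟨hC, rfl⟩
  · rintro ⟨hC, h⟩
    exact ⟨hC, (endotrivialEquiv k G p).injective (Subtype.ext h.symm)⟩

lemma exists_isClass (x : EndotrivialClasses k G p) : ∃ C, IsClass C x := by
  obtain ⟨C, hC, h⟩ := (endotrivialEquiv k G p x).2
  exact ⟨C, isClass_iff.2 ⟨hC, h.symm⟩⟩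

lemma IsClass.isEndotrivial {C : ChainComplex (Rep.{u} k G) ℤ} {x : EndotrivialClasses k G p}
    (h : IsClass C x) : IsEndotrivial p C := (isClass_iff.1 h).1

lemma IsClass.eq {C D : ChainComplex (Rep.{u} k G) ℤ} {x y : EndotrivialClasses k G p}
    (hx : IsClass C x) (hy : IsClass D y) (h : htpyClass C = htpyClass D) : x = y :=
  (endotrivialEquiv k G p).injective
    (Subtype.ext ((isClass_iff.1 hx).2.trans (h.trans (isClass_iff.1 hy).2.symm)))

lemma IsClass.htpyClass_eq {C D : ChainComplex (Rep.{u} k G) ℤ} {x : EndotrivialClasses k G p}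
    (hC : IsClass C x) (hD : IsClass D x) : htpyClass C = htpyClass D :=
  (isClass_iff.1 hC).2.symm.trans (isClass_iff.1 hD).2

lemma IsClass.tensor {C D : ChainComplex (Rep.{u} k G) ℤ} {x y : EndotrivialClasses k G p}
    (hx : IsClass C x) (hy : IsClass D y) : IsClass (tensor C D) (x + y) := by
  refine isClass_iff.2 ⟨hx.isEndotrivial.tensor hy.isEndotrivial, ?_⟩
  have h : endotrivialEquiv k G p (x + y) = endotrivialEquiv k G p x + endotrivialEquiv k G p y :=
    (endotrivialEquiv k G p).apply_symm_apply _
  rw [h, AddSubmonoid.coe_add, (isClass_iff.1 hx).2, (isClass_iff.1 hy).2, htpyClass_tensor]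

lemma isClass_zero : IsClass (inDegreeZero (oneDim (1 : G →* kˣ))) (0 : EndotrivialClasses k G p) := by
  refine isClass_iff.2 ⟨isEndotrivial_oneDim 1, ?_⟩
  have h : endotrivialEquiv k G p 0 = 0 := (endotrivialEquiv k G p).apply_symm_apply _
  rw [h, htpyClass_inDegreeZero_congr oneDim_one, htpyClass_unit]
  rfl

/-- The class `[k_ω[0]]`. -/
def oneDimClass (ω : G →* kˣ) : EndotrivialClasses k G p :=
  Quotient.mk (htpySetoid k G p) ⟨inDegreeZero (oneDim ω), isEndotrivial_oneDim ω⟩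

lemma isClass_oneDimClass (ω : G →* kˣ) :
    IsClass (inDegreeZero (oneDim ω)) (oneDimClass ω : EndotrivialClasses k G p) := ⟨_, rfl⟩

lemma oneDimClass_mul (ω ω' : G →* kˣ) :
    (oneDimClass (ω * ω') : EndotrivialClasses k G p) = oneDimClass ω + oneDimClass ω' :=
  (isClass_oneDimClass _).eq ((isClass_oneDimClass _).tensor (isClass_oneDimClass _)) (by
    rw [htpyClass_tensor, htpyClass_tensor_inDegreeZero]
    exact (htpyClass_inDegreeZero_congr (oneDim_tensor _ _)).symm)

variable (k G p) in
/-- The homomorphism `ω ↦ [k_ω[0]]`. -/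
def oneDimClassHom : Additive (G →* kˣ) →+ EndotrivialClasses k G p :=
  AddMonoidHom.mk' (fun ω => oneDimClass ω.toMul) fun ω ω' =>
    (congrArg oneDimClass (toMul_add ω ω')).trans (oneDimClass_mul _ _)

end GroupStructure

/-! ### The homomorphisms `h` and `Ξ`, rank and torsion -/

section Marks

variable {k : Type u} [Field k] {G : Type v} [Group G]

variable {p : ℕ}

/-- The h-marks as functions on the conjugacy classes of `p`-subgroups. -/
def classFunctionsHom (p : ℕ) (G : Type v) [Group G] :
    classFunctions p G →+ (_root_.Quotient (conjSetoid p G) → ℤ) :=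
  AddMonoidHom.mk' (fun f => Quotient.lift (s := conjSetoid p G) f.1 f.2) fun f g =>
    funext fun c => by
      induction c using Quotient.inductionOn
      rfl

lemma classFunctionsHom_injective : Function.Injective (classFunctionsHom p G) := fun _ _ h =>
  Subtype.ext (funext fun P => congrFun h (Quotient.mk (conjSetoid p G) P))

variable [Finite G] [Fact p.Prime] [CharP k p]

/-- Homotopy invariance allows one pair to serve all representatives of the class. -/
lemma exists_mark (x : EndotrivialClasses k G p) (P : PSubgroup p G) :
    ∃ m : ℤ × (LocalGroup P.1 →* kˣ), ∀ C, IsClass C x → HasMark C P.1 m.1 m.2 := by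
  obtain ⟨C, hC⟩ := exists_isClass x
  obtain ⟨n, χ, h⟩ := exists_hasMark hC.isEndotrivial P.2
  exact ⟨⟨n, χ⟩, fun D hD => h.of_htpyClass_eq (hC.htpyClass_eq hD)⟩

/-- The h-mark of a class at `P`, together with the character on the homology. -/
def mark (x : EndotrivialClasses k G p) (P : PSubgroup p G) : ℤ × (LocalGroup P.1 →* kˣ) :=
  (exists_mark x P).choose

lemma IsClass.hasMark {C : ChainComplex (Rep.{u} k G) ℤ} {x : EndotrivialClasses k G p}
    (h : IsClass C x) (P : PSubgroup p G) : HasMark C P.1 (mark x P).1 (mark x P).2 :=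
  (exists_mark x P).choose_spec C h

lemma IsClass.mark_eq {C : ChainComplex (Rep.{u} k G) ℤ} {x : EndotrivialClasses k G p}
    (h : IsClass C x) {P : PSubgroup p G} {n : ℤ} {χ : LocalGroup P.1 →* kˣ}
    (h' : HasMark C P.1 n χ) : mark x P = (n, χ) :=
  Prod.ext ((h.hasMark P).degree_unique h') ((h.hasMark P).character_unique h')

lemma mark_add (x y : EndotrivialClasses k G p) (P : PSubgroup p G) :
    mark (x + y) P = ((mark x P).1 + (mark y P).1, (mark x P).2 * (mark y P).2) := by
  obtain ⟨C, hC⟩ := exists_isClass x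
  obtain ⟨D, hD⟩ := exists_isClass y
  exact (hC.tensor hD).mark_eq
    ((hC.hasMark P).tensor hC.isEndotrivial hD.isEndotrivial P.2 (hD.hasMark P))

lemma mark_add_fst (x y : EndotrivialClasses k G p) (P : PSubgroup p G) :
    (mark (x + y) P).1 = (mark x P).1 + (mark y P).1 := congrArg Prod.fst (mark_add x y P)

lemma mark_add_snd (x y : EndotrivialClasses k G p) (P : PSubgroup p G) :
    (mark (x + y) P).2 = (mark x P).2 * (mark y P).2 := congrArg Prod.snd (mark_add x y P)

variable (k G p) in
/-- The homomorphism of h-marks. -/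
def markHom : EndotrivialClasses k G p →+ classFunctions p G :=
  AddMonoidHom.mk' (fun x => ⟨fun P => (mark x P).1, fun P Q hPQ => by
    obtain ⟨C, hC⟩ := exists_isClass x
    exact HasMark.conj hPQ (hC.hasMark P) (hC.hasMark Q)⟩) fun x y =>
      Subtype.ext (funext (mark_add_fst x y))

lemma mark_zero (P : PSubgroup p G) : mark (0 : EndotrivialClasses k G p) P = (0, 1) :=
  (isClass_zero.mark_eq (hasMark_oneDim P.2 1)).trans (Prod.ext rfl (MonoidHom.ext fun g => by
    obtain ⟨g, rfl⟩ := QuotientGroup.mk_surjective g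
    rfl))

/-- The pair `Ξ(x)_P`. -/
def localDatum (x : EndotrivialClasses k G p) (P : PSubgroup p G) :
    ℤ × Additive (LocalGroup P.1 →* kˣ) := ((mark x P).1, Additive.ofMul (mark x P).2)

lemma localDatum_zero (P : PSubgroup p G) : localDatum (0 : EndotrivialClasses k G p) P = 0 := by
  rw [localDatum, mark_zero, ofMul_one]
  rfl

lemma localDatum_add (x y : EndotrivialClasses k G p) (P : PSubgroup p G) :
    localDatum (x + y) P = localDatum x P + localDatum y P := by
  rw [localDatum, mark_add_fst, mark_add_snd, ofMul_mul]
  rfl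

variable (k G p) in
/-- The homomorphism given by the h-marks and the characters on the homology. -/
def localDataHom : EndotrivialClasses k G p →+ LocalData k G p where
  toFun := localDatum
  map_zero' := funext localDatum_zero
  map_add' x y := funext (localDatum_add x y)

lemma mark_oneDimClass (ω : G →* kˣ) (P : PSubgroup p G) :
    mark (oneDimClass ω : EndotrivialClasses k G p) P = (0, localCharacter P.2 ω) :=
  (isClass_oneDimClass ω).mark_eq (hasMark_oneDim P.2 ω)

lemma mem_ker_markHom {x : EndotrivialClasses k G p} :
    x ∈ (markHom k G p).ker ↔ ∃ ω : G →* kˣ, oneDimClass ω = x := by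
  constructor
  · intro hx
    obtain ⟨C, hC⟩ := exists_isClass x
    obtain ⟨ω, hω⟩ := exists_htpyClass_eq_oneDim hC.isEndotrivial fun P hP => by
      have h := hC.hasMark ⟨P, hP⟩
      have h0 : (mark x ⟨P, hP⟩).1 = 0 :=
        congrArg (fun f : classFunctions p G => f.1 ⟨P, hP⟩) (AddMonoidHom.mem_ker.1 hx)
      rw [h0] at h
      exact ⟨_, h⟩
    exact ⟨ω, (isClass_oneDimClass ω).eq hC hω.symm⟩
  · rintro ⟨ω, rfl⟩
    exact AddMonoidHom.mem_ker.2 (Subtype.ext (funext fun P =>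
      congrArg Prod.fst (mark_oneDimClass ω P)))

/-- Vanishing h-marks give `x = [k_ω[0]]`, and the character at the trivial subgroup is `ω` itself.
-/
lemma eq_zero_of_mark {x : EndotrivialClasses k G p} (h : markHom k G p x = 0)
    (h' : ∀ g : Nor (⊥ : Subgroup G), (mark x ⟨⊥, IsPGroup.of_bot⟩).2 (QuotientGroup.mk g) = 1) :
    x = 0 := by
  obtain ⟨ω, rfl⟩ := mem_ker_markHom.1 (AddMonoidHom.mem_ker.2 h)
  obtain rfl : ω = 1 := by
    ext g
    have h1 := h' ⟨g, mem_nor_bot g⟩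
    rw [mark_oneDimClass] at h1
    exact congrArg Units.val h1
  exact (isClass_oneDimClass 1).eq isClass_zero rfl

lemma localDataHom_injective : Function.Injective (localDataHom k G p) := by
  refine (injective_iff_map_eq_zero _).2 fun x hx => eq_zero_of_mark ?_ fun g => ?_
  · exact Subtype.ext (funext fun P => congrArg (fun y : LocalData k G p => (y P).1) hx)
  · exact congrArg (fun y : LocalData k G p => (y ⟨⊥, IsPGroup.of_bot⟩).2.toMul
      (QuotientGroup.mk g)) hx

lemma oneDimClassHom_injective : Function.Injective (oneDimClassHom k G p) := by
  refine (injective_iff_map_eq_zero _).2 fun ω hω => ?_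
  have h := (mark_oneDimClass (p := p) ω.toMul ⟨⊥, IsPGroup.of_bot⟩).symm.trans
    ((congrArg (fun x => mark x ⟨⊥, IsPGroup.of_bot⟩) hω).trans
      (isClass_zero.mark_eq (hasMark_oneDim IsPGroup.of_bot 1)))
  refine Additive.toMul.injective (MonoidHom.ext fun g => ?_)
  exact DFunLike.congr_fun (congrArg Prod.snd h) (QuotientGroup.mk ⟨g, mem_nor_bot g⟩)

lemma finite_ker_markHom : ((markHom k G p).ker : Set (EndotrivialClasses k G p)).Finite :=
  (Set.finite_range (oneDimClass : (G →* kˣ) → EndotrivialClasses k G p)).subset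
    fun _ hx => mem_ker_markHom.1 hx

lemma finite_and_finrank_le : Module.Finite ℤ (EndotrivialClasses k G p) ∧
    Module.finrank ℤ (EndotrivialClasses k G p) ≤
      Nat.card (_root_.Quotient (conjSetoid p G)) := by
  have : Fintype (_root_.Quotient (conjSetoid p G)) := Fintype.ofFinite _
  have h := fg_and_finrank_le_of_finite_ker
    ((classFunctionsHom p G).comp (markHom k G p)).toIntLinearMap
    (finite_ker_markHom.subset fun x hx => AddMonoidHom.mem_ker.2 (classFunctionsHom_injective
      ((show classFunctionsHom p G (markHom k G p x) = 0 from hx).trans (map_zero _).symm)))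
  rwa [Module.finrank_pi, ← Nat.card_eq_fintype_card] at h

/-- Integer-valued functions have no torsion, while the kernel is the image of the finite group
`Hom(G, kˣ)`. -/
lemma torsion_eq_ker_markHom :
    AddCommGroup.torsion (EndotrivialClasses k G p) = (markHom k G p).ker := by
  ext x
  constructor
  · intro hx
    obtain ⟨n, hn, hn'⟩ := isOfFinAddOrder_iff_nsmul_eq_zero.1 hx
    refine AddMonoidHom.mem_ker.2 (Subtype.ext (funext fun P => ?_))
    have h := congrArg (fun f : classFunctions p G => f.1 P) (congrArg (markHom k G p) hn')
    rw [map_nsmul, map_zero] at h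
    have h' : n • ((markHom k G p x).1 P) = 0 := h
    exact (smul_eq_zero.1 h').resolve_left hn.ne'
  · intro hx
    obtain ⟨ω, rfl⟩ := mem_ker_markHom.1 hx
    exact AddMonoidHom.isOfFinAddOrder (oneDimClassHom k G p)
      (isOfFinAddOrder_of_finite (Additive.ofMul ω))

lemma oneDimClass_mem_torsion (ω : G →* kˣ) :
    oneDimClass ω ∈ AddCommGroup.torsion (EndotrivialClasses k G p) := by
  rw [torsion_eq_ker_markHom, mem_ker_markHom]
  exact ⟨ω, rfl⟩

variable (k G p) in
/-- The isomorphism from `Hom(G, kˣ)` onto the torsion subgroup. -/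
def torsionEquiv :
    Additive (G →* kˣ) ≃+ AddCommGroup.torsion (EndotrivialClasses k G p) :=
  AddEquiv.ofBijective
    ((oneDimClassHom k G p).codRestrict (AddCommGroup.torsion (EndotrivialClasses k G p))
      fun _ => oneDimClass_mem_torsion _)
    ⟨fun _ _ h => oneDimClassHom_injective (congrArg Subtype.val h), fun ⟨x, hx⟩ => by
      rw [torsion_eq_ker_markHom, mem_ker_markHom] at hx
      obtain ⟨ω, hω⟩ := hx
      exact ⟨Additive.ofMul ω, Subtype.ext hω⟩⟩

lemma coe_torsionEquiv (ω : Additive (G →* kˣ)) :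
    (torsionEquiv k G p ω : EndotrivialClasses k G p) = oneDimClass ω.toMul := rfl

end Marks
end
end EndotrivialComplexes

theorem theorem3 (p : ℕ) [Fact p.Prime] (k : Type u) [Field k] [CharP k p]
    (G : Type v) [Group G] [Finite G] :
    ∃ (_ : AddCommGroup (EndotrivialClasses k G p))
      (h : EndotrivialClasses k G p →+ classFunctions p G)
      (Ξ : EndotrivialClasses k G p →+ LocalData k G p),
      -- the group law of `E_k(G)` is `[C] + [D] = [C ⊗ D]`
      (∀ (C D : ChainComplex (Rep.{u} k G) ℤ) (x y : EndotrivialClasses k G p),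
        IsClass C x → IsClass D y → IsClass (tensor C D) (x + y)) ∧
      -- `h [C] P` is the unique degree in which `C(P)` has nonzero homology
      (∀ (C : ChainComplex (Rep.{u} k G) ℤ) (x : EndotrivialClasses k G p), IsClass C x →
        ∀ (P : PSubgroup p G) (i : ℤ), ¬ IsZero (localHomology C P.1 i) ↔ i = (h x).1 P) ∧
      -- `Ξ [C] P` is the pair of the h-mark at `P` and of the character of `N_G(P)/P` on the
      -- one-dimensional homology of `C(P)` in that degree
      (∀ (C : ChainComplex (Rep.{u} k G) ℤ) (x : EndotrivialClasses k G p), IsClass C x →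
        ∀ P : PSubgroup p G, (Ξ x P).1 = (h x).1 P ∧
          Nonempty (localHomology C P.1 ((h x).1 P) ≅ oneDim (Ξ x P).2.toMul)) ∧
      -- the kernel of `h`
      (h.ker : Set (EndotrivialClasses k G p)) =
        {x | ∃ ω : G →* kˣ, IsClass (inDegreeZero (oneDim ω)) x} ∧
      -- `Ξ` is injective
      Function.Injective Ξ ∧
      -- an element of the image of `Ξ` is determined by its integers and its character at `1`
      (∀ (a : PSubgroup p G → ℤ) (ρ : G →* kˣ),
        {y : LocalData k G p | y ∈ Set.range Ξ ∧ (∀ P, (y P).1 = a P) ∧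
          ∀ g : Nor (⊥ : Subgroup G),
            (y ⟨⊥, IsPGroup.of_bot⟩).2.toMul (QuotientGroup.mk g) = ρ g}.Subsingleton) ∧
      -- finite generation, rank and torsion
      AddGroup.FG (EndotrivialClasses k G p) ∧
      Module.finrank ℤ (EndotrivialClasses k G p) ≤ Nat.card (_root_.Quotient (conjSetoid p G)) ∧
      ∃ e : Additive (G →* kˣ) ≃+ AddCommGroup.torsion (EndotrivialClasses k G p),
        ∀ ω : G →* kˣ,
          IsClass (inDegreeZero (oneDim ω)) (e (Additive.ofMul ω) : EndotrivialClasses k G p) := by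
  refine ⟨inferInstance, markHom k G p, localDataHom k G p, fun C D x y hx hy => hx.tensor hy,
    fun C x hC P i => (hC.hasMark P).not_isZero_iff i, fun C x hC P => ⟨rfl, (hC.hasMark P).iso⟩,
    ?_, localDataHom_injective, ?_, Module.Finite.iff_addGroup_fg.1 finite_and_finrank_le.1,
    finite_and_finrank_le.2, torsionEquiv k G p, fun ω => ?_⟩
  · ext x
    refine mem_ker_markHom.trans (exists_congr fun ω => ?_)
    exact ⟨fun h => h ▸ isClass_oneDimClass ω, fun h => (isClass_oneDimClass ω).eq h rfl⟩
  · rintro a ρ _ ⟨⟨x, rfl⟩, hx, hx'⟩ _ ⟨⟨y, rfl⟩, hy, hy'⟩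
    -- For the difference of two preimages, the integers cancel and the character at the trivial
    -- subgroup is `ρ / ρ = 1`.
    refine congrArg _ (sub_eq_zero.1 (eq_zero_of_mark ?_ fun g => ?_))
    · rw [map_sub]
      refine Subtype.ext (funext fun P => ?_)
      exact sub_eq_zero.2 ((hx P).trans (hy P).symm)
    · have h := congrArg (fun z : LocalData k G p => (z ⟨⊥, IsPGroup.of_bot⟩).2.toMul
        (QuotientGroup.mk g)) (map_sub (localDataHom k G p) x y)
      exact h.trans (div_eq_one.2 ((hx' g).trans (hy' g).symm))
  · rw [coe_torsionEquiv]
    exact isClass_oneDimClass ω
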